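/- **Setting.** All quantities below may depend on $n$, and $n\to\infty$. Let $\mathbb H=\mathbb H_n$ be a real separable Hilbert space (for instance $\mathbb R^{d_n}$), and let $x_i=\bar x_i+z_i\in\mathbb H$, $i\in[n]$, with deterministic signals $\bar x_i$ and random noises $z_i$. Identify $\bar X=(\bar x_1,\dots,\bar x_n)^\top$ with the operator $\mathbb H\to\mathbb R^n$, $u\mapsto(\langle \bar x_i,u\rangle)_{i\le n}$, put $\|\bar X\|_{2,\infty}=\max_i\|\bar x_i\|$, and similarly for $X$, $Z$. Let $\mathcal H(A)$ denote the square matrix $A$ with its diagonal replaced by zero. Put $G=\mathcal H(XX^\top)$, i.e. $G_{ij}=\langle x_i,x_j\rangle\mathbf 1_{\{i\ne j\}}$; let $\mathcal H(ZX^\top)$ have entries $\langle z_i,x_j\rangle\mathbf 1_{\{i\neq j\}}$; and let $\bar G=\bar X\bar X^\top$, i.e. $\bar G_{ij}=\langle\bar x_i,\bar x_j\rangle$. Let $\lambda_1\ge\dots\ge\lambda_n$ and $u_1,\dots,u_n$ be the eigenvalues and any associated orthonormal eigenvectors of $G$, and $\bar\lambda_j$, $\bar u_j$ those of $\bar G$;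 by convention $\bar\lambda_0=+\infty$, $\bar\lambda_{n+1}=-\infty$. Let $r\ge1$, $0\le s\le n-r$, $U=(u_{s+1},\dots,u_{s+r})$, $\Lambda=\mathrm{diag}(\lambda_{s+1},\dots,\lambda_{s+r})$, and $\bar U,\bar\Lambda$ accordingly. Let $H=U^\top\bar U$ and $\mathrm{sgn}(H)=\tilde U\tilde V^\top$ for any singular value decomposition $H=\tilde U\tilde\Lambda\tilde V^\top$. Put $$\bar\Delta=\min\{\bar\lambda_s-\bar\lambda_{s+1},\ \bar\lambda_{s+r}-\bar\lambda_{s+r+1}\},\quad \kappa=\frac{\bar\lambda_1}{\bar\Delta},\quad \mu=\max\Big\{\frac{\|\bar X\|_{2,\infty}}{\|\bar X\|_{\mathrm{op}}}\sqrt{\frac nr},\,1\Big\},$$ and assume $0<\bar\Delta<\infty$ for all large $n$. (On the event that some $\lambda_{s+j}$ is negative, $\Lambda^{1/2}$ is defined with $\sqrt{\lambda_{s+j}}:=0$.) For $A\in\mathbb R^{n\times r}$ with rows $A_i$ let $\|A\|_{2,p}=(\sum_{i=1}^n\|A_i\|_2^p)^{1/p}$. For random variables $X_n,Y_n$ and deterministic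 $\rho_n$, write $X_n=O_{\mathbb P}(Y_n;\rho_n)$ if there is $C_1>0$ such that for every $C>0$ there are $C'>0$ and $N$ with $\mathbb P(|X_n|\ge C'|Y_n|)\le C_1e^{-C\rho_n}$ for all $n\ge N$; write $X_n=o_{\mathbb P}(Y_n;\rho_n)$ if $X_n=O_{\mathbb P}(w_nY_n;\rho_n)$ for some deterministic $w_n\to0$. Write $a_n\ll b_n$ for $a_n/b_n\to0$ and $a_n\lesssim b_n$ for $a_n=O(b_n)$. **Assumptions.** There are $\gamma=\gamma_n$, a constant $\alpha>0$ independent of $n$, and self-adjoint positive semi-definite trace class operators $\Sigma=\Sigma_n$ on $\mathbb H$ such that: 1. (Incoherence) $\kappa\mu\sqrt{r/n}\le\gamma$ for all large $n$, and $\gamma\ll 1/(\kappa\mu)$. 2. (Sub-Gaussianity) $z_1,\dots,z_n$ are independent zero-mean random vectors in $\mathbb H$ with $\mathbb E e^{\langle u,z_i\rangle}\le e^{\alpha^2\langle\Sigma u,u\rangle/2}$ for all $u\in\mathbb H$ and $i\in[n]$. 3. (Concentration) $\sqrt n\max\{(\kappa\|\Sigma\|_{\mathrm{op}}/\bar\Delta)^{1/2},\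 \|\Sigma\|_{\mathrm{HS}}/\bar\Delta\}\le\gamma$ for all large $n$. **Theorem.** If $p=p_n$ is real with $2\le p\lesssim(\mu\gamma)^{-2}$, then $$\|U\,\mathrm{sgn}(H)-G\bar U\bar\Lambda^{-1}\|_{2,p}=o_{\mathbb P}(\|\bar U\|_{2,p};\,p),$$ $$\|U\,\mathrm{sgn}(H)-[\bar U+\mathcal H(ZX^\top)\bar U\bar\Lambda^{-1}]\|_{2,p}=o_{\mathbb P}(\|\bar U\|_{2,p};\,p),$$ $$\|U\,\mathrm{sgn}(H)\|_{2,p}=O_{\mathbb P}(\|\bar U\|_{2,p};\,p).$$ If in addition $\kappa^{3/2}\gamma\ll1$, then $$\|U\Lambda^{1/2}\mathrm{sgn}(H)-G\bar U\bar\Lambda^{-1/2}\|_{2,p}=o_{\mathbb P}(\|\bar U\|_{2,p}\|\bar\Lambda^{1/2}\|_2;\,p),$$ $$\|U\Lambda^{1/2}\mathrm{sgn}(H)-[\bar U\bar\Lambda^{1/2}+\mathcal H(ZX^\top)\bar U\bar\Lambda^{-1/2}]\|_{2,p}=o_{\mathbb P}(\|\bar U\|_{2,p}\|\bar\Lambda^{1/2}\|_2;\,p).$$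 -/

import Mathlib

open Filter MeasureTheory ProbabilityTheory Asymptotics
open scoped Topology RealInnerProductSpace Matrix

namespace KPCA

/-! Probabilistic order notation -/

/-- `X_n = O_P(Y_n; r_n)`: there is a constant `C₁ > 0` such that for every `C > 0` there are
`C' > 0` and `N` with `P(|X_n| ≥ C' |Y_n|) ≤ C₁ exp(-C r_n)` for all `n ≥ N`.
The underlying probability space may change with `n`. -/
def IsBigOP {Ω : ℕ → Type*} [∀ n, MeasurableSpace (Ω n)] (P : ∀ n, Measure (Ω n))
    (X Y : ∀ n, Ω n → ℝ) (ρ : ℕ → ℝ) : Prop :=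
  ∃ C₁ : ℝ, 0 < C₁ ∧ ∀ C : ℝ, 0 < C → ∃ C' : ℝ, 0 < C' ∧ ∃ N : ℕ, ∀ n, N ≤ n →
    (P n).real {ω | C' * |Y n ω| ≤ |X n ω|} ≤ C₁ * Real.exp (-(C * ρ n))

/-- `X_n = o_P(Y_n; r_n)`: `X_n = O_P(w_n Y_n; r_n)` for some deterministic `w_n → 0`. -/
def IsLittleOP {Ω : ℕ → Type*} [∀ n, MeasurableSpace (Ω n)] (P : ∀ n, Measure (Ω n))
    (X Y : ∀ n, Ω n → ℝ) (ρ : ℕ → ℝ) : Prop :=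
  ∃ w : ℕ → ℝ, Tendsto w atTop (𝓝 0) ∧ IsBigOP P X (fun n ω => w n * Y n ω) ρ

/-! Matrices -/

/-- The hollowing operator: it sets the diagonal to zero. -/
def hollow {n : ℕ} (A : Matrix (Fin n) (Fin n) ℝ) : Matrix (Fin n) (Fin n) ℝ :=
  Matrix.of fun i j => if i = j then 0 else A i j

/-- The matrix `X Yᵀ` of inner products `⟨x_i, y_j⟩`, where `X` and `Y` have "rows" `x_i`, `y_j`
in an inner product space. -/
def mulTr {n : ℕ} {H : Type*} [NormedAddCommGroup H] [InnerProductSpace ℝ H]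
    (x y : Fin n → H) : Matrix (Fin n) (Fin n) ℝ :=
  Matrix.of fun i j => ⟪x i, y j⟫

/-- The entrywise norm `‖A‖_{2,p} = (∑ᵢ ‖Aᵢ‖₂ ^ p) ^ (1/p)`, with `Aᵢ` the rows of `A`. -/
noncomputable def norm2p {n r : ℕ} (p : ℝ) (A : Matrix (Fin n) (Fin r) ℝ) : ℝ :=
  (∑ i, (Real.sqrt (∑ j, A i j ^ 2)) ^ p) ^ (1 / p)

/-- The spectral norm of a square matrix. -/
noncomputable def specNorm {r : ℕ} (A : Matrix (Fin r) (Fin r) ℝ) : ℝ :=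
  ‖Matrix.toEuclideanCLM (𝕜 := ℝ) A‖

/-- `lam` lists the eigenvalues of `A` in non-increasing order, with multiplicity, and the columns
of `V` are associated orthonormal eigenvectors (an arbitrary choice of them). -/
structure IsEigendecomposition {n : ℕ} (A : Matrix (Fin n) (Fin n) ℝ) (lam : Fin n → ℝ)
    (V : Matrix (Fin n) (Fin n) ℝ) : Prop where
  antitone : Antitone lam
  orthogonal : V ∈ Matrix.orthogonalGroup (Fin n) ℝ
  eigen : A * V = V * Matrix.diagonal lam

/-- The position of the `(s + j)`-th eigenvalue, `j = 1, …, r` (both indices shifted to start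
from `0`). -/
def blockIdx {n s r : ℕ} (hsr : s + r ≤ n) (j : Fin r) : Fin n :=
  ⟨s + j, by have := j.isLt; omega⟩

/-- The `n × r` matrix of the columns number `s + 1, …, s + r` of `V`. -/
def blockCols {n s r : ℕ} (hsr : s + r ≤ n) (V : Matrix (Fin n) (Fin n) ℝ) :
    Matrix (Fin n) (Fin r) ℝ :=
  V.submatrix id (blockIdx hsr)

/-- `diag(f(λ_{s+1}), …, f(λ_{s+r}))`. -/
def blockDiag {n s r : ℕ} (hsr : s + r ≤ n) (lam : Fin n → ℝ) (f : ℝ → ℝ) :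
    Matrix (Fin r) (Fin r) ℝ :=
  Matrix.diagonal fun j => f (lam (blockIdx hsr j))

/-- `S` is a matrix sign `sgn(M) = A Bᵀ` of `M`, where `M = A diag(σ) Bᵀ` is a singular value
decomposition of `M` (an arbitrary choice of it). -/
def IsMatrixSign {r : ℕ} (M S : Matrix (Fin r) (Fin r) ℝ) : Prop :=
  ∃ A ∈ Matrix.orthogonalGroup (Fin r) ℝ, ∃ B ∈ Matrix.orthogonalGroup (Fin r) ℝ,
    ∃ σ : Fin r → ℝ, (∀ i, 0 ≤ σ i) ∧ M = A * Matrix.diagonal σ * Bᵀ ∧ S = A * Bᵀ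

/-- The eigenvalue `λ_k`, `k = 1, …, n`, with the conventions `λ_0 = +∞` and `λ_{n+1} = -∞`. -/
noncomputable def extEig {n : ℕ} (lam : Fin n → ℝ) (k : ℕ) : EReal :=
  if k = 0 then ⊤ else if h : k - 1 < n then (lam ⟨k - 1, h⟩ : EReal) else ⊥

/-- The eigen-gap `min {λ_s - λ_{s+1}, λ_{s+r} - λ_{s+r+1}}`. -/
noncomputable def eigengap {n : ℕ} (lam : Fin n → ℝ) (s r : ℕ) : EReal :=
  min (extEig lam s - extEig lam (s + 1)) (extEig lam (s + r) - extEig lam (s + r + 1))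

/-- The eigen-gap as a real number (used only when it is finite). -/
noncomputable def gap {n : ℕ} (lam : Fin n → ℝ) (s r : ℕ) : ℝ := (eigengap lam s r).toReal

/-- The condition number `κ = λ_1 / Δ`. -/
noncomputable def cond {n : ℕ} (lam : Fin n → ℝ) (s r : ℕ) : ℝ :=
  (extEig lam 1).toReal / gap lam s r

/-! Operators on Hilbert spaces -/

section Hilbert

variable {H : Type*} [NormedAddCommGroup H] [InnerProductSpace ℝ H]

/-- The operator `X : H → ℝⁿ`, `u ↦ (⟨x_1, u⟩, …, ⟨x_n, u⟩)`. -/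
noncomputable def dataOp {n : ℕ} (x : Fin n → H) : H →L[ℝ] EuclideanSpace ℝ (Fin n) :=
  ((EuclideanSpace.equiv (Fin n) ℝ).symm : (Fin n → ℝ) →L[ℝ] EuclideanSpace ℝ (Fin n)).comp
    (ContinuousLinearMap.pi fun i => innerSL ℝ (x i))

/-- The incoherence parameter `μ = max {(max_i ‖x_i‖ / ‖X‖_op) √(n/r), 1}`. -/
noncomputable def incoh {n : ℕ} (x : Fin n → H) (r : ℕ) : ℝ :=
  max ((⨆ i, ‖x i‖) / ‖dataOp x‖ * Real.sqrt ((n : ℝ) / (r : ℝ))) 1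

/-- The Hilbert–Schmidt norm `(∑_j ‖A h_j‖²)^{1/2}` with respect to an orthonormal basis. -/
noncomputable def hsNorm {ι : Type*} (h : HilbertBasis ι ℝ H) (A : H →L[ℝ] H) : ℝ :=
  Real.sqrt (∑' j, ‖A (h j)‖ ^ 2)

/-- Self-adjoint, positive semi-definite, trace class operators. -/
def IsPosTraceClass [CompleteSpace H] {ι : Type*} (h : HilbertBasis ι ℝ H) (A : H →L[ℝ] H) :
    Prop :=
  IsSelfAdjoint A ∧ (∀ u : H, 0 ≤ ⟪A u, u⟫) ∧ Summable fun j => ⟪A (h j), h j⟫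

/-- Independent zero-mean random vectors `z_i` with
`E exp⟨u, z_i⟩ ≤ exp(α² ⟨Σ u, u⟩ / 2)` for all `u`; `Sg` stands for the operator `Σ`. -/
structure IsSubGaussianNoise {n : ℕ} {Ω : Type*} [MeasurableSpace Ω] [MeasurableSpace H]
    (P : Measure Ω) (z : Fin n → Ω → H) (α : ℝ) (Sg : H →L[ℝ] H) : Prop where
  measurable : ∀ i, Measurable (z i)
  indep : iIndepFun z P
  integrable : ∀ i, Integrable (z i) P
  mean_zero : ∀ i, ∫ ω, z i ω ∂P = 0
  integrable_exp : ∀ i (u : H), Integrable (fun ω => Real.exp ⟪u, z i ω⟫) P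
  mgf_le : ∀ i (u : H), ∫ ω, Real.exp ⟪u, z i ω⟫ ∂P ≤ Real.exp (α ^ 2 * ⟪Sg u, u⟫ / 2)

end Hilbert

end KPCA

/-!
The proof is a leave-one-out analysis. Throughout, `G` is the hollowed Gram matrix of the samples,
`Ḡ` that of the signals, `Δ` the eigen-gap, `θ = √(r/n)`, and `Ū`, `U` are the two blocks of
eigenvectors.

**Operator norm.** The concentration hypothesis gives one parameter `β = (γΔ)²/n` that dominates
`‖Σ‖_HS²`, `n ‖Σ‖²` and `κΔ ‖Σ‖`. Up to a diagonal, `G - Ḡ` consists of the cross terms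
`⟨z_i, x̄_j⟩` and the strictly lower triangular part of `Z Zᵀ` with its transpose
(`sampleGram_sub_eq`). The bilinear forms of both are sums whose coefficients depend only on earlier
noise vectors, so an exponential supermartingale bounds them (`measure_predictable_ge_le`); for the
second the quadratic variation is a value of the random quadratic form `v ↦ ⟨Σ Zᵀv, Zᵀv⟩`, which is
`O(β |v|²)` by Gaussian linearisation (`measure_quadForm_sum_gt_le`). A union bound over a net yields
`‖G - Ḡ‖ = O(γΔ)`, and the Davis–Kahan theorem (`davisKahan_norm`, `davisKahan_frobSq`) shows that
the eigenspaces differ by `O(γ)`.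

**Rows.** With `H = UᵀŪ` and `P = U Uᵀ`,
`U H - G Ū Λ̄⁻¹ = (G (P Ū - Ū) - P (G - Ḡ) Ū) Λ̄⁻¹` (`mul_sub_mul_blockInv`). In the `m`-th row of the
first term, `P` is replaced by the projection `P_m` that belongs to `G` with its `m`-th row and
column set to zero; the price is `O(κ |U_m|)` (`frobSq_proj_sub_zeroRowCol_le`). What remains is a
part that comes from the signal `x̄_m`, which incoherence controls, and
`∑_{j ≠ m} ⟨z_m, x_j⟩ (P_m Ū - Ū)_j`. Since `P_m` does not depend on `z_m`, the latter is sub-Gaussian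
given the other noise vectors; adding up the `p`-th moments over `m` bounds its `‖·‖_{2,p}` norm with
probability `1 - exp(-Cp)` (`measure_norm2p_loo_ge_le`). Together, for a constant `K`,
`‖U H - G Ū Λ̄⁻¹‖_{2,p} ≤ 21 K κμγ (‖U‖_{2,p} + ‖Ū‖_{2,p})` (`norm2p_align_le`), and as `κμγ → 0` the
term in `U` on the right is absorbed. To integrate over `z_m` first one needs `P_m` to be a
measurable function of the noise: it is Lipschitz where the block of eigenvalues is separated
(`continuousOn_specProj`), and it is cut off elsewhere (`looSet`).

**The claims.** The singular values of `H` are cosines of principal angles, so replacing `H` by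
`sgn(H)` is a second-order effect (`IsMatrixSign.norm_sub_le`). The approximation by
`Ū + H(ZXᵀ) Ū Λ̄⁻¹` differs from the one by `G Ū Λ̄⁻¹` only in the terms `⟨z_j, x̄_m⟩` and the diagonal of
`Ḡ` (`norm2p_linear_le`). For the square roots, `Λ^{1/2} sgn(H) - sgn(H) Λ̄^{1/2}` is bounded through
a Sylvester equation (`norm_sqrt_comm_le`). `norm2p_bounds` collects these estimates on one event,
and `measure_not_goodEvent_le` bounds the probability that it fails by `6 exp(-Cp)`. The rate in the
`o_P` statements is `κμγ`. Incoherence is also used to see that the block does not reach the lower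
end of the spectrum, so that its eigenvalues are at least `Δ` (`add_lt_of_incoh`).
-/

/-! ### Euclidean, operator, Frobenius and `ℓ_{2,p}` norms -/

namespace KPCA

section Basics

open scoped Matrix.Norms.L2Operator

variable {ι m n l : Type*} [Fintype ι] [Fintype m] [Fintype n] [Fintype l]

/-- The Euclidean norm of a real vector indexed by a finite type. -/
noncomputable def vnorm (v : ι → ℝ) : ℝ := ‖(WithLp.toLp 2 v : EuclideanSpace ℝ ι)‖

lemma vnorm_nonneg (v : ι → ℝ) : 0 ≤ vnorm v := norm_nonneg _

lemma vnorm_sq (v : ι → ℝ) : vnorm v ^ 2 = ∑ i, v i ^ 2 := by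
  simp [vnorm, EuclideanSpace.norm_sq_eq]

lemma vnorm_eq_sqrt (v : ι → ℝ) : vnorm v = √(∑ i, v i ^ 2) := by
  rw [← vnorm_sq, Real.sqrt_sq (vnorm_nonneg v)]

lemma vnorm_sq_eq_dotProduct (v : ι → ℝ) : vnorm v ^ 2 = v ⬝ᵥ v := by
  simp [vnorm_sq v, dotProduct, ← sq]

lemma vnorm_add_le (v w : ι → ℝ) : vnorm (v + w) ≤ vnorm v + vnorm w := by
  simpa [vnorm] using norm_add_le (WithLp.toLp 2 v : EuclideanSpace ℝ ι) (WithLp.toLp 2 w)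

lemma vnorm_sub_le (v w : ι → ℝ) : vnorm (v - w) ≤ vnorm v + vnorm w := by
  simpa [vnorm] using norm_sub_le (WithLp.toLp 2 v : EuclideanSpace ℝ ι) (WithLp.toLp 2 w)

lemma vnorm_smul (c : ℝ) (v : ι → ℝ) : vnorm (c • v) = |c| * vnorm v := by
  simpa [vnorm] using norm_smul c (WithLp.toLp 2 v : EuclideanSpace ℝ ι)

@[simp] lemma vnorm_zero : vnorm (0 : ι → ℝ) = 0 := by simp [vnorm]

lemma vnorm_eq_zero {v : ι → ℝ} (h : vnorm v = 0) : v = 0 := by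
  simpa [vnorm] using h

lemma abs_dotProduct_le (v w : ι → ℝ) : |v ⬝ᵥ w| ≤ vnorm v * vnorm w := by
  have := abs_real_inner_le_norm (WithLp.toLp 2 w : EuclideanSpace ℝ ι) (WithLp.toLp 2 v)
  rw [EuclideanSpace.inner_eq_star_dotProduct] at this
  simpa [vnorm, mul_comm] using this

lemma abs_apply_le_vnorm (v : ι → ℝ) (i : ι) : |v i| ≤ vnorm v := by
  simpa [vnorm] using PiLp.norm_apply_le (WithLp.toLp 2 v : EuclideanSpace ℝ ι) i

/-- Restricting the support of a vector does not increase its norm. -/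
lemma vnorm_ite_le (p : ι → Prop) [DecidablePred p] (v : ι → ℝ) :
    vnorm (fun i => if p i then v i else 0) ≤ vnorm v := by
  rw [vnorm_eq_sqrt, vnorm_eq_sqrt]
  apply Real.sqrt_le_sqrt
  refine Finset.sum_le_sum fun i _ => ?_
  split_ifs
  · exact le_rfl
  · simpa using sq_nonneg _

set_option linter.unusedSectionVars false
variable [DecidableEq n] [DecidableEq m] [DecidableEq l]

lemma vnorm_mulVec_le (A : Matrix m n ℝ) (v : n → ℝ) : vnorm (A *ᵥ v) ≤ ‖A‖ * vnorm v := by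
  simpa [vnorm] using Matrix.l2_opNorm_mulVec A (WithLp.toLp 2 v)

lemma norm_le_of_mulVec (A : Matrix m n ℝ) {c : ℝ} (hc : 0 ≤ c)
    (h : ∀ v, vnorm (A *ᵥ v) ≤ c * vnorm v) : ‖A‖ ≤ c := by
  rw [Matrix.l2_opNorm_def]
  refine ContinuousLinearMap.opNorm_le_bound _ hc fun x => ?_
  have := h x.ofLp
  rwa [vnorm, vnorm] at this

lemma norm_transpose (A : Matrix m n ℝ) : ‖Aᵀ‖ = ‖A‖ := by
  have := Matrix.l2_opNorm_conjTranspose A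
  rwa [Matrix.conjTranspose_eq_transpose_of_trivial] at this

lemma norm_mul_le' (A : Matrix m n ℝ) (B : Matrix n l ℝ) : ‖A * B‖ ≤ ‖A‖ * ‖B‖ :=
  Matrix.l2_opNorm_mul A B

lemma vnorm_vecMul_le (A : Matrix m n ℝ) (v : m → ℝ) : vnorm (v ᵥ* A) ≤ vnorm v * ‖A‖ := by
  rw [← Matrix.mulVec_transpose, mul_comm, ← norm_transpose A]
  exact vnorm_mulVec_le _ _

lemma vnorm_row_le (A : Matrix m n ℝ) (i : m) : vnorm (A i) ≤ ‖A‖ := by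
  have h := vnorm_vecMul_le A (Pi.single i 1)
  have h1 : vnorm (Pi.single i 1 : m → ℝ) = 1 := by simp [vnorm]
  rw [h1, one_mul, Matrix.single_one_vecMul] at h
  exact h

lemma norm_diagonal_le (d : n → ℝ) {c : ℝ} (hc : 0 ≤ c) (h : ∀ i, |d i| ≤ c) :
    ‖Matrix.diagonal d‖ ≤ c := by
  rw [Matrix.l2_opNorm_diagonal]
  exact (pi_norm_le_iff_of_nonneg hc).2 h

lemma abs_entry_le_norm (A : Matrix m n ℝ) (i : m) (j : n) : |A i j| ≤ ‖A‖ :=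
  (abs_apply_le_vnorm (A i) j).trans (vnorm_row_le A i)

/-- Orthonormal columns: multiplication on the left is an isometry. -/
lemma vnorm_mulVec_of_orthonormal {U : Matrix m n ℝ} (hU : Uᵀ * U = 1) (v : n → ℝ) :
    vnorm (U *ᵥ v) = vnorm v := by
  have : vnorm (U *ᵥ v) ^ 2 = vnorm v ^ 2 := by
    rw [vnorm_sq_eq_dotProduct, vnorm_sq_eq_dotProduct, Matrix.dotProduct_mulVec,
      ← Matrix.mulVec_transpose, Matrix.mulVec_mulVec, hU, Matrix.one_mulVec]
  exact (sq_eq_sq₀ (vnorm_nonneg _) (vnorm_nonneg _)).1 this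

lemma norm_le_one_of_orthonormal {U : Matrix m n ℝ} (hU : Uᵀ * U = 1) : ‖U‖ ≤ 1 :=
  norm_le_of_mulVec U zero_le_one fun v => by rw [vnorm_mulVec_of_orthonormal hU, one_mul]

/-- The squared Frobenius norm. -/
noncomputable def frobSq (A : Matrix m n ℝ) : ℝ := ∑ i, ∑ j, A i j ^ 2

lemma frobSq_nonneg (A : Matrix m n ℝ) : 0 ≤ frobSq A := by
  unfold frobSq; positivity

lemma frobSq_eq_trace (A : Matrix m n ℝ) : frobSq A = (Aᵀ * A).trace := by
  simp only [frobSq, Matrix.trace, Matrix.diag, Matrix.mul_apply, Matrix.transpose_apply]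
  rw [Finset.sum_comm]
  simp [sq]

lemma frobSq_eq_sum_col (A : Matrix m n ℝ) : frobSq A = ∑ j, vnorm (fun i => A i j) ^ 2 := by
  simp only [frobSq, vnorm_sq]
  rw [Finset.sum_comm]

lemma norm_le_sqrt_frobSq (A : Matrix m n ℝ) : ‖A‖ ≤ √(frobSq A) := by
  refine norm_le_of_mulVec A (Real.sqrt_nonneg _) fun v => ?_
  rw [vnorm_eq_sqrt (A *ᵥ v), vnorm_eq_sqrt v, ← Real.sqrt_mul (frobSq_nonneg A), frobSq,
    Finset.sum_mul]
  refine Real.sqrt_le_sqrt (Finset.sum_le_sum fun i _ => ?_)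
  exact Finset.sum_mul_sq_le_sq_mul_sq _ _ _

end Basics

section Lp

variable {ι : Type*} [Fintype ι]

/-- The `ℓ_p` norm of a real vector. -/
noncomputable def lpn (p : ℝ) (a : ι → ℝ) : ℝ := (∑ i, |a i| ^ p) ^ (1 / p)

lemma lpn_nonneg (p : ℝ) (a : ι → ℝ) : 0 ≤ lpn p a := by unfold lpn; positivity

lemma lpn_add_le {p : ℝ} (hp : 1 ≤ p) (a b : ι → ℝ) : lpn p (a + b) ≤ lpn p a + lpn p b :=
  Real.Lp_add_le Finset.univ a b hp

lemma lpn_mono {p : ℝ} (hp : 0 < p) {a b : ι → ℝ} (h : ∀ i, |a i| ≤ b i) :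
    lpn p a ≤ lpn p b := by
  unfold lpn
  refine Real.rpow_le_rpow (by positivity) (Finset.sum_le_sum fun i _ => ?_) (by positivity)
  exact Real.rpow_le_rpow (abs_nonneg _) ((h i).trans (le_abs_self _)) hp.le

lemma lpn_const_mul {p : ℝ} (hp : 0 < p) (c : ℝ) (a : ι → ℝ) :
    lpn p (fun i => c * a i) = |c| * lpn p a := by
  unfold lpn
  simp_rw [abs_mul, Real.mul_rpow (abs_nonneg _) (abs_nonneg _)]
  rw [← Finset.mul_sum, Real.mul_rpow (by positivity) (by positivity), ← Real.rpow_mul (abs_nonneg _),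
    mul_one_div_cancel hp.ne', Real.rpow_one]

lemma lpn_const {n : ℕ} {p : ℝ} (hp : 0 < p) {c : ℝ} (hc : 0 ≤ c) :
    lpn p (fun _ : Fin n => c) = (n : ℝ) ^ (1 / p) * c := by
  unfold lpn
  rw [Finset.sum_const, Finset.card_univ, Fintype.card_fin, nsmul_eq_mul, abs_of_nonneg hc,
    Real.mul_rpow (by positivity) (by positivity), ← Real.rpow_mul hc, mul_one_div_cancel hp.ne',
    Real.rpow_one]

lemma norm2p_eq_lpn {n r : ℕ} (p : ℝ) (A : Matrix (Fin n) (Fin r) ℝ) :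
    norm2p p A = lpn p fun i => vnorm (A i) := by
  unfold norm2p lpn
  congr 1
  refine Finset.sum_congr rfl fun i _ => ?_
  rw [abs_of_nonneg (vnorm_nonneg _), vnorm_eq_sqrt]

variable {n r k : ℕ} {p : ℝ}

lemma norm2p_nonneg (A : Matrix (Fin n) (Fin r) ℝ) : 0 ≤ norm2p p A := by
  rw [norm2p_eq_lpn]; exact lpn_nonneg _ _

lemma norm2p_le_lpn (hp : 0 < p) {A : Matrix (Fin n) (Fin r) ℝ} {b : Fin n → ℝ}
    (h : ∀ i, vnorm (A i) ≤ b i) : norm2p p A ≤ lpn p b := by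
  rw [norm2p_eq_lpn]
  exact lpn_mono hp fun i => by rw [abs_of_nonneg (vnorm_nonneg _)]; exact h i

lemma norm2p_add_le (hp : 1 ≤ p) (A B : Matrix (Fin n) (Fin r) ℝ) :
    norm2p p (A + B) ≤ norm2p p A + norm2p p B := by
  rw [norm2p_eq_lpn p A, norm2p_eq_lpn p B]
  exact (norm2p_le_lpn (by linarith) fun i => vnorm_add_le (A i) (B i)).trans (lpn_add_le hp _ _)

open scoped Matrix.Norms.L2Operator in
lemma norm2p_mul_le (hp : 0 < p) (A : Matrix (Fin n) (Fin r) ℝ) (B : Matrix (Fin r) (Fin k) ℝ) :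
    norm2p p (A * B) ≤ norm2p p A * ‖B‖ := by
  have h := norm2p_le_lpn hp (A := A * B) (b := fun i => ‖B‖ * vnorm (A i)) fun i => by
    rw [mul_comm, Matrix.mul_apply_eq_vecMul]
    exact vnorm_vecMul_le B (A i)
  rwa [lpn_const_mul hp, abs_of_nonneg (norm_nonneg B), ← norm2p_eq_lpn, mul_comm] at h

lemma norm2p_neg (A : Matrix (Fin n) (Fin r) ℝ) : norm2p p (-A) = norm2p p A := by
  simp [norm2p]

lemma norm2p_sub_le (hp : 1 ≤ p) (A B : Matrix (Fin n) (Fin r) ℝ) :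
    norm2p p (A - B) ≤ norm2p p A + norm2p p B := by
  rw [sub_eq_add_neg, ← norm2p_neg B]
  exact norm2p_add_le hp _ _

/-- Power mean inequality: among the matrices with a given Frobenius norm the `‖·‖_{2,p}` norm is
smallest when all rows have the same length. -/
lemma rpow_mul_sqrt_le_norm2p (hn : 0 < n) (hp : 2 ≤ p) (A : Matrix (Fin n) (Fin r) ℝ) :
    (n : ℝ) ^ (1 / p) * √(frobSq A / n) ≤ norm2p p A := by
  have hn' : (0 : ℝ) < n := by exact_mod_cast hn
  have hp0 : 0 < p := by linarith
  have key := Real.rpow_arith_mean_le_arith_mean_rpow Finset.univ (fun _ : Fin n => (1 / n : ℝ))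
    (fun i => vnorm (A i) ^ 2) (fun _ _ => by positivity) (by simp [hn'.ne'])
    (fun _ _ => by positivity) (p := p / 2) (by linarith)
  have h1 : ∀ i, (vnorm (A i) ^ 2) ^ (p / 2) = vnorm (A i) ^ p := fun i => by
    rw [← Real.rpow_natCast, ← Real.rpow_mul (vnorm_nonneg _)]
    congr 1; push_cast; ring
  simp_rw [h1, ← Finset.mul_sum, vnorm_sq] at key
  have h2 : (∑ i, ∑ j, A i j ^ 2) = frobSq A := rfl
  rw [h2, one_div_mul_eq_div, one_div_mul_eq_div, le_div_iff₀ hn'] at key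
  have hf : 0 ≤ frobSq A / n := div_nonneg (frobSq_nonneg A) hn'.le
  have h3 : norm2p p A = (∑ i, vnorm (A i) ^ p) ^ (1 / p) := by
    rw [norm2p_eq_lpn, lpn]; simp_rw [abs_of_nonneg (vnorm_nonneg _)]
  rw [h3]
  calc (n : ℝ) ^ (1 / p) * √(frobSq A / n)
      = ((frobSq A / n) ^ (p / 2) * n) ^ (1 / p) := by
        rw [Real.mul_rpow (by positivity) hn'.le, ← Real.rpow_mul hf, Real.sqrt_eq_rpow, mul_comm]
        congr 2; field_simp
    _ ≤ _ := by gcongr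

end Lp

end KPCA

/-! ### Eigenvalue perturbation and matrix signs -/

namespace KPCA

section Spectral

open scoped Matrix.Norms.L2Operator

variable {n r s : ℕ}

lemma transpose_mul_self_of_mem_orthogonalGroup {V : Matrix (Fin n) (Fin n) ℝ}
    (h : V ∈ Matrix.orthogonalGroup (Fin n) ℝ) : Vᵀ * V = 1 := by
  simpa [Matrix.star_eq_conjTranspose] using (Matrix.mem_orthogonalGroup_iff' _ _).1 h

lemma mul_transpose_self_of_mem_orthogonalGroup {V : Matrix (Fin n) (Fin n) ℝ}
    (h : V ∈ Matrix.orthogonalGroup (Fin n) ℝ) : V * Vᵀ = 1 := by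
  simpa [Matrix.star_eq_conjTranspose] using (Matrix.mem_orthogonalGroup_iff _ _).1 h

namespace IsEigendecomposition

variable {A B : Matrix (Fin n) (Fin n) ℝ} {la lb : Fin n → ℝ} {V W : Matrix (Fin n) (Fin n) ℝ}

lemma tmul (h : IsEigendecomposition A la V) : Vᵀ * V = 1 :=
  transpose_mul_self_of_mem_orthogonalGroup h.orthogonal

lemma mult (h : IsEigendecomposition A la V) : V * Vᵀ = 1 :=
  mul_transpose_self_of_mem_orthogonalGroup h.orthogonal

lemma eq_conj (h : IsEigendecomposition A la V) : A = V * Matrix.diagonal la * Vᵀ := by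
  rw [← h.eigen, Matrix.mul_assoc, h.mult, Matrix.mul_one]

lemma vnorm_transpose (h : IsEigendecomposition A la V) (v : Fin n → ℝ) :
    vnorm (Vᵀ *ᵥ v) = vnorm v :=
  vnorm_mulVec_of_orthonormal (by simpa using h.mult) v

lemma quadForm (h : IsEigendecomposition A la V) (v : Fin n → ℝ) :
    v ⬝ᵥ (A *ᵥ v) = ∑ i, la i * (Vᵀ *ᵥ v) i ^ 2 := by
  conv_lhs => rw [h.eq_conj]
  rw [← Matrix.mulVec_mulVec, ← Matrix.mulVec_mulVec, Matrix.dotProduct_mulVec,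
    ← Matrix.mulVec_transpose]
  simp only [dotProduct, Matrix.mulVec_diagonal]
  exact Finset.sum_congr rfl fun i _ => by ring

/-- One half of Weyl's inequality. A nonzero vector that is orthogonal to the first `i`
eigenvectors of `B` and to the eigenvectors of `A` after the `i`-th exists by a dimension count,
and the two quadratic forms are compared there. -/
lemma le_add_norm_sub (hA : IsEigendecomposition A la V) (hB : IsEigendecomposition B lb W)
    (i : Fin n) : la i ≤ lb i + ‖A - B‖ := by
  -- the `i`-th condition is void, so that `f` has a nontrivial kernel
  let f : (Fin n → ℝ) →ₗ[ℝ] (Fin n → ℝ) := LinearMap.pi fun k =>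
    if k < i then (LinearMap.proj k).comp (Matrix.mulVecLin Wᵀ)
    else if i < k then (LinearMap.proj k).comp (Matrix.mulVecLin Vᵀ) else 0
  have hf : ¬ Function.Injective f := by
    rw [LinearMap.injective_iff_surjective]
    intro hs
    obtain ⟨x, hx⟩ := hs (Pi.single i 1)
    have := congrFun hx i
    simp [f] at this
  obtain ⟨x, hx, hx0⟩ : ∃ x, f x = 0 ∧ x ≠ 0 := by
    by_contra! hcon
    exact hf ((injective_iff_map_eq_zero f).2 fun x hx => hcon x hx)
  have h1 : ∀ k, k < i → (Wᵀ *ᵥ x) k = 0 := fun k hk => by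
    have := congrFun hx k
    simpa [f, hk, ← Matrix.mulVec_transpose] using this
  have h2 : ∀ k, i < k → (Vᵀ *ᵥ x) k = 0 := fun k hk => by
    have := congrFun hx k
    simpa [f, hk, hk.le.not_gt, ← Matrix.mulVec_transpose] using this
  have hpos : 0 < vnorm x ^ 2 := by
    have : vnorm x ≠ 0 := fun h => hx0 (vnorm_eq_zero h)
    positivity
  have hq1 : la i * vnorm x ^ 2 ≤ x ⬝ᵥ (A *ᵥ x) := by
    rw [hA.quadForm, ← hA.vnorm_transpose, vnorm_sq, Finset.mul_sum]
    refine Finset.sum_le_sum fun k _ => ?_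
    rcases lt_or_ge i k with hk | hk
    · simp [h2 k hk]
    · exact mul_le_mul_of_nonneg_right (hA.antitone hk) (sq_nonneg _)
  have hq2 : x ⬝ᵥ (B *ᵥ x) ≤ lb i * vnorm x ^ 2 := by
    rw [hB.quadForm, ← hB.vnorm_transpose, vnorm_sq, Finset.mul_sum]
    refine Finset.sum_le_sum fun k _ => ?_
    rcases lt_or_ge k i with hk | hk
    · simp [h1 k hk]
    · exact mul_le_mul_of_nonneg_right (hB.antitone hk) (sq_nonneg _)
  have hq3 : x ⬝ᵥ (A *ᵥ x) - x ⬝ᵥ (B *ᵥ x) ≤ ‖A - B‖ * vnorm x ^ 2 := by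
    rw [← dotProduct_sub, ← Matrix.sub_mulVec]
    refine (le_abs_self _).trans ((abs_dotProduct_le _ _).trans ?_)
    nlinarith [vnorm_mulVec_le (A - B) x, vnorm_nonneg x]
  have : la i * vnorm x ^ 2 ≤ (lb i + ‖A - B‖) * vnorm x ^ 2 := by linarith
  exact le_of_mul_le_mul_right this hpos

/-- Weyl's inequality. -/
lemma abs_sub_le (hA : IsEigendecomposition A la V) (hB : IsEigendecomposition B lb W)
    (i : Fin n) : |la i - lb i| ≤ ‖A - B‖ := by
  have h1 := hA.le_add_norm_sub hB i
  have h2 := hB.le_add_norm_sub hA i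
  rw [norm_sub_rev] at h2
  rw [abs_le]; constructor <;> linarith

end IsEigendecomposition

/-- Every symmetric matrix has an eigendecomposition with eigenvalues in non-increasing order. -/
lemma exists_isEigendecomposition {A : Matrix (Fin n) (Fin n) ℝ} (hA : Aᵀ = A) :
    ∃ la V, IsEigendecomposition A la V := by
  have hH : A.IsHermitian := by
    rwa [Matrix.IsHermitian, Matrix.conjTranspose_eq_transpose_of_trivial]
  set σ := Tuple.sort (fun i => -hH.eigenvalues i)
  set Q : Matrix (Fin n) (Fin n) ℝ := hH.eigenvectorUnitary.1
  have hQ : Q ∈ Matrix.orthogonalGroup (Fin n) ℝ := hH.eigenvectorUnitary.2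
  have hQ1 : Qᵀ * Q = 1 := transpose_mul_self_of_mem_orthogonalGroup hQ
  have hAQ : A * Q = Q * Matrix.diagonal hH.eigenvalues := by
    ext i j
    have := congrFun (hH.mulVec_eigenvectorBasis j) i
    rw [Matrix.mul_diagonal]
    simpa [Q, Matrix.mul_apply, Matrix.mulVec, dotProduct, Matrix.IsHermitian.eigenvectorUnitary_apply,
      mul_comm] using this
  refine ⟨fun i => hH.eigenvalues (σ i), Q.submatrix id σ, ⟨?_, ?_, ?_⟩⟩
  · intro i j hij
    have := Tuple.monotone_sort (fun i => -hH.eigenvalues i) hij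
    simpa using this
  · rw [Matrix.mem_orthogonalGroup_iff']
    ext i j
    have := congrFun (congrFun hQ1 (σ i)) (σ j)
    simp only [Matrix.mul_apply, Matrix.transpose_apply, Matrix.submatrix_apply, id] at this ⊢
    rw [this]
    simp [Matrix.one_apply]
  · ext i j
    have := congrFun (congrFun hAQ i) (σ j)
    rw [Matrix.mul_diagonal] at this ⊢
    simpa [Matrix.mul_apply] using this

/-- The indices `s, …, s + r - 1` of the block. -/
def InBlock (s r : ℕ) (i : Fin n) : Prop := s ≤ (i : ℕ) ∧ (i : ℕ) < s + r

instance : DecidablePred (InBlock (n := n) s r) := fun _ => inferInstanceAs (Decidable (_ ∧ _))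

lemma blockIdx_injective (hsr : s + r ≤ n) : Function.Injective (blockIdx (n := n) hsr) := by
  intro i j h
  simp only [blockIdx, Fin.mk.injEq] at h
  exact Fin.ext (by omega)

lemma inBlock_blockIdx (hsr : s + r ≤ n) (j : Fin r) : InBlock s r (blockIdx hsr j) := by
  have := j.isLt
  simp only [InBlock, blockIdx]; omega

lemma sum_blockIdx (hsr : s + r ≤ n) (f : Fin n → ℝ) :
    ∑ j, f (blockIdx hsr j) = ∑ i, if InBlock s r i then f i else 0 := by
  rw [← Finset.sum_filter]
  refine Finset.sum_bij (fun j _ => blockIdx hsr j) ?_ ?_ ?_ ?_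
  · intro j _; simpa using inBlock_blockIdx hsr j
  · intro i _ j _ h; exact blockIdx_injective hsr h
  · intro i hi
    have hi' : InBlock s r i := by simpa using hi
    refine ⟨⟨i - s, by have := hi'.1; have := hi'.2; omega⟩, Finset.mem_univ _, ?_⟩
    have := hi'.1
    exact Fin.ext (by simp only [blockIdx]; omega)
  · intro _ _; rfl

variable {A B : Matrix (Fin n) (Fin n) ℝ} {la lb : Fin n → ℝ} {V W : Matrix (Fin n) (Fin n) ℝ}

lemma blockCols_orthonormal (hsr : s + r ≤ n) (hV : Vᵀ * V = 1) :
    (blockCols hsr V)ᵀ * blockCols hsr V = 1 := by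
  ext i j
  have := congrFun (congrFun hV (blockIdx hsr i)) (blockIdx hsr j)
  simp only [blockCols, Matrix.mul_apply, Matrix.transpose_apply, Matrix.submatrix_apply,
    id] at this ⊢
  rw [this]
  simp [Matrix.one_apply, (blockIdx_injective hsr).eq_iff]

lemma mul_blockCols (hsr : s + r ≤ n) (h : IsEigendecomposition A la V) :
    A * blockCols hsr V = blockCols hsr V * blockDiag hsr la id := by
  ext i j
  have := congrFun (congrFun h.eigen i) (blockIdx hsr j)
  rw [Matrix.mul_diagonal] at this
  rw [blockDiag, Matrix.mul_diagonal]
  simpa [Matrix.mul_apply, blockCols] using this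

lemma blockCols_mul_transpose (hsr : s + r ≤ n) (V : Matrix (Fin n) (Fin n) ℝ) :
    blockCols hsr V * (blockCols hsr V)ᵀ =
      V * Matrix.diagonal (fun i => if InBlock s r i then 1 else 0) * Vᵀ := by
  ext a b
  rw [Matrix.mul_apply, Matrix.mul_apply]
  simp only [Matrix.mul_diagonal, blockCols, Matrix.transpose_apply, Matrix.submatrix_apply, id]
  rw [sum_blockIdx hsr (fun i => V a i * V b i)]
  exact Finset.sum_congr rfl fun i _ => by split_ifs <;> simp

lemma one_sub_blockProj (hsr : s + r ≤ n) (h : IsEigendecomposition A la V) :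
    1 - blockCols hsr V * (blockCols hsr V)ᵀ =
      V * Matrix.diagonal (fun i => if InBlock s r i then 0 else 1) * Vᵀ := by
  rw [blockCols_mul_transpose]
  conv_lhs => rw [← h.mult]
  rw [← Matrix.sub_mul]
  congr 1
  ext a b
  simp only [Matrix.sub_apply, Matrix.mul_diagonal]
  split_ifs <;> simp

lemma transpose_mulVec_one_sub_blockProj (hsr : s + r ≤ n) (h : IsEigendecomposition A la V)
    (y : Fin n → ℝ) (i : Fin n) :
    (Vᵀ *ᵥ ((1 - blockCols hsr V * (blockCols hsr V)ᵀ) *ᵥ y)) i =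
      if InBlock s r i then 0 else (Vᵀ *ᵥ y) i := by
  rw [one_sub_blockProj hsr h, Matrix.mulVec_mulVec, ← Matrix.mul_assoc, ← Matrix.mul_assoc, h.tmul,
    Matrix.one_mul, ← Matrix.mulVec_mulVec, Matrix.mulVec_diagonal]
  split_ifs <;> simp

lemma vnorm_one_sub_blockProj_le (hsr : s + r ≤ n) (h : IsEigendecomposition A la V)
    (y : Fin n → ℝ) :
    vnorm ((1 - blockCols hsr V * (blockCols hsr V)ᵀ) *ᵥ y) ≤ vnorm y := by
  rw [← h.vnorm_transpose, ← h.vnorm_transpose y]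
  have := vnorm_ite_le (fun i => ¬ InBlock s r i) (Vᵀ *ᵥ y)
  convert this using 2
  ext i
  rw [transpose_mulVec_one_sub_blockProj hsr h]
  split_ifs <;> rfl

lemma transpose_mulVec_shift (h : IsEigendecomposition A la V) (c : ℝ) (y : Fin n → ℝ)
    (i : Fin n) : (Vᵀ *ᵥ (A *ᵥ y - c • y)) i = (la i - c) * (Vᵀ *ᵥ y) i := by
  have : Vᵀ *ᵥ (A *ᵥ y) = Matrix.diagonal la *ᵥ (Vᵀ *ᵥ y) := by
    conv_lhs => rw [h.eq_conj]
    rw [Matrix.mulVec_mulVec, ← Matrix.mul_assoc, ← Matrix.mul_assoc, h.tmul, Matrix.one_mul,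
      Matrix.mulVec_mulVec]
  rw [Matrix.mulVec_sub, Matrix.mulVec_smul, this]
  simp only [Pi.sub_apply, Matrix.mulVec_diagonal, Pi.smul_apply, smul_eq_mul]
  ring

/-- Outside the block `A - c` is bounded below by the distance of `c` to the other eigenvalues;
as `A - c` commutes with the spectral projection, this bounds the component of `y` outside the
block. -/
lemma mul_vnorm_one_sub_blockProj_le (hsr : s + r ≤ n) (h : IsEigendecomposition A la V) {c t : ℝ}
    (ht : 0 ≤ t) (hc : ∀ i, ¬ InBlock s r i → t ≤ |la i - c|) (y : Fin n → ℝ) :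
    t * vnorm ((1 - blockCols hsr V * (blockCols hsr V)ᵀ) *ᵥ y) ≤
      vnorm ((1 - blockCols hsr V * (blockCols hsr V)ᵀ) *ᵥ (A *ᵥ y - c • y)) := by
  rw [← h.vnorm_transpose, ← h.vnorm_transpose ((1 - _) *ᵥ (A *ᵥ y - c • y))]
  refine le_of_sq_le_sq ?_ (vnorm_nonneg _)
  rw [mul_pow, vnorm_sq, vnorm_sq, Finset.mul_sum]
  refine Finset.sum_le_sum fun i _ => ?_
  rw [transpose_mulVec_one_sub_blockProj hsr h, transpose_mulVec_one_sub_blockProj hsr h,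
    transpose_mulVec_shift h]
  split_ifs with hi
  · simp
  · rw [mul_pow, ← sq_abs (la i - c)]
    gcongr
    exact hc i hi

/-- The eigenvalues `la` outside the block are separated by `δ` from the eigenvalues `lb` inside
the block, on the correct side. -/
def BlockGap (la lb : Fin n → ℝ) (s r : ℕ) (δ : ℝ) : Prop :=
  ∀ i j : Fin n, ¬ InBlock s r i → InBlock s r j →
    (i < j → lb j + δ ≤ la i) ∧ (j < i → la i + δ ≤ lb j)

lemma BlockGap.le_abs (h : BlockGap la lb s r δ) {i j : Fin n} (hi : ¬ InBlock s r i)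
    (hj : InBlock s r j) : δ ≤ |la i - lb j| := by
  rcases lt_trichotomy i j with hij | hij | hij
  · exact le_trans (by linarith [(h i j hi hj).1 hij]) (le_abs_self _)
  · exact absurd (hij ▸ hj) hi
  · exact le_trans (by linarith [(h i j hi hj).2 hij]) (neg_le_abs _)

lemma BlockGap.perturb {la' lb' : Fin n → ℝ} {ε ε' : ℝ} (h : BlockGap la lb s r δ)
    (ha : ∀ i, |la' i - la i| ≤ ε) (hb : ∀ i, |lb' i - lb i| ≤ ε') :
    BlockGap la' lb' s r (δ - ε - ε') := by
  intro i j hi hj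
  have h1 := abs_le.1 (ha i)
  have h2 := abs_le.1 (hb j)
  exact ⟨fun hij => by linarith [(h i j hi hj).1 hij], fun hij => by linarith [(h i j hi hj).2 hij]⟩

/-- Davis–Kahan, one vector at a time, in the Frobenius norm. -/
lemma davisKahan_frobSq (hsr : s + r ≤ n) (hA : IsEigendecomposition A la V)
    (hB : IsEigendecomposition B lb W) {δ : ℝ} (hδ : 0 ≤ δ) (hg : BlockGap la lb s r δ) :
    δ ^ 2 * frobSq ((1 - blockCols hsr V * (blockCols hsr V)ᵀ) * blockCols hsr W) ≤
      frobSq ((A - B) * blockCols hsr W) := by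
  rw [frobSq_eq_sum_col, frobSq_eq_sum_col, Finset.mul_sum]
  refine Finset.sum_le_sum fun j _ => ?_
  have hcol : ∀ C : Matrix (Fin n) (Fin n) ℝ, (fun i => (C * blockCols hsr W) i j) =
      C *ᵥ (fun i => blockCols hsr W i j) := fun C => rfl
  rw [hcol, hcol, ← mul_pow]
  set w := fun i => blockCols hsr W i j
  have hw : B *ᵥ w = lb (blockIdx hsr j) • w := by
    have := mul_blockCols hsr hB
    ext i
    have h2 := congrFun (congrFun this i) j
    rw [blockDiag, Matrix.mul_diagonal] at h2
    rw [Pi.smul_apply, smul_eq_mul, mul_comm]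
    exact h2
  have h1 := mul_vnorm_one_sub_blockProj_le hsr hA hδ (c := lb (blockIdx hsr j))
    (fun i hi => hg.le_abs hi (inBlock_blockIdx hsr j)) w
  have h2 := vnorm_one_sub_blockProj_le hsr hA (A *ᵥ w - lb (blockIdx hsr j) • w)
  rw [← hw, ← Matrix.sub_mulVec] at h1 h2
  exact pow_le_pow_left₀ (mul_nonneg hδ (vnorm_nonneg _)) (h1.trans h2) 2

/-- The Davis–Kahan `sin Θ` theorem in the operator norm, for a block of eigenvalues separated
from the others on both sides. Shifting by the midpoint of the block makes the two sides of the
gap alike. -/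
lemma davisKahan_norm (hsr : s + r ≤ n) (hr : 1 ≤ r) (hA : IsEigendecomposition A la V)
    (hB : IsEigendecomposition B lb W) {δ : ℝ} (hδ : 0 ≤ δ) (hg : BlockGap la lb s r δ) :
    δ * ‖(1 - blockCols hsr V * (blockCols hsr V)ᵀ) * blockCols hsr W‖ ≤ ‖A - B‖ := by
  set X := (1 - blockCols hsr V * (blockCols hsr V)ᵀ) * blockCols hsr W with hX
  set j0 : Fin n := ⟨s, by omega⟩
  set j1 : Fin n := ⟨s + r - 1, by omega⟩
  set c := (lb j0 + lb j1) / 2 with hc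
  set ρ := (lb j0 - lb j1) / 2 with hρ'
  have hj0 : InBlock s r j0 := by simp only [InBlock, j0]; omega
  have hj1 : InBlock s r j1 := by simp only [InBlock, j1]; omega
  have hρ : 0 ≤ ρ := by
    have : lb j1 ≤ lb j0 := hB.antitone (by simp only [j0, j1, Fin.mk_le_mk]; omega)
    rw [hρ']; linarith
  have hin : ∀ j : Fin r, |lb (blockIdx hsr j) - c| ≤ ρ := fun j => by
    have hj := j.isLt
    have h0 : lb (blockIdx hsr j) ≤ lb j0 := hB.antitone (by
      simp only [j0, blockIdx, Fin.mk_le_mk]; omega)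
    have h1 : lb j1 ≤ lb (blockIdx hsr j) := hB.antitone (by
      simp only [j1, blockIdx, Fin.mk_le_mk]; omega)
    rw [abs_le, hc, hρ']; constructor <;> linarith
  have hout : ∀ i, ¬ InBlock s r i → ρ + δ ≤ |la i - c| := fun i hi => by
    rcases lt_or_ge (i : ℕ) s with h | h
    · have := (hg i j0 hi hj0).1 h
      exact le_trans (by rw [hc, hρ']; linarith) (le_abs_self _)
    · have h3 : s + r ≤ (i : ℕ) := by
        by_contra h4; exact hi ⟨h, by omega⟩
      have := (hg i j1 hi hj1).2 (by rw [Fin.lt_def]; simp only [j1]; omega)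
      exact le_trans (by rw [hc, hρ']; linarith) (neg_le_abs _)
  have hU1 : ‖blockCols hsr W‖ ≤ 1 := norm_le_one_of_orthonormal (blockCols_orthonormal hsr hB.tmul)
  -- `(A - c) W = (A - B) W + W (Λ_B - c)`, and `‖Λ_B - c‖ ≤ ρ`; the second term contributes `ρ ‖X‖`,
  -- which is absorbed on the left
  have key : ∀ v : Fin r → ℝ, (ρ + δ) * vnorm (X *ᵥ v) ≤ (‖A - B‖ + ‖X‖ * ρ) * vnorm v := by
    intro v
    have h1 := mul_vnorm_one_sub_blockProj_le hsr hA (by linarith) hout (blockCols hsr W *ᵥ v)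
    have h2 : A *ᵥ (blockCols hsr W *ᵥ v) - c • (blockCols hsr W *ᵥ v) =
        (A - B) *ᵥ (blockCols hsr W *ᵥ v) +
          blockCols hsr W *ᵥ (Matrix.diagonal (fun j => lb (blockIdx hsr j) - c) *ᵥ v) := by
      have h3 : Matrix.diagonal (fun j => lb (blockIdx hsr j) - c) =
          blockDiag hsr lb id - c • (1 : Matrix (Fin r) (Fin r) ℝ) := by
        ext a b
        by_cases hab : a = b
        · subst hab; simp [blockDiag]
        · simp [blockDiag, hab]
      rw [h3, Matrix.sub_mulVec, Matrix.sub_mulVec, Matrix.mulVec_sub, Matrix.mulVec_mulVec,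
        Matrix.mulVec_mulVec v B, mul_blockCols hsr hB, Matrix.smul_mulVec, Matrix.one_mulVec,
        Matrix.mulVec_smul, ← Matrix.mulVec_mulVec v (blockCols hsr W)]
      abel
    rw [h2, Matrix.mulVec_add, Matrix.mulVec_mulVec (Matrix.diagonal _ *ᵥ v) _ (blockCols hsr W),
      Matrix.mulVec_mulVec v _ (blockCols hsr W), ← hX] at h1
    refine h1.trans ((vnorm_add_le _ _).trans ?_)
    have h4 : vnorm ((1 - blockCols hsr V * (blockCols hsr V)ᵀ) *ᵥ
        ((A - B) *ᵥ (blockCols hsr W *ᵥ v))) ≤ ‖A - B‖ * vnorm v := by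
      refine (vnorm_one_sub_blockProj_le hsr hA _).trans ((vnorm_mulVec_le _ _).trans ?_)
      gcongr
      exact (vnorm_mulVec_of_orthonormal (blockCols_orthonormal hsr hB.tmul) v).le
    have h5 : vnorm (X *ᵥ (Matrix.diagonal (fun j => lb (blockIdx hsr j) - c) *ᵥ v)) ≤
        ‖X‖ * (ρ * vnorm v) := by
      refine (vnorm_mulVec_le _ _).trans ?_
      gcongr
      refine (vnorm_mulVec_le _ _).trans ?_
      gcongr
      · exact vnorm_nonneg _
      · exact norm_diagonal_le _ hρ hin
    linarith
  rcases (add_nonneg hρ hδ).eq_or_lt with h0 | hpos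
  · have : δ = 0 := by linarith
    rw [this, zero_mul]; exact norm_nonneg _
  have hXb : ‖X‖ ≤ (‖A - B‖ + ‖X‖ * ρ) / (ρ + δ) := by
    refine norm_le_of_mulVec X (by positivity) fun v => ?_
    rw [div_mul_eq_mul_div, le_div_iff₀ hpos, mul_comm]
    exact key v
  rw [le_div_iff₀ hpos] at hXb
  linarith

/-- Two orthogonal projections of the same rank: the Frobenius distance is determined by one of
the two off-diagonal parts. -/
lemma frobSq_proj_sub {m k : Type*} [Fintype m] [Fintype k] [DecidableEq m] [DecidableEq k]
    {U W : Matrix m k ℝ} (hU : Uᵀ * U = 1) (hW : Wᵀ * W = 1) :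
    frobSq (U * Uᵀ - W * Wᵀ) = 2 * frobSq ((1 - W * Wᵀ) * U) := by
  have hUt : (U * Uᵀ).trace = Fintype.card k := by rw [Matrix.trace_mul_comm, hU, Matrix.trace_one]
  have hWt : (W * Wᵀ).trace = Fintype.card k := by rw [Matrix.trace_mul_comm, hW, Matrix.trace_one]
  have hUU : U * Uᵀ * (U * Uᵀ) = U * Uᵀ := by
    rw [Matrix.mul_assoc, ← Matrix.mul_assoc Uᵀ, hU, Matrix.one_mul]
  have hWW : W * Wᵀ * (W * Wᵀ) = W * Wᵀ := by
    rw [Matrix.mul_assoc, ← Matrix.mul_assoc Wᵀ, hW, Matrix.one_mul]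
  have h1 : frobSq (U * Uᵀ - W * Wᵀ) = 2 * Fintype.card k - 2 * (W * Wᵀ * (U * Uᵀ)).trace := by
    rw [frobSq_eq_trace]
    have : (U * Uᵀ - W * Wᵀ)ᵀ = U * Uᵀ - W * Wᵀ := by simp
    rw [this, Matrix.sub_mul, Matrix.mul_sub, Matrix.mul_sub, hUU, hWW]
    simp only [Matrix.trace_sub, hUt, hWt]
    rw [Matrix.trace_mul_comm (U * Uᵀ) (W * Wᵀ)]
    ring
  have h2 : frobSq ((1 - W * Wᵀ) * U) = Fintype.card k - (W * Wᵀ * (U * Uᵀ)).trace := by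
    rw [frobSq_eq_trace]
    have h3 : ((1 - W * Wᵀ) * U)ᵀ * ((1 - W * Wᵀ) * U) = 1 - Uᵀ * (W * Wᵀ * U) := by
      have : (1 - W * Wᵀ)ᵀ * (1 - W * Wᵀ) = 1 - W * Wᵀ := by
        simp [Matrix.sub_mul, Matrix.mul_sub, hWW]
      rw [Matrix.transpose_mul, Matrix.mul_assoc, ← Matrix.mul_assoc _ _ U, this, Matrix.sub_mul,
        Matrix.mul_sub, Matrix.one_mul, hU]
    rw [h3, Matrix.trace_sub, Matrix.trace_one, Matrix.trace_mul_comm, Matrix.mul_assoc]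
  rw [h1, h2]; ring

lemma IsMatrixSign.orthonormal {M S : Matrix (Fin r) (Fin r) ℝ} (h : IsMatrixSign M S) :
    Sᵀ * S = 1 := by
  obtain ⟨A, hA, B, hB, σ, -, -, rfl⟩ := h
  rw [Matrix.transpose_mul, Matrix.transpose_transpose, Matrix.mul_assoc, ← Matrix.mul_assoc Aᵀ,
    transpose_mul_self_of_mem_orthogonalGroup hA, Matrix.one_mul,
    mul_transpose_self_of_mem_orthogonalGroup hB]

/-- The matrix sign of `Uᵀ W` is close to `Uᵀ W`: the singular values are the cosines of the
principal angles, and `1 - cos ≤ sin²`. -/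
lemma IsMatrixSign.norm_sub_le {U W : Matrix (Fin n) (Fin r) ℝ} {S : Matrix (Fin r) (Fin r) ℝ}
    (hU : Uᵀ * U = 1) (hW : Wᵀ * W = 1) (h : IsMatrixSign (Uᵀ * W) S) :
    ‖Uᵀ * W - S‖ ≤ ‖(1 - U * Uᵀ) * W‖ ^ 2 := by
  obtain ⟨A, hA, B, hB, σ, hσ, hM, rfl⟩ := h
  have hA1 := transpose_mul_self_of_mem_orthogonalGroup hA
  have hB1 := transpose_mul_self_of_mem_orthogonalGroup hB
  have hB2 := mul_transpose_self_of_mem_orthogonalGroup hB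
  set X := (1 - U * Uᵀ) * W with hX
  have hXX : Xᵀ * X = 1 - (Uᵀ * W)ᵀ * (Uᵀ * W) := by
    have h2 : (1 - U * Uᵀ)ᵀ * (1 - U * Uᵀ) = 1 - U * Uᵀ := by
      have : U * Uᵀ * (U * Uᵀ) = U * Uᵀ := by
        rw [Matrix.mul_assoc, ← Matrix.mul_assoc Uᵀ, hU, Matrix.one_mul]
      simp [Matrix.sub_mul, Matrix.mul_sub, this]
    rw [hX, Matrix.transpose_mul, Matrix.mul_assoc, ← Matrix.mul_assoc _ _ W, h2, Matrix.sub_mul,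
      Matrix.mul_sub, Matrix.one_mul, hW, Matrix.transpose_mul, Matrix.transpose_transpose]
    simp only [Matrix.mul_assoc]
  -- `XᵀX = 1 - HᵀH` has the eigenvalues `1 - σᵢ²`
  have hσ2 : ∀ i, 1 - σ i ^ 2 = vnorm (X *ᵥ (B *ᵥ Pi.single i 1)) ^ 2 := by
    intro i
    have e1 : (Bᵀ * (Xᵀ * X) * B) i i = vnorm (X *ᵥ (B *ᵥ Pi.single i 1)) ^ 2 := by
      rw [vnorm_sq]
      have : Bᵀ * (Xᵀ * X) * B = (X * B)ᵀ * (X * B) := by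
        rw [Matrix.transpose_mul X B]; simp only [Matrix.mul_assoc]
      rw [this, Matrix.mulVec_mulVec, Matrix.mul_apply]
      simp [sq]
    rw [← e1, hXX, hM]
    have : Bᵀ * (1 - (A * Matrix.diagonal σ * Bᵀ)ᵀ * (A * Matrix.diagonal σ * Bᵀ)) * B =
        1 - Matrix.diagonal σ * Matrix.diagonal σ := by
      rw [Matrix.mul_sub, Matrix.sub_mul, Matrix.mul_one, hB1]
      congr 1
      calc _ = (Bᵀ * B) * Matrix.diagonal σ * (Aᵀ * A) * Matrix.diagonal σ * (Bᵀ * B) := by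
            simp only [Matrix.transpose_mul, Matrix.transpose_transpose,
              Matrix.diagonal_transpose, Matrix.mul_assoc]
        _ = _ := by rw [hA1, hB1]; simp
    rw [this]
    simp [sq]
  have hd : Uᵀ * W - A * Bᵀ = A * Matrix.diagonal (fun i => σ i - 1) * Bᵀ := by
    have : Matrix.diagonal (fun i => σ i - 1) = Matrix.diagonal σ - 1 := by
      rw [← Matrix.diagonal_one, Matrix.diagonal_sub]
    rw [hM, this, Matrix.mul_sub, Matrix.sub_mul, Matrix.mul_one]
  rw [hd]
  have hdiag : ‖Matrix.diagonal (fun i => σ i - 1)‖ ≤ ‖X‖ ^ 2 := by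
    refine norm_diagonal_le _ (by positivity) fun i => ?_
    have h1 := hσ2 i
    have h2 : vnorm (X *ᵥ (B *ᵥ Pi.single i 1)) ≤ ‖X‖ := by
      refine (vnorm_mulVec_le _ _).trans ?_
      rw [vnorm_mulVec_of_orthonormal hB1]
      simp [vnorm]
    have h3 : vnorm (X *ᵥ (B *ᵥ Pi.single i 1)) ^ 2 ≤ ‖X‖ ^ 2 :=
      pow_le_pow_left₀ (vnorm_nonneg _) h2 2
    have h4 : 0 ≤ vnorm (X *ᵥ (B *ᵥ Pi.single i 1)) ^ 2 := sq_nonneg _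
    have h5 := hσ i
    rw [abs_le]; constructor <;> nlinarith
  calc ‖A * Matrix.diagonal (fun i => σ i - 1) * Bᵀ‖
      ≤ ‖A‖ * ‖Matrix.diagonal (fun i => σ i - 1)‖ * ‖Bᵀ‖ :=
        (norm_mul_le' _ _).trans (by gcongr; exact norm_mul_le' _ _)
    _ ≤ 1 * ‖X‖ ^ 2 * 1 := by
        rw [norm_transpose]
        have := norm_le_one_of_orthonormal hA1
        have := norm_le_one_of_orthonormal hB1
        gcongr
    _ = _ := by ring

/-- Perturbation of square roots: if `a, b ≥ c² > 0` then `diag(√a) S - S diag(√b)` is smaller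
than `diag(a) S - S diag(b)` by the factor `2c`. Evaluate the quadratic form of
`√A (√A - √B) + (√A - √B) √B = A - B` at an eigenvector of `√A - √B`. -/
lemma norm_sqrt_comm_le {S : Matrix (Fin r) (Fin r) ℝ} (hS : Sᵀ * S = 1) {a b : Fin r → ℝ} {c : ℝ}
    (hc : 0 < c) (ha : ∀ i, c ^ 2 ≤ a i) (hb : ∀ i, c ^ 2 ≤ b i) :
    2 * c * ‖Matrix.diagonal (fun i => √(a i)) * S - S * Matrix.diagonal (fun i => √(b i))‖ ≤
      ‖Matrix.diagonal a * S - S * Matrix.diagonal b‖ := by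
  have hS' : S * Sᵀ = 1 := mul_eq_one_comm.1 hS
  set Da := Matrix.diagonal (fun i => √(a i))
  set Db := Matrix.diagonal (fun i => √(b i))
  set R := Matrix.diagonal a * S - S * Matrix.diagonal b with hR
  have hDa : Da * Da = Matrix.diagonal a := by
    rw [Matrix.diagonal_mul_diagonal]
    congr 1; ext i; exact Real.mul_self_sqrt ((sq_nonneg c).trans (ha i))
  have hDb : Db * Db = Matrix.diagonal b := by
    rw [Matrix.diagonal_mul_diagonal]
    congr 1; ext i; exact Real.mul_self_sqrt ((sq_nonneg c).trans (hb i))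
  set D := Da - S * Db * Sᵀ with hD
  have hDsym : Dᵀ = D := by
    simp [hD, Da, Db, Matrix.mul_assoc]
  have hY : Da * S - S * Db = D * S := by
    rw [hD, Matrix.sub_mul, Matrix.mul_assoc (S * Db), hS, Matrix.mul_one]
  have hS1 : ‖S‖ ≤ 1 := norm_le_one_of_orthonormal hS
  -- `D` is symmetric and solves the Sylvester equation `√A D + D S √B Sᵀ = R Sᵀ`
  have hRS : R * Sᵀ = Da * D + D * (S * Db * Sᵀ) := by
    have e : S * Db * Sᵀ * (S * Db * Sᵀ) = S * Matrix.diagonal b * Sᵀ := by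
      calc _ = S * Db * (Sᵀ * S) * Db * Sᵀ := by simp only [Matrix.mul_assoc]
        _ = S * (Db * Db) * Sᵀ := by rw [hS]; simp only [Matrix.mul_one, Matrix.mul_assoc]
        _ = _ := by rw [hDb]
    rw [hD, Matrix.mul_sub, Matrix.sub_mul Da _ (S * Db * Sᵀ), e, hDa, hR, Matrix.sub_mul, Matrix.mul_assoc _ S, hS',
      Matrix.mul_one]
    abel
  obtain ⟨d, V, hV⟩ := exists_isEigendecomposition hDsym
  have hlow : ∀ (e : Fin r → ℝ), (∀ i, c ^ 2 ≤ e i) → ∀ x : Fin r → ℝ,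
      c * vnorm x ^ 2 ≤ x ⬝ᵥ (Matrix.diagonal (fun i => √(e i)) *ᵥ x) := by
    intro e he x
    rw [vnorm_sq, Finset.mul_sum, dotProduct]
    refine Finset.sum_le_sum fun i _ => ?_
    rw [Matrix.mulVec_diagonal]
    nlinarith [Real.le_sqrt_of_sq_le (he i), sq_nonneg (x i)]
  have hRSn : ‖R * Sᵀ‖ ≤ ‖R‖ := by
    refine (norm_mul_le' _ _).trans ?_
    rw [norm_transpose]
    exact mul_le_of_le_one_right (norm_nonneg _) hS1
  have hd : ∀ i, |d i| ≤ ‖R‖ / (2 * c) := by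
    intro i
    set x : Fin r → ℝ := V *ᵥ Pi.single i 1
    have hx1 : vnorm x = 1 := by
      rw [vnorm_mulVec_of_orthonormal hV.tmul]; simp [vnorm]
    have hDx : D *ᵥ x = d i • x := by
      rw [Matrix.mulVec_mulVec, hV.eigen, ← Matrix.mulVec_mulVec, ← Matrix.mulVec_smul]
      congr 1
      ext k
      rw [Matrix.mulVec_diagonal]
      by_cases hk : k = i
      · subst hk; simp
      · simp [hk]
    have hxD : ∀ y, x ⬝ᵥ (D *ᵥ y) = d i * (x ⬝ᵥ y) := fun y => by
      rw [Matrix.dotProduct_mulVec, ← Matrix.mulVec_transpose, hDsym, hDx, smul_dotProduct,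
        smul_eq_mul]
    have h1 : x ⬝ᵥ ((R * Sᵀ) *ᵥ x) = d i * (x ⬝ᵥ (Da *ᵥ x) + x ⬝ᵥ ((S * Db * Sᵀ) *ᵥ x)) := by
      rw [hRS, Matrix.add_mulVec, dotProduct_add, ← Matrix.mulVec_mulVec, hDx, Matrix.mulVec_smul,
        dotProduct_smul, ← Matrix.mulVec_mulVec, hxD, smul_eq_mul]
      ring
    have h2 := hlow a ha x
    have h3 : c ≤ x ⬝ᵥ ((S * Db * Sᵀ) *ᵥ x) := by
      have h4 := hlow b hb (Sᵀ *ᵥ x)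
      have h5 : vnorm (Sᵀ *ᵥ x) = 1 := by
        rw [vnorm_mulVec_of_orthonormal (by simpa using hS'), hx1]
      rw [h5] at h4
      rw [← Matrix.mulVec_mulVec, ← Matrix.mulVec_mulVec, Matrix.dotProduct_mulVec,
        ← Matrix.mulVec_transpose]
      simpa using h4
    rw [hx1] at h2
    have h6 : |x ⬝ᵥ ((R * Sᵀ) *ᵥ x)| ≤ ‖R‖ := by
      refine (abs_dotProduct_le _ _).trans ?_
      have := vnorm_mulVec_le (R * Sᵀ) x
      rw [hx1] at this ⊢
      linarith
    rw [h1, abs_mul] at h6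
    have h7 : 2 * c ≤ |x ⬝ᵥ (Da *ᵥ x) + x ⬝ᵥ ((S * Db * Sᵀ) *ᵥ x)| :=
      le_trans (by simp only [Da] at h2 ⊢; linarith) (le_abs_self _)
    rw [le_div_iff₀ (by positivity)]
    exact (mul_le_mul_of_nonneg_left h7 (abs_nonneg _)).trans h6
  have hDn : ‖D‖ ≤ ‖R‖ / (2 * c) := by
    rw [hV.eq_conj]
    calc ‖V * Matrix.diagonal d * Vᵀ‖ ≤ ‖V‖ * ‖Matrix.diagonal d‖ * ‖Vᵀ‖ :=
          (norm_mul_le' _ _).trans (by gcongr; exact norm_mul_le' _ _)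
      _ ≤ 1 * (‖R‖ / (2 * c)) * 1 := by
          rw [norm_transpose]
          have := norm_le_one_of_orthonormal hV.tmul
          gcongr
          exact norm_diagonal_le _ (by positivity) hd
      _ = _ := by ring
  rw [hY]
  have h8 : ‖D * S‖ ≤ ‖R‖ / (2 * c) := (norm_mul_le' _ _).trans
    ((mul_le_of_le_one_right (norm_nonneg _) hS1).trans hDn)
  rw [le_div_iff₀ (by positivity)] at h8
  linarith

end Spectral

end KPCA

/-! ### Exponential moments of independent sub-Gaussian vectors -/

namespace KPCA

section Chernoff

open scoped ENNReal

/-- The exponential of a real number, as an extended nonnegative real. -/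
noncomputable def eexp (x : ℝ) : ℝ≥0∞ := ENNReal.ofReal (Real.exp x)

lemma eexp_add (x y : ℝ) : eexp (x + y) = eexp x * eexp y := by
  rw [eexp, Real.exp_add, ENNReal.ofReal_mul (Real.exp_pos x).le]; rfl

@[simp] lemma eexp_zero : eexp 0 = 1 := by simp [eexp]

lemma eexp_mono {x y : ℝ} (h : x ≤ y) : eexp x ≤ eexp y :=
  ENNReal.ofReal_le_ofReal (Real.exp_le_exp.2 h)


lemma eexp_ne_top (x : ℝ) : eexp x ≠ ∞ := ENNReal.ofReal_ne_top

lemma eexp_sum {ι : Type*} (s : Finset ι) (f : ι → ℝ) : eexp (∑ i ∈ s, f i) = ∏ i ∈ s, eexp (f i) := by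
  classical
  induction s using Finset.induction_on with
  | empty => simp
  | insert a s ha ih => rw [Finset.sum_insert ha, Finset.prod_insert ha, eexp_add, ih]

lemma continuous_eexp : Continuous eexp := ENNReal.continuous_ofReal.comp Real.continuous_exp

lemma measurable_eexp : Measurable eexp := continuous_eexp.measurable

lemma eexp_neg_mul (x : ℝ) : eexp (-x) * eexp x = 1 := by rw [← eexp_add]; simp

/-- The exponential Markov inequality. -/
lemma measure_le_of_lintegral_eexp_le {Ω : Type*} [MeasurableSpace Ω] {P : Measure Ω} {F : Ω → ℝ}
    (hF : Measurable F) {a τ : ℝ} (h : ∫⁻ ω, eexp (F ω) ∂P ≤ eexp a) :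
    P {ω | τ ≤ F ω} ≤ eexp (a - τ) := by
  have h1 := mul_meas_ge_le_lintegral (μ := P) (measurable_eexp.comp hF) (eexp τ)
  have h2 : P {ω | τ ≤ F ω} ≤ P {ω | eexp τ ≤ (eexp ∘ F) ω} :=
    measure_mono fun ω hω => eexp_mono hω
  calc P {ω | τ ≤ F ω} = eexp (-τ) * (eexp τ * P {ω | τ ≤ F ω}) := by
        rw [← mul_assoc, eexp_neg_mul, one_mul]
    _ ≤ eexp (-τ) * eexp a := by
        gcongr
        exact (mul_le_mul_right h2 _).trans (h1.trans h)
    _ = eexp (a - τ) := by rw [← eexp_add]; congr 1; ring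

end Chernoff

section Product

open scoped ENNReal

variable {δ : Type*} [Fintype δ] [DecidableEq δ] {X : δ → Type*} [∀ i, MeasurableSpace (X i)]

/-- Resampling one coordinate does not change an integral over a product space. -/
lemma lintegral_pi_update (μ : ∀ i, Measure (X i)) [∀ i, IsProbabilityMeasure (μ i)]
    {f : (∀ i, X i) → ℝ≥0∞} (hf : Measurable f) (m : δ) :
    ∫⁻ x, f x ∂Measure.pi μ = ∫⁻ x, ∫⁻ y, f (Function.update x m y) ∂μ m ∂Measure.pi μ := by
  have h : (∫⋯∫⁻_{m}, f ∂μ) = fun x => ∫⁻ y, f (Function.update x m y) ∂μ m :=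
    lmarginal_singleton f m
  rw [← h]
  refine lintegral_eq_of_lmarginal_eq {m} hf (hf.lmarginal μ) ?_
  rw [lmarginal_singleton (∫⋯∫⁻_{m}, f ∂μ)]
  ext x
  simp_rw [h, Function.update_idem]
  simp

end Product

section Martingale

open scoped ENNReal

variable {H : Type*} [NormedAddCommGroup H] [InnerProductSpace ℝ H] [SecondCountableTopology H]
  [MeasurableSpace H] [BorelSpace H]

/-- `ν` is sub-Gaussian with variance proxy `α² Σ`. -/
def SubGaussianLaw (ν : Measure H) (α : ℝ) (Sg : H →L[ℝ] H) : Prop :=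
  ∀ u : H, ∫⁻ y, eexp ⟪u, y⟫ ∂ν ≤ eexp (α ^ 2 * ⟪Sg u, u⟫ / 2)

lemma measurable_quadForm (Sg : H →L[ℝ] H) {Ω : Type*} [MeasurableSpace Ω] {f : Ω → H}
    (hf : Measurable f) : Measurable fun ω => ⟪Sg (f ω), f ω⟫ :=
  (Sg.continuous.measurable.comp hf).inner hf

variable {n : ℕ} {ν : Fin n → Measure H} [∀ i, IsProbabilityMeasure (ν i)] {α : ℝ}
  {Sg : H →L[ℝ] H}

/-- The exponential supermartingale: if `Y_i` depends only on the coordinates before `i`, then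
`E exp ∑ᵢ (⟨Y_i, z_i⟩ - α² ⟨Σ Y_i, Y_i⟩ / 2) ≤ 1`. -/
lemma lintegral_eexp_predictable_le (hν : ∀ i, SubGaussianLaw (ν i) α Sg)
    (Y : Fin n → (Fin n → H) → H) (hY : ∀ i, Measurable (Y i))
    (hpred : ∀ i j z y, i ≤ j → Y i (Function.update z j y) = Y i z) :
    ∫⁻ z, eexp (∑ i, (⟪Y i z, z i⟫ - α ^ 2 * ⟪Sg (Y i z), Y i z⟫ / 2)) ∂Measure.pi ν ≤ 1 := by
  set t : Fin n → (Fin n → H) → ℝ :=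
    fun i z => ⟪Y i z, z i⟫ - α ^ 2 * ⟪Sg (Y i z), Y i z⟫ / 2 with ht
  have htm : ∀ i, Measurable (t i) := fun i =>
    ((hY i).inner (measurable_pi_apply i)).sub
      (((measurable_quadForm Sg (hY i)).const_mul _).div_const _)
  -- induction on the number of summands; the last noise vector is integrated out first
  have key : ∀ k, k ≤ n →
      ∫⁻ z, eexp (∑ i : Fin n, if (i : ℕ) < k then t i z else 0) ∂Measure.pi ν ≤ 1 := by
    intro k
    induction k with
    | zero => intro _; simp
    | succ k ih =>
      intro hk
      set m : Fin n := ⟨k, hk⟩ with hm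
      have hsum : ∀ z, (∑ i : Fin n, if (i : ℕ) < k + 1 then t i z else 0) =
          (∑ i : Fin n, if (i : ℕ) < k then t i z else 0) + t m z := by
        intro z
        have : t m z = ∑ i, if i = m then t i z else 0 := by simp
        rw [this, ← Finset.sum_add_distrib]
        refine Finset.sum_congr rfl fun i _ => ?_
        by_cases h1 : i = m
        · subst h1; simp [hm]
        · have h2 : (i : ℕ) ≠ k := fun h => h1 (Fin.ext h)
          by_cases h3 : (i : ℕ) < k
          · simp [h1, h3, Nat.lt_succ_of_lt h3]
          · have : ¬ (i : ℕ) < k + 1 := by omega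
            simp [h1, h3, this]
      have hmeas : Measurable fun z => eexp (∑ i : Fin n, if (i : ℕ) < k + 1 then t i z else 0) := by
        refine measurable_eexp.comp (Finset.measurable_sum _ fun i _ => ?_)
        split_ifs
        · exact htm i
        · exact measurable_const
      rw [lintegral_pi_update ν hmeas m]
      refine le_trans (lintegral_mono fun z => ?_) (ih (by omega))
      have h1 : ∀ y, (∑ i : Fin n, if (i : ℕ) < k then t i (Function.update z m y) else 0) =
          ∑ i : Fin n, if (i : ℕ) < k then t i z else 0 := by
        intro y
        refine Finset.sum_congr rfl fun i _ => ?_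
        split_ifs with hi
        · have hne : i ≠ m := fun h => by subst h; simp [hm] at hi
          have hle : i ≤ m := Fin.le_def.2 hi.le
          simp only [ht, hpred i m z y hle, Function.update_of_ne hne]
        · rfl
      have h2 : ∀ y, t m (Function.update z m y) =
          ⟪Y m z, y⟫ + (-(α ^ 2 * ⟪Sg (Y m z), Y m z⟫ / 2)) := by
        intro y
        simp only [ht, hpred m m z y le_rfl, Function.update_self]; ring
      simp_rw [hsum, h1, h2, eexp_add]
      have hme : Measurable fun y : H => eexp ⟪Y m z, y⟫ :=
        measurable_eexp.comp (measurable_const.inner measurable_id)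
      rw [lintegral_const_mul _ (hme.mul_const _), lintegral_mul_const _ hme]
      calc _ ≤ eexp (∑ i : Fin n, if (i : ℕ) < k then t i z else 0) *
            (eexp (α ^ 2 * ⟪Sg (Y m z), Y m z⟫ / 2) *
              eexp (-(α ^ 2 * ⟪Sg (Y m z), Y m z⟫ / 2))) := by
            gcongr
            exact hν m _
        _ = _ := by rw [mul_comm (eexp (α ^ 2 * _ / 2)), eexp_neg_mul, mul_one]
  have h := key n le_rfl
  simp only [Fin.is_lt, if_true] at h
  exact h

/-- Freedman-type tail bound for predictable sums. -/
lemma measure_predictable_ge_le (hν : ∀ i, SubGaussianLaw (ν i) α Sg)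
    (Y : Fin n → (Fin n → H) → H) (hY : ∀ i, Measurable (Y i))
    (hpred : ∀ i j z y, i ≤ j → Y i (Function.update z j y) = Y i z) {b s τ : ℝ} (hs : 0 ≤ s) :
    Measure.pi ν {z | τ ≤ ∑ i, ⟪Y i z, z i⟫ ∧ ∑ i, ⟪Sg (Y i z), Y i z⟫ ≤ b} ≤
      eexp (α ^ 2 * s ^ 2 * b / 2 - s * τ) := by
  have h1 := lintegral_eexp_predictable_le hν (fun i z => s • Y i z)
    (fun i => (hY i).const_smul s) (fun i j z y hij => by simp only [hpred i j z y hij])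
  have hsum : ∀ z : Fin n → H,
      (∑ i, (⟪s • Y i z, z i⟫ - α ^ 2 * ⟪Sg (s • Y i z), s • Y i z⟫ / 2)) =
      s * (∑ i, ⟪Y i z, z i⟫) - α ^ 2 * s ^ 2 * (∑ i, ⟪Sg (Y i z), Y i z⟫) / 2 := by
    intro z
    simp only [map_smul, real_inner_smul_left, real_inner_smul_right, Finset.sum_sub_distrib,
      Finset.mul_sum, Finset.sum_div]
    congr 1
    exact Finset.sum_congr rfl fun i _ => by ring
  simp_rw [hsum] at h1
  have hF : Measurable fun z : Fin n → H =>
      s * (∑ i, ⟪Y i z, z i⟫) - α ^ 2 * s ^ 2 * (∑ i, ⟪Sg (Y i z), Y i z⟫) / 2 :=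
    ((Finset.measurable_sum _ fun i _ => (hY i).inner (measurable_pi_apply i)).const_mul _).sub
      (((Finset.measurable_sum _ fun i _ => measurable_quadForm Sg (hY i)).const_mul _).div_const _)
  have h2 := measure_le_of_lintegral_eexp_le hF (a := 0) (τ := s * τ - α ^ 2 * s ^ 2 * b / 2)
    (by simpa using h1)
  refine (measure_mono fun z hz => ?_).trans (h2.trans (eexp_mono (by linarith)))
  have h3 : α ^ 2 * s ^ 2 * (∑ i, ⟪Sg (Y i z), Y i z⟫) ≤ α ^ 2 * s ^ 2 * b :=
    mul_le_mul_of_nonneg_left hz.2 (by positivity)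
  have h4 : s * τ ≤ s * ∑ i, ⟪Y i z, z i⟫ := mul_le_mul_of_nonneg_left hz.1 hs
  simp only [Set.mem_ofPred_eq]
  linarith

end Martingale

section Gaussian

open scoped ENNReal

lemma lintegral_eexp_mul_gaussian (t : ℝ) :
    ∫⁻ g, eexp (t * g) ∂gaussianReal 0 1 = eexp (t ^ 2 / 2) := by
  have h := congrFun (mgf_fun_id_gaussianReal (μ := 0) (v := 1)) t
  have h2 := ofReal_integral_eq_lintegral_ofReal (integrable_exp_mul_gaussianReal (μ := 0) (v := 1) t)
    (Eventually.of_forall fun x => (Real.exp_pos _).le)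
  simp only [mgf] at h
  rw [h] at h2
  simp only [eexp]
  rw [← h2]
  simp

lemma lintegral_eexp_mul_sq_gaussian_le {c : ℝ} (hc0 : 0 ≤ c) (hc : c ≤ 1 / 4) :
    ∫⁻ g, eexp (c * g ^ 2) ∂gaussianReal 0 1 ≤ eexp (2 * c) := by
  have h1 : ∫⁻ g, eexp (c * g ^ 2) ∂gaussianReal 0 1 =
      ∫⁻ x : ℝ, ENNReal.ofReal ((√(2 * Real.pi))⁻¹ * Real.exp (-(1 / 2 - c) * x ^ 2)) := by
    rw [gaussianReal_of_var_ne_zero _ one_ne_zero,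
      lintegral_withDensity_eq_lintegral_mul _ (measurable_gaussianPDF 0 1)
        (g := fun g => eexp (c * g ^ 2)) (measurable_eexp.comp (by fun_prop))]
    refine lintegral_congr fun x => ?_
    simp only [Pi.mul_apply, gaussianPDF, gaussianPDFReal, eexp]
    rw [← ENNReal.ofReal_mul (by positivity), mul_assoc, ← Real.exp_add]
    congr 3
    · simp
    · simp; ring
  have hb : 0 < 1 / 2 - c := by linarith
  rw [h1, ← ofReal_integral_eq_lintegral_ofReal ((integrable_exp_neg_mul_sq hb).const_mul _)
    (Eventually.of_forall fun x => by positivity), integral_const_mul, integral_gaussian]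
  refine ENNReal.ofReal_le_ofReal ?_
  have h3 : (√(2 * Real.pi))⁻¹ * √(Real.pi / (1 / 2 - c)) = √(1 / (1 - 2 * c)) := by
    rw [← Real.sqrt_inv, ← Real.sqrt_mul (by positivity)]
    congr 1
    have := Real.pi_pos
    have h2 : 1 - 2 * c ≠ 0 := by linarith
    field_simp
  rw [h3]
  refine Real.sqrt_le_iff.2 ⟨(Real.exp_pos _).le, ?_⟩
  rw [← Real.exp_nat_mul, div_le_iff₀ (by linarith)]
  have h4 := Real.add_one_le_exp (((2 : ℕ) : ℝ) * (2 * c))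
  push_cast at h4 ⊢
  nlinarith

variable {ι Ω : Type*} [Fintype ι] [MeasurableSpace Ω]

lemma lintegral_pi_gaussian_prod {f : ι → ℝ → ℝ≥0∞} (hf : ∀ k, Measurable (f k)) :
    ∫⁻ g, ∏ k, f k (g k) ∂(Measure.pi fun _ : ι => gaussianReal 0 1) =
      ∏ k, ∫⁻ x, f k x ∂gaussianReal 0 1 := by
  rw [lintegral_prod_eq_prod_lintegral_of_indepFun Finset.univ
    (fun k (g : ι → ℝ) => f k (g k))
    (iIndepFun_pi fun k => (hf k).aemeasurable)
    fun k => (hf k).comp (measurable_pi_apply k)]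
  refine Finset.prod_congr rfl fun k _ => ?_
  exact (measurePreserving_eval (fun _ : ι => gaussianReal 0 1) k).lintegral_comp (hf k)

/-- Gaussian linearisation: a bound on the joint moment generating function of real random
variables gives a bound on the exponential moment of a weighted sum of their squares, because
`exp(s w²) = E exp(√(2s) g w)` for a standard Gaussian `g`. -/
lemma lintegral_eexp_sum_sq_le {P : Measure Ω} [IsProbabilityMeasure P] {w : ι → Ω → ℝ}
    (hw : ∀ k, Measurable (w k)) {c : ι → ℝ} (hc : ∀ k, 0 ≤ c k)
    (h : ∀ t : ι → ℝ, ∫⁻ ω, eexp (∑ k, t k * w k ω) ∂P ≤ eexp (∑ k, c k * t k ^ 2 / 2))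
    {s : ι → ℝ} (hs : ∀ k, 0 ≤ s k) (hsc : ∀ k, s k * c k ≤ 1 / 4) :
    ∫⁻ ω, eexp (∑ k, s k * w k ω ^ 2) ∂P ≤ eexp (∑ k, 2 * (s k * c k)) := by
  have h1 : ∀ ω, eexp (∑ k, s k * w k ω ^ 2) =
      ∫⁻ g, eexp (∑ k, (√(2 * s k) * g k) * w k ω) ∂(Measure.pi fun _ : ι => gaussianReal 0 1) := by
    intro ω
    simp_rw [eexp_sum]
    rw [lintegral_pi_gaussian_prod (f := fun k x => eexp ((√(2 * s k) * x) * w k ω))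
      fun k => measurable_eexp.comp (by fun_prop)]
    refine Finset.prod_congr rfl fun k _ => ?_
    have h2 : ∀ x : ℝ, √(2 * s k) * x * w k ω = (√(2 * s k) * w k ω) * x := fun x => by ring
    simp_rw [h2]
    rw [lintegral_eexp_mul_gaussian, mul_pow, Real.sq_sqrt (by have := hs k; positivity)]
    congr 1; ring
  simp_rw [h1]
  have hmeas : Measurable (Function.uncurry fun (ω : Ω) (g : ι → ℝ) =>
      eexp (∑ k, (√(2 * s k) * g k) * w k ω)) := by
    refine measurable_eexp.comp (Finset.measurable_sum _ fun k _ => ?_)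
    exact (((measurable_pi_apply k).comp measurable_snd).const_mul _).mul ((hw k).comp measurable_fst)
  rw [lintegral_lintegral_swap hmeas.aemeasurable]
  calc _ ≤ ∫⁻ g, eexp (∑ k, c k * (√(2 * s k) * g k) ^ 2 / 2)
        ∂(Measure.pi fun _ : ι => gaussianReal 0 1) := lintegral_mono fun g => h _
    _ = ∏ k, ∫⁻ x, eexp ((s k * c k) * x ^ 2) ∂gaussianReal 0 1 := by
        rw [← lintegral_pi_gaussian_prod (f := fun k x => eexp ((s k * c k) * x ^ 2))
          fun k => measurable_eexp.comp (by fun_prop)]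
        refine lintegral_congr fun g => ?_
        rw [← eexp_sum]
        congr 1
        refine Finset.sum_congr rfl fun k _ => ?_
        rw [mul_pow, Real.sq_sqrt (by have := hs k; positivity)]
        ring
    _ ≤ ∏ k, eexp (2 * (s k * c k)) := Finset.prod_le_prod' fun k _ =>
        lintegral_eexp_mul_sq_gaussian_le (mul_nonneg (hs k) (hc k)) (hsc k)
    _ = _ := (eexp_sum _ _).symm

/-- Moments of a vector with sub-Gaussian one-dimensional marginals. -/
lemma lintegral_vnorm_rpow_le {r : ℕ} {P : Measure Ω} [IsProbabilityMeasure P] {w : Fin r → Ω → ℝ}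
    (hw : ∀ k, Measurable (w k)) {τ p : ℝ} (hτ : 0 < τ) (hp : 0 < p)
    (h : ∀ t : Fin r → ℝ, ∫⁻ ω, eexp (∑ k, t k * w k ω) ∂P ≤ eexp (τ ^ 2 * vnorm t ^ 2 / 2)) :
    ∫⁻ ω, ENNReal.ofReal (vnorm (fun k => w k ω) ^ p) ∂P ≤
      ENNReal.ofReal ((3 * τ * √(p + r)) ^ p) := by
  -- with `q = p / 2`, use `x ^ q ≤ exp (q x)` for `x = V² / (4 τ² (q + r))`; the exponent is `s V²`, and
  -- `s τ² ≤ 1 / 4` as the Gaussian linearisation requires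
  set q := p / 2 with hq
  have hq0 : 0 < q := by rw [hq]; positivity
  have hqr : 0 < q + r := by positivity
  set θ := q / (q + r) with hθ
  have hθ0 : 0 ≤ θ := by positivity
  have hθ1 : θ ≤ 1 := by
    rw [hθ, div_le_one hqr]; have : (0 : ℝ) ≤ r := by positivity
    linarith
  set s := θ / (4 * τ ^ 2) with hs
  have hmgf := lintegral_eexp_sum_sq_le hw (c := fun _ => τ ^ 2) (fun _ => by positivity)
    (fun t => (h t).trans (eexp_mono (by rw [vnorm_sq, Finset.mul_sum, Finset.sum_div])))
    (s := fun _ => s) (fun _ => by positivity)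
    (fun _ => by rw [hs]; field_simp; linarith)
  have hpt : ∀ ω, ENNReal.ofReal (vnorm (fun k => w k ω) ^ p) ≤
      ENNReal.ofReal ((4 * τ ^ 2 * (q + r)) ^ q) * eexp (∑ k, s * w k ω ^ 2) := by
    intro ω
    rw [eexp, ← ENNReal.ofReal_mul (by positivity)]
    refine ENNReal.ofReal_le_ofReal ?_
    rw [← Finset.mul_sum, ← vnorm_sq]
    set V := vnorm (fun k => w k ω)
    have hV : 0 ≤ V := vnorm_nonneg _
    have e1 : V ^ p = (V ^ 2) ^ q := by
      rw [← Real.rpow_natCast, ← Real.rpow_mul hV]; congr 1; rw [hq]; push_cast; ring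
    have e2 : V ^ 2 = (4 * τ ^ 2 * (q + r)) * (V ^ 2 / (4 * τ ^ 2 * (q + r))) := by
      field_simp
    have e3 : s * V ^ 2 = (V ^ 2 / (4 * τ ^ 2 * (q + r))) * q := by
      rw [hs, hθ]; field_simp
    rw [e1, e3, Real.exp_mul]
    conv_lhs => rw [e2]
    rw [Real.mul_rpow (by positivity) (by positivity)]
    gcongr
    linarith [Real.add_one_le_exp (V ^ 2 / (4 * τ ^ 2 * (q + r)))]
  calc _ ≤ ∫⁻ ω, ENNReal.ofReal ((4 * τ ^ 2 * (q + r)) ^ q) * eexp (∑ k, s * w k ω ^ 2) ∂P :=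
        lintegral_mono hpt
    _ = ENNReal.ofReal ((4 * τ ^ 2 * (q + r)) ^ q) * ∫⁻ ω, eexp (∑ k, s * w k ω ^ 2) ∂P :=
        lintegral_const_mul _ (measurable_eexp.comp
          (Finset.measurable_sum _ fun k _ => ((hw k).pow_const 2).const_mul s))
    _ ≤ ENNReal.ofReal ((4 * τ ^ 2 * (q + r)) ^ q) * eexp (∑ k : Fin r, 2 * (s * τ ^ 2)) := by
        gcongr
    _ ≤ _ := by
        rw [eexp, ← ENNReal.ofReal_mul (by positivity)]
        refine ENNReal.ofReal_le_ofReal ?_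
        have e1 : (3 * τ * √(p + r)) ^ p = (9 * τ ^ 2 * (p + r)) ^ q := by
          have : 9 * τ ^ 2 * (p + r) = (3 * τ * √(p + r)) ^ 2 := by
            rw [mul_pow, Real.sq_sqrt (by positivity)]; ring
          rw [this, ← Real.rpow_natCast, ← Real.rpow_mul (by positivity)]
          congr 1; rw [hq]; push_cast; ring
        have e2 : ∑ k : Fin r, 2 * (s * τ ^ 2) ≤ 1 / 2 * q := by
          rw [Finset.sum_const, Finset.card_univ, Fintype.card_fin, nsmul_eq_mul]
          have : (r : ℝ) * (2 * (s * τ ^ 2)) = (r / (q + r)) * q / 2 := by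
            rw [hs, hθ]; field_simp; ring
          rw [this]
          have : (r : ℝ) / (q + r) ≤ 1 := by rw [div_le_one hqr]; linarith
          nlinarith
        rw [e1]
        calc (4 * τ ^ 2 * (q + r)) ^ q * Real.exp (∑ k : Fin r, 2 * (s * τ ^ 2))
            ≤ (4 * τ ^ 2 * (q + r)) ^ q * Real.exp (1 / 2 * q) := by gcongr
          _ = (4 * τ ^ 2 * (q + r) * Real.exp (1 / 2)) ^ q := by
              rw [Real.exp_mul, ← Real.mul_rpow (by positivity) (by positivity)]
          _ ≤ _ := by
              refine Real.rpow_le_rpow (by positivity) ?_ hq0.le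
              have h3 : Real.exp (1 / 2) ≤ 2 := by
                have e3 : Real.exp (1 / 2) ^ 2 = Real.exp 1 := by
                  rw [← Real.exp_nat_mul]; norm_num
                have := Real.exp_one_lt_d9
                nlinarith [Real.exp_pos (1 / 2)]
              have h5 : (0 : ℝ) ≤ r := by positivity
              calc 4 * τ ^ 2 * (q + r) * Real.exp (1 / 2) ≤ 4 * τ ^ 2 * (q + r) * 2 := by gcongr
                _ ≤ 9 * τ ^ 2 * (p + r) := by
                  have : 0 ≤ τ ^ 2 * (5 * p + r) := by positivity
                  rw [hq]; linarith

end Gaussian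

end KPCA

/-! ### Nets and quadratic forms on a Hilbert space -/

namespace KPCA

section Nets

open scoped Matrix.Norms.L2Operator

variable {n : ℕ}

/-- The unit ball of `ℝⁿ` has a `1/2`-net of at most `5ⁿ` points: a maximal separated set. -/
lemma exists_net (n : ℕ) : ∃ N : Finset (Fin n → ℝ), N.card ≤ 5 ^ n ∧ (∀ v ∈ N, vnorm v ≤ 1) ∧
    ∀ v, vnorm v ≤ 1 → ∃ w ∈ N, vnorm (v - w) ≤ 1 / 2 := by
  classical
  let p : Finset (EuclideanSpace ℝ (Fin n)) → Prop := fun s =>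
    (∀ c ∈ s, ‖c‖ ≤ 2) ∧ (∀ c ∈ s, ∀ d ∈ s, c ≠ d → 1 ≤ ‖c - d‖)
  have hcard : ∀ s, p s → s.card ≤ 5 ^ n := fun s hs => by
    simpa using Besicovitch.card_le_of_separated s hs.1 hs.2
  obtain ⟨s, hs, hmax⟩ : ∃ s, p s ∧ ∀ t, p t → t.card ≤ s.card := by
    let q : ℕ → Prop := fun k => ∃ s, p s ∧ s.card = k
    have hq0 : q 0 := ⟨∅, by simp [p], rfl⟩
    obtain ⟨s, hs, hsc⟩ := Nat.findGreatest_spec (P := q) (Nat.zero_le (5 ^ n)) hq0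
    refine ⟨s, hs, fun t ht => ?_⟩
    rw [hsc]
    exact Nat.le_findGreatest (hcard t ht) ⟨t, ht, rfl⟩
  refine ⟨s.image fun c => (1 / 2 : ℝ) • c.ofLp, Finset.card_image_le.trans (hcard s hs), ?_, ?_⟩
  · intro v hv
    obtain ⟨c, hc, rfl⟩ := Finset.mem_image.1 hv
    have h1 : vnorm c.ofLp = ‖c‖ := rfl
    rw [vnorm_smul, h1, abs_of_pos (by norm_num)]
    linarith [hs.1 c hc]
  · intro v hv
    set x : EuclideanSpace ℝ (Fin n) := WithLp.toLp 2 ((2 : ℝ) • v) with hx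
    have hxn : ‖x‖ ≤ 2 := by
      have : ‖x‖ = vnorm ((2 : ℝ) • v) := rfl
      rw [this, vnorm_smul, abs_of_pos (by norm_num)]; linarith
    have hex : ∃ c ∈ s, ‖x - c‖ ≤ 1 := by
      by_contra! hcon
      have hxs : x ∉ s := fun h => by have := hcon x h; simp at this; linarith
      have hp : p (insert x s) := by
        refine ⟨fun c hc => ?_, fun c hc d hd hcd => ?_⟩
        · rcases Finset.mem_insert.1 hc with rfl | hc
          · exact hxn
          · exact hs.1 c hc
        · rcases Finset.mem_insert.1 hc with hc1 | hc1 <;>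
            rcases Finset.mem_insert.1 hd with hd1 | hd1
          · exact absurd (hc1.trans hd1.symm) hcd
          · rw [hc1]; exact (hcon d hd1).le
          · rw [hd1, norm_sub_rev]; exact (hcon c hc1).le
          · exact hs.2 c hc1 d hd1 hcd
      have := hmax _ hp
      rw [Finset.card_insert_of_notMem hxs] at this
      omega
    obtain ⟨c, hc, hxc⟩ := hex
    refine ⟨_, Finset.mem_image_of_mem _ hc, ?_⟩
    have h2 : v - (1 / 2 : ℝ) • c.ofLp = (1 / 2 : ℝ) • (x - c).ofLp := by
      ext i; simp [hx]; ring
    have h3 : vnorm (x - c).ofLp = ‖x - c‖ := rfl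
    rw [h2, vnorm_smul, h3, abs_of_pos (by norm_num)]
    linarith

lemma norm_le_of_net {N : Finset (Fin n → ℝ)}
    (hnet : ∀ v, vnorm v ≤ 1 → ∃ w ∈ N, vnorm (v - w) ≤ 1 / 2)
    (A : Matrix (Fin n) (Fin n) ℝ) {c : ℝ} (hc : 0 ≤ c)
    (h : ∀ v ∈ N, ∀ w ∈ N, v ⬝ᵥ (A *ᵥ w) ≤ c) : ‖A‖ ≤ 4 * c := by
  have h1 : ∀ w ∈ N, vnorm (A *ᵥ w) ≤ 2 * c := by
    intro w hw
    rcases (vnorm_nonneg (A *ᵥ w)).eq_or_lt with h0 | h0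
    · rw [← h0]; linarith
    set t := vnorm (A *ᵥ w)
    set v := t⁻¹ • (A *ᵥ w)
    have hv : vnorm v = 1 := by
      rw [vnorm_smul, abs_of_pos (inv_pos.2 h0)]; exact inv_mul_cancel₀ h0.ne'
    obtain ⟨v', hv', hvv'⟩ := hnet v hv.le
    have h2 : v ⬝ᵥ (A *ᵥ w) = t := by
      rw [smul_dotProduct, ← vnorm_sq_eq_dotProduct, smul_eq_mul, sq];
      exact inv_mul_cancel_left₀ h0.ne' t
    have h3 : (v - v') ⬝ᵥ (A *ᵥ w) ≤ 1 / 2 * t :=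
      (le_abs_self _).trans ((abs_dotProduct_le _ _).trans (by gcongr))
    rw [sub_dotProduct, h2] at h3
    linarith [h v' hv' w hw]
  have h2 : ‖A‖ ≤ 2 * c + ‖A‖ / 2 := by
    refine norm_le_of_mulVec A (by positivity) fun v => ?_
    rcases (vnorm_nonneg v).eq_or_lt with h0 | h0
    · rw [vnorm_eq_zero h0.symm]; simp
    set u := (vnorm v)⁻¹ • v
    have hu : vnorm u = 1 := by
      rw [vnorm_smul, abs_of_pos (inv_pos.2 h0)]; exact inv_mul_cancel₀ h0.ne'
    obtain ⟨w, hw, huw⟩ := hnet u hu.le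
    have h3 : vnorm (A *ᵥ u) ≤ 2 * c + ‖A‖ / 2 := by
      have : A *ᵥ u = A *ᵥ w + A *ᵥ (u - w) := by rw [Matrix.mulVec_sub]; abel
      rw [this]
      refine (vnorm_add_le _ _).trans (add_le_add (h1 w hw) ((vnorm_mulVec_le _ _).trans ?_))
      rw [div_eq_mul_one_div]; gcongr
    have h4 : v = vnorm v • u := by rw [smul_smul, mul_inv_cancel₀ h0.ne', one_smul]
    conv_lhs => rw [h4]
    rw [Matrix.mulVec_smul, vnorm_smul, abs_of_pos h0, mul_comm]
    gcongr
  linarith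

open scoped ENNReal

lemma natCast_pow_five_le (n : ℕ) : ((5 ^ n : ℕ) : ℝ≥0∞) ≤ eexp (2 * n) := by
  have h1 : (5 : ℝ) ≤ Real.exp 2 := by
    have e3 : Real.exp 1 ^ 2 = Real.exp 2 := by rw [← Real.exp_nat_mul]; norm_num
    have := Real.exp_one_gt_d9
    nlinarith
  have h2 : ((5 ^ n : ℕ) : ℝ) ≤ Real.exp (2 * n) := by
    rw [mul_comm, Real.exp_nat_mul]; push_cast; gcongr
  rw [eexp, ← ENNReal.ofReal_natCast]
  exact ENNReal.ofReal_le_ofReal h2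

/-- Union bound over a net: the operator norm of a random matrix is controlled by its bilinear
forms, at the price of `exp(4n)`. -/
lemma measure_norm_gt_le {Ω : Type*} [MeasurableSpace Ω] {P : Measure Ω}
    (A : Ω → Matrix (Fin n) (Fin n) ℝ) (E : Ω → Prop) {τ a : ℝ} (hτ : 0 ≤ τ)
    (h : ∀ v w : Fin n → ℝ, vnorm v ≤ 1 → vnorm w ≤ 1 →
      P {ω | τ ≤ v ⬝ᵥ (A ω *ᵥ w) ∧ E ω} ≤ eexp a) :
    P {ω | 4 * τ < ‖A ω‖ ∧ E ω} ≤ eexp (4 * n + a) := by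
  obtain ⟨N, hN, hN1, hnet⟩ := exists_net n
  have hsub : {ω | 4 * τ < ‖A ω‖ ∧ E ω} ⊆
      ⋃ q ∈ N ×ˢ N, {ω | τ ≤ q.1 ⬝ᵥ (A ω *ᵥ q.2) ∧ E ω} := by
    rintro ω ⟨h1, h2⟩
    by_contra hcon
    simp only [Set.mem_iUnion, not_exists] at hcon
    refine absurd (norm_le_of_net hnet (A ω) hτ fun v hv w hw => ?_) (not_le.2 h1)
    by_contra! h3
    exact hcon (v, w) (Finset.mk_mem_product hv hw) ⟨h3.le, h2⟩
  calc P {ω | 4 * τ < ‖A ω‖ ∧ E ω}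
      ≤ ∑ q ∈ N ×ˢ N, P {ω | τ ≤ q.1 ⬝ᵥ (A ω *ᵥ q.2) ∧ E ω} :=
        (measure_mono hsub).trans (measure_biUnion_finset_le _ _)
    _ ≤ ∑ q ∈ N ×ˢ N, eexp a := Finset.sum_le_sum fun q hq =>
        h _ _ (hN1 _ (Finset.mem_product.1 hq).1) (hN1 _ (Finset.mem_product.1 hq).2)
    _ = (N.card : ℝ≥0∞) * N.card * eexp a := by
        rw [Finset.sum_const, Finset.card_product, nsmul_eq_mul]; push_cast; rfl
    _ ≤ eexp (2 * n) * eexp (2 * n) * eexp a := by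
        have : (N.card : ℝ≥0∞) ≤ eexp (2 * n) :=
          le_trans (by exact_mod_cast hN) (natCast_pow_five_le n)
        gcongr
    _ = eexp (4 * n + a) := by rw [← eexp_add, ← eexp_add]; congr 1; ring

end Nets

section QuadForm

set_option linter.unusedSectionVars false

variable {H : Type*} [NormedAddCommGroup H] [InnerProductSpace ℝ H] [CompleteSpace H]

/-- For a positive operator, the mixed term is at most the mean of the quadratic forms. -/
lemma two_mul_inner_le {Sg : H →L[ℝ] H} (hsa : IsSelfAdjoint Sg) (hpos : ∀ u, 0 ≤ ⟪Sg u, u⟫)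
    (u v : H) : 2 * ⟪Sg u, v⟫ ≤ ⟪Sg u, u⟫ + ⟪Sg v, v⟫ := by
  have h1 := hpos (u - v)
  have h2 : ⟪Sg v, u⟫ = ⟪Sg u, v⟫ := by
    rw [hsa.isSymmetric.apply_clm v u, real_inner_comm]
  simp only [map_sub, inner_sub_left, inner_sub_right] at h1
  linarith

lemma quadForm_add_le {Sg : H →L[ℝ] H} (hsa : IsSelfAdjoint Sg) (hpos : ∀ u, 0 ≤ ⟪Sg u, u⟫)
    (u v : H) : ⟪Sg (u + v), u + v⟫ ≤ 2 * ⟪Sg u, u⟫ + 2 * ⟪Sg v, v⟫ := by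
  have h1 := two_mul_inner_le hsa hpos u v
  have h2 : ⟪Sg v, u⟫ = ⟪Sg u, v⟫ := by
    rw [hsa.isSymmetric.apply_clm v u, real_inner_comm]
  simp only [map_add, inner_add_left, inner_add_right]
  linarith

lemma quadForm_le_norm (Sg : H →L[ℝ] H) (u : H) : ⟪Sg u, u⟫ ≤ ‖Sg‖ * ‖u‖ ^ 2 := by
  refine (real_inner_le_norm _ _).trans ?_
  rw [sq, ← mul_assoc]
  gcongr
  exact Sg.le_opNorm u

lemma norm_apply_sq_le {Sg : H →L[ℝ] H} (hsa : IsSelfAdjoint Sg) (hpos : ∀ u, 0 ≤ ⟪Sg u, u⟫)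
    (u : H) : ‖Sg u‖ ^ 2 ≤ ‖Sg‖ * ⟪Sg u, u⟫ := by
  rcases (norm_nonneg Sg).eq_or_lt with h0 | h0
  · rw [← h0, norm_eq_zero.1 h0.symm]; simp
  have h1 := two_mul_inner_le hsa hpos u ((‖Sg‖)⁻¹ • Sg u)
  have h2 := quadForm_le_norm Sg (Sg u)
  simp only [map_smul, real_inner_smul_left, real_inner_smul_right] at h1
  rw [real_inner_self_eq_norm_sq] at h1
  have h3 : ‖Sg‖⁻¹ * (‖Sg‖⁻¹ * ⟪Sg (Sg u), Sg u⟫) ≤ ‖Sg‖⁻¹ * ‖Sg u‖ ^ 2 := by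
    gcongr
    rw [inv_mul_le_iff₀ h0]; exact h2
  have h4 : ‖Sg‖⁻¹ * ‖Sg u‖ ^ 2 ≤ ⟪Sg u, u⟫ := by linarith
  rwa [inv_mul_le_iff₀ h0] at h4

lemma hsNorm_sq {ι : Type*} (h : HilbertBasis ι ℝ H) (Sg : H →L[ℝ] H) :
    hsNorm h Sg ^ 2 = ∑' j, ‖Sg (h j)‖ ^ 2 :=
  Real.sq_sqrt (tsum_nonneg fun _ => sq_nonneg _)

/-- The Hilbert–Schmidt norm dominates the sum over any finite orthonormal family. -/
lemma sum_norm_sq_le_hsNorm_sq {ι : Type*} {h : HilbertBasis ι ℝ H} {Sg : H →L[ℝ] H}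
    (hSg : IsPosTraceClass h Sg) {κ : Type*} [Fintype κ] {e : κ → H} (he : Orthonormal ℝ e) :
    ∑ k, ‖Sg (e k)‖ ^ 2 ≤ hsNorm h Sg ^ 2 := by
  obtain ⟨hsa, hpos, htr⟩ := hSg
  have hsum : Summable fun j => ‖Sg (h j)‖ ^ 2 :=
    Summable.of_nonneg_of_le (fun _ => sq_nonneg _) (fun j => norm_apply_sq_le hsa hpos (h j))
      (htr.mul_left ‖Sg‖)
  have hpars : ∀ x : H, HasSum (fun j => ⟪x, h j⟫ ^ 2) (‖x‖ ^ 2) := by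
    intro x
    have := h.hasSum_inner_mul_inner x x
    rw [real_inner_self_eq_norm_sq] at this
    have e : (fun j => ⟪x, h j⟫ ^ 2) = fun j => ⟪x, h j⟫ * ⟪h j, x⟫ :=
      funext fun j => by rw [real_inner_comm x (h j), sq]
    rwa [e]
  have h1 : HasSum (fun j => ∑ k, ⟪Sg (e k), h j⟫ ^ 2) (∑ k, ‖Sg (e k)‖ ^ 2) :=
    hasSum_sum fun k _ => hpars (Sg (e k))
  rw [hsNorm_sq, ← h1.tsum_eq]
  refine h1.summable.tsum_le_tsum (fun j => ?_) hsum
  have h2 := he.sum_inner_products_le (Sg (h j)) (s := Finset.univ)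
  refine le_trans (Finset.sum_le_sum fun k _ => ?_) h2
  rw [hsa.isSymmetric.apply_clm (e k) (h j), Real.norm_eq_abs, sq_abs]

variable [MeasurableSpace H] [BorelSpace H]

variable {Ω : Type*} [MeasurableSpace Ω] {P : Measure Ω} [IsProbabilityMeasure P]

/-- Exponential moments of `⟨Σ Py, Py⟩` for `P` the projection to a finite-dimensional subspace:
linearise in an orthonormal basis that diagonalises the compression of `Σ`. -/
lemma lintegral_eexp_quadForm_proj_le [SecondCountableTopology H] {Sg : H →L[ℝ] H}
    (hsa : IsSelfAdjoint Sg)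
    (hpos : ∀ u, 0 ≤ ⟪Sg u, u⟫) {β : ℝ}
    (hβ : ∀ (k : ℕ) (e : Fin k → H), Orthonormal ℝ e → ∑ i, ‖Sg (e i)‖ ^ 2 ≤ β)
    {y : Ω → H} (hy : Measurable y) {α s : ℝ} (hs : 0 ≤ s) (hsα : s * (α ^ 2 * ‖Sg‖ ^ 2) ≤ 1 / 4)
    (h : ∀ u, ∫⁻ ω, eexp ⟪u, y ω⟫ ∂P ≤ eexp (α ^ 2 * ⟪Sg u, u⟫ / 2))
    (W : Submodule ℝ H) [FiniteDimensional ℝ W] :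
    ∫⁻ ω, eexp (s * ⟪Sg (W.starProjection (y ω)), W.starProjection (y ω)⟫) ∂P ≤
      eexp (2 * (s * α ^ 2) * β) := by
  set T : W →ₗ[ℝ] W := ((W.orthogonalProjectionOnto ∘L Sg ∘L W.subtypeL : W →L[ℝ] W) : W →ₗ[ℝ] W) with hTdef
  have hTin : ∀ a b : W, ⟪T a, b⟫ = ⟪Sg a, (b : H)⟫ := by
    intro a b
    simp only [hTdef, ContinuousLinearMap.coe_coe, ContinuousLinearMap.comp_apply,
      Submodule.subtypeL_apply]
    exact Submodule.inner_orthogonalProjectionOnto_eq_of_mem_right b (Sg a)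
  have hT : T.IsSymmetric := by
    intro a b
    calc ⟪T a, b⟫ = ⟪(a : H), Sg b⟫ := by rw [hTin, hsa.isSymmetric.apply_clm]
      _ = ⟪Sg b, (a : H)⟫ := real_inner_comm _ _
      _ = ⟪T b, a⟫ := (hTin b a).symm
      _ = ⟪a, T b⟫ := real_inner_comm _ _
  set d := Module.finrank ℝ W
  set b := hT.eigenvectorBasis (n := d) rfl
  set a := hT.eigenvalues (n := d) rfl
  set e : Fin d → H := fun k => (b k : H) with he
  have heo : Orthonormal ℝ e := b.orthonormal.comp_linearIsometry W.subtypeₗᵢ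
  have hq : ∀ k l, ⟪Sg (e k), e l⟫ = if k = l then a k else 0 := by
    intro k l
    rw [he, ← hTin, hT.apply_eigenvectorBasis, real_inner_smul_left]
    have := orthonormal_iff_ite.1 b.orthonormal k l
    rw [this]
    split_ifs <;> simp [a]
  have hlin : ∀ t : Fin d → ℝ, ⟪Sg (∑ k, t k • e k), ∑ k, t k • e k⟫ = ∑ k, a k * t k ^ 2 := by
    intro t
    simp only [map_sum, map_smul, sum_inner, inner_sum, real_inner_smul_left,
      real_inner_smul_right, hq]
    refine Finset.sum_congr rfl fun k _ => ?_
    simp; ring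
  have hproj : ∀ x, W.starProjection x = ∑ k, ⟪e k, x⟫ • e k := by
    intro x
    rw [Submodule.starProjection_apply, ← b.sum_repr (W.orthogonalProjectionOnto x)]
    rw [Submodule.coe_sum]
    refine Finset.sum_congr rfl fun k _ => ?_
    rw [Submodule.coe_smul, b.repr_apply_apply]
    congr 1
    exact Submodule.inner_orthogonalProjectionOnto_eq_of_mem_left (b k) x
  have ha0 : ∀ k, 0 ≤ a k := fun k => by simpa [hq] using hpos (e k)
  have ha1 : ∀ k, a k ≤ ‖Sg (e k)‖ := fun k => by
    have := real_inner_le_norm (Sg (e k)) (e k)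
    rw [hq, heo.1 k] at this; simpa using this
  have hb : ∀ k, a k ≤ ‖Sg‖ := fun k => (ha1 k).trans (by
    simpa [heo.1 k] using Sg.le_opNorm (e k))
  have key := lintegral_eexp_sum_sq_le (P := P) (w := fun k ω => ⟪e k, y ω⟫)
    (fun k => measurable_const.inner hy) (c := fun k => α ^ 2 * a k)
    (fun k => mul_nonneg (sq_nonneg _) (ha0 k))
    (fun t => by
      have := h (∑ k, t k • e k)
      rw [hlin] at this
      simp only [sum_inner, real_inner_smul_left] at this
      refine this.trans (eexp_mono (le_of_eq ?_))
      rw [Finset.mul_sum, Finset.sum_div]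
      exact Finset.sum_congr rfl fun k _ => by ring)
    (s := fun k => s * a k) (fun k => mul_nonneg hs (ha0 k))
    (fun k => by
      refine le_trans ?_ hsα
      have : a k * a k ≤ ‖Sg‖ ^ 2 := by
        rw [sq]; exact mul_le_mul (hb k) (hb k) (ha0 k) (norm_nonneg _)
      calc s * a k * (α ^ 2 * a k) = s * (α ^ 2 * (a k * a k)) := by ring
        _ ≤ _ := by gcongr)
  refine le_trans (le_of_eq (lintegral_congr fun ω => ?_)) (key.trans (eexp_mono ?_))
  · rw [hproj, hlin, Finset.mul_sum]
    congr 1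
    exact Finset.sum_congr rfl fun k _ => by ring
  · calc ∑ k, 2 * (s * a k * (α ^ 2 * a k)) = 2 * (s * α ^ 2) * ∑ k, a k ^ 2 := by
          rw [Finset.mul_sum]; exact Finset.sum_congr rfl fun k _ => by ring
      _ ≤ _ := by
          have : ∑ k, a k ^ 2 ≤ β := (Finset.sum_le_sum fun k _ =>
            pow_le_pow_left₀ (ha0 k) (ha1 k) 2).trans (hβ d e heo)
          gcongr

/-- Exponential moments of the quadratic form of a sub-Gaussian vector in a separable Hilbert
space. -/
lemma lintegral_eexp_quadForm_le [SecondCountableTopology H] {Sg : H →L[ℝ] H}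
    (hsa : IsSelfAdjoint Sg)
    (hpos : ∀ u, 0 ≤ ⟪Sg u, u⟫) {β : ℝ}
    (hβ : ∀ (k : ℕ) (e : Fin k → H), Orthonormal ℝ e → ∑ i, ‖Sg (e i)‖ ^ 2 ≤ β)
    {y : Ω → H} (hy : Measurable y) {α s : ℝ} (hs : 0 ≤ s) (hsα : s * (α ^ 2 * ‖Sg‖ ^ 2) ≤ 1 / 4)
    (h : ∀ u, ∫⁻ ω, eexp ⟪u, y ω⟫ ∂P ≤ eexp (α ^ 2 * ⟪Sg u, u⟫ / 2)) :
    ∫⁻ ω, eexp (s * ⟪Sg (y ω), y ω⟫) ∂P ≤ eexp (2 * (s * α ^ 2) * β) := by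
  -- exhaust the space by the spans of the initial segments of a dense sequence
  let W : ℕ → Submodule ℝ H := fun k =>
    Submodule.span ℝ ((TopologicalSpace.denseSeq H) '' (Set.Iio k))
  have hfd : ∀ k, FiniteDimensional ℝ (W k) := fun k =>
    FiniteDimensional.span_of_finite ℝ ((Set.finite_Iio k).image _)
  have hmono : Monotone W := fun i j hij =>
    Submodule.span_mono (Set.image_mono (Set.Iio_subset_Iio hij))
  have hdense : ⊤ ≤ (⨆ k, W k).topologicalClosure := by
    intro x _
    have hd := TopologicalSpace.denseRange_denseSeq H x
    refine closure_mono ?_ hd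
    rintro _ ⟨k, rfl⟩
    exact (le_iSup W (k + 1)) (Submodule.subset_span ⟨k, by simp, rfl⟩)
  set f : ℕ → Ω → ENNReal := fun k ω =>
    eexp (s * ⟪Sg ((W k).starProjection (y ω)), (W k).starProjection (y ω)⟫) with hf
  have hlim : ∀ ω, Tendsto (fun k => f k ω) atTop (𝓝 (eexp (s * ⟪Sg (y ω), y ω⟫))) := by
    intro ω
    have h1 := Submodule.starProjection_tendsto_self W hmono (y ω) hdense
    have h2 : Continuous fun x : H => eexp (s * ⟪Sg x, x⟫) :=
      continuous_eexp.comp (continuous_const.mul (Sg.continuous.inner continuous_id))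
    exact (h2.tendsto _).comp h1
  have hfm : ∀ k, Measurable (f k) := fun k =>
    measurable_eexp.comp ((measurable_quadForm Sg
      ((W k).starProjection.continuous.measurable.comp hy)).const_mul s)
  calc ∫⁻ ω, eexp (s * ⟪Sg (y ω), y ω⟫) ∂P = ∫⁻ ω, liminf (fun k => f k ω) atTop ∂P :=
        lintegral_congr fun ω => (hlim ω).liminf_eq.symm
    _ ≤ liminf (fun k => ∫⁻ ω, f k ω ∂P) atTop := lintegral_liminf_le hfm
    _ ≤ liminf (fun _ : ℕ => eexp (2 * (s * α ^ 2) * β)) atTop := by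
        refine liminf_le_liminf (Eventually.of_forall fun k => ?_)
        exact lintegral_eexp_quadForm_proj_le hsa hpos hβ hy hs hsα h (W k)
    _ = _ := by simp

end QuadForm

end KPCA

/-! ### Tail bounds for the noise matrices -/

namespace KPCA

section Tails

open scoped Matrix.Norms.L2Operator ENNReal

variable {H : Type*} [NormedAddCommGroup H] [InnerProductSpace ℝ H] [CompleteSpace H]
  [SecondCountableTopology H] [MeasurableSpace H] [BorelSpace H]

variable {n : ℕ} {ν : Fin n → Measure H} [∀ i, IsProbabilityMeasure (ν i)] {α : ℝ}
  {Sg : H →L[ℝ] H}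

set_option linter.unusedSectionVars false

/-- Linear combinations of independent sub-Gaussian vectors with coefficients of norm at most `1`
are sub-Gaussian with the same proxy. -/
lemma lintegral_eexp_inner_sum_le (hpos : ∀ u, 0 ≤ ⟪Sg u, u⟫)
    (hν : ∀ i, SubGaussianLaw (ν i) α Sg) {v : Fin n → ℝ} (hv : vnorm v ≤ 1) (u : H) :
    ∫⁻ z, eexp ⟪u, ∑ i, v i • z i⟫ ∂Measure.pi ν ≤ eexp (α ^ 2 * ⟪Sg u, u⟫ / 2) := by
  have h1 := lintegral_eexp_predictable_le hν (fun i _ => v i • u) (fun i => measurable_const)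
    (fun _ _ _ _ _ => rfl)
  have hv2 : ∑ i, v i ^ 2 ≤ 1 := by
    rw [← vnorm_sq]; exact pow_le_one₀ (vnorm_nonneg v) hv
  have hpt : ∀ z : Fin n → H, ⟪u, ∑ i, v i • z i⟫ ≤
      (∑ i, (⟪v i • u, z i⟫ - α ^ 2 * ⟪Sg (v i • u), v i • u⟫ / 2)) + α ^ 2 * ⟪Sg u, u⟫ / 2 := by
    intro z
    have e : ∑ i, α ^ 2 * (v i * (v i * ⟪Sg u, u⟫)) / 2 =
        (α ^ 2 * ⟪Sg u, u⟫ / 2) * ∑ i, v i ^ 2 := by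
      rw [Finset.mul_sum]; exact Finset.sum_congr rfl fun i _ => by ring
    simp only [inner_sum, map_smul, real_inner_smul_left, real_inner_smul_right,
      Finset.sum_sub_distrib, e]
    have := hpos u
    have : (α ^ 2 * ⟪Sg u, u⟫ / 2) * ∑ i, v i ^ 2 ≤ (α ^ 2 * ⟪Sg u, u⟫ / 2) * 1 := by gcongr
    linarith
  calc _ ≤ ∫⁻ z, eexp (∑ i, (⟪v i • u, z i⟫ - α ^ 2 * ⟪Sg (v i • u), v i • u⟫ / 2)) *
        eexp (α ^ 2 * ⟪Sg u, u⟫ / 2) ∂Measure.pi ν :=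
        lintegral_mono fun z => by rw [← eexp_add]; exact eexp_mono (hpt z)
    _ ≤ 1 * eexp (α ^ 2 * ⟪Sg u, u⟫ / 2) := by
        rw [lintegral_mul_const' _ _ (eexp_ne_top _)]
        gcongr
    _ = _ := one_mul _

/-- With overwhelming probability the empirical quadratic form `v ↦ ⟨Σ Zᵀv, Zᵀv⟩` is at most
`K β |v|²`, where `β` dominates both `‖Σ‖_HS²` and `n ‖Σ‖²`. -/
lemma measure_quadForm_sum_gt_le (hn : 0 < n) (hα : 0 < α) (hsa : IsSelfAdjoint Sg)
    (hpos : ∀ u, 0 ≤ ⟪Sg u, u⟫) (hν : ∀ i, SubGaussianLaw (ν i) α Sg) {β : ℝ} (hβ0 : 0 < β)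
    (hβ : ∀ (k : ℕ) (e : Fin k → H), Orthonormal ℝ e → ∑ i, ‖Sg (e i)‖ ^ 2 ≤ β)
    (hop : n * ‖Sg‖ ^ 2 ≤ β) {C : ℝ} (hC : 0 ≤ C) :
    Measure.pi ν {z | ¬ ∀ v : Fin n → ℝ, ⟪Sg (∑ i, v i • z i), ∑ i, v i • z i⟫ ≤
      (16 * α ^ 2 * (C + 6)) * β * vnorm v ^ 2} ≤ eexp (-(C * n)) := by
  have hn' : (0 : ℝ) < n := by exact_mod_cast hn
  set K := 16 * α ^ 2 * (C + 6) with hK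
  set B : (Fin n → H) → Matrix (Fin n) (Fin n) ℝ := fun z => Matrix.of fun i j => ⟪Sg (z i), z j⟫
  have hB : ∀ z (v w : Fin n → ℝ),
      v ⬝ᵥ (B z *ᵥ w) = ⟪Sg (∑ i, v i • z i), ∑ i, w i • z i⟫ := by
    intro z v w
    simp only [map_sum, map_smul, sum_inner, inner_sum, real_inner_smul_left,
      real_inner_smul_right, dotProduct, Matrix.mulVec, B, Matrix.of_apply, Finset.mul_sum]
    rw [Finset.sum_comm]
    refine Finset.sum_congr rfl fun i _ => Finset.sum_congr rfl fun j _ => by ring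
  -- the largest exponent that `n ‖Σ‖² ≤ β` allows
  set s := n / (4 * α ^ 2 * β) with hs
  have hs0 : 0 ≤ s := by positivity
  have hone : ∀ v : Fin n → ℝ, vnorm v ≤ 1 →
      Measure.pi ν {z | K / 4 * β ≤ ⟪Sg (∑ i, v i • z i), ∑ i, v i • z i⟫} ≤
        eexp (n / 2 - n * K / (16 * α ^ 2)) := by
    intro v hv
    have hym : Measurable fun z : Fin n → H => ∑ i, v i • z i :=
      Finset.measurable_sum _ fun i _ => (measurable_pi_apply i).const_smul (v i)
    have h1 := lintegral_eexp_quadForm_le (P := Measure.pi ν) hsa hpos hβ hym (α := α) hs0 (by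
      rw [hs, div_mul_eq_mul_div, div_le_div_iff₀ (by positivity) (by norm_num)]
      have : α ^ 2 * (n * ‖Sg‖ ^ 2) ≤ α ^ 2 * β := by gcongr
      linarith) (lintegral_eexp_inner_sum_le hpos hν hv)
    have h2 := measure_le_of_lintegral_eexp_le ((measurable_quadForm Sg hym).const_mul s)
      (τ := s * (K / 4 * β)) h1
    refine (measure_mono fun z hz => ?_).trans (h2.trans (eexp_mono (le_of_eq ?_)))
    · exact mul_le_mul_of_nonneg_left hz hs0
    · rw [hs]; field_simp; ring
  have hbil : ∀ v w : Fin n → ℝ, vnorm v ≤ 1 → vnorm w ≤ 1 →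
      Measure.pi ν {z | K / 4 * β ≤ v ⬝ᵥ (B z *ᵥ w) ∧ True} ≤
        eexp (n + (n / 2 - n * K / (16 * α ^ 2))) := by
    intro v w hv hw
    -- as `Σ` is positive, a large bilinear form makes one of the two quadratic forms large
    have hsub : {z | K / 4 * β ≤ v ⬝ᵥ (B z *ᵥ w) ∧ True} ⊆
        {z | K / 4 * β ≤ ⟪Sg (∑ i, v i • z i), ∑ i, v i • z i⟫} ∪
        {z | K / 4 * β ≤ ⟪Sg (∑ i, w i • z i), ∑ i, w i • z i⟫} := by
      rintro z ⟨hz, -⟩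
      rw [hB] at hz
      have := two_mul_inner_le hsa hpos (∑ i, v i • z i) (∑ i, w i • z i)
      by_contra hcon
      simp only [Set.mem_union, Set.mem_ofPred_eq, not_or, not_le] at hcon
      linarith [hcon.1, hcon.2]
    refine (measure_mono hsub).trans ((measure_union_le _ _).trans
      ((add_le_add (hone v hv) (hone w hw)).trans ?_))
    rw [← two_mul, eexp_add]
    gcongr
    have h1 : (1 : ℝ) ≤ n := by exact_mod_cast hn
    have h2 : (2 : ℝ) ≤ Real.exp n := by linarith [Real.add_one_le_exp (n : ℝ)]
    calc (2 : ℝ≥0∞) = ENNReal.ofReal 2 := by simp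
      _ ≤ _ := ENNReal.ofReal_le_ofReal h2
  have hnet := measure_norm_gt_le B (fun _ => True) (by positivity) hbil
  refine (measure_mono fun z hz => ?_).trans (hnet.trans (eexp_mono ?_))
  · refine ⟨?_, trivial⟩
    by_contra! hle
    refine hz fun v => ?_
    rw [← hB]
    refine (le_abs_self _).trans ((abs_dotProduct_le _ _).trans ?_)
    have h1 := vnorm_mulVec_le (B z) v
    have h2 := vnorm_nonneg v
    have h3 : ‖B z‖ * vnorm v ≤ K * β * vnorm v := by gcongr; linarith
    nlinarith
  · have : n * K / (16 * α ^ 2) = n * (C + 6) := by rw [hK]; field_simp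
    rw [this]
    nlinarith

/-- Operator norm of `(⟨z_i, a_j⟩)` for deterministic vectors `a_j`: the bilinear forms are sums of
independent terms, which are predictable sums with deterministic coefficients. -/
lemma measure_norm_cross_gt_le (hn : 0 < n)
    (hν : ∀ i, SubGaussianLaw (ν i) α Sg) {β : ℝ} (hβ0 : 0 < β) (a : Fin n → H)
    (ha : ∀ w : Fin n → ℝ, ⟪Sg (∑ j, w j • a j), ∑ j, w j • a j⟫ ≤ β * vnorm w ^ 2)
    {C K : ℝ} (hK : 4 * (C + 4 + α ^ 2) ≤ K) (hK0 : 0 ≤ K) :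
    Measure.pi ν {z | K * √(n * β) < ‖mulTr z a‖} ≤ eexp (-(C * n)) := by
  have hn' : (0 : ℝ) < n := by exact_mod_cast hn
  have hbil : ∀ v w : Fin n → ℝ, vnorm v ≤ 1 → vnorm w ≤ 1 →
      Measure.pi ν {z | K / 4 * √(n * β) ≤ v ⬝ᵥ (mulTr z a *ᵥ w) ∧ True} ≤
        eexp (α ^ 2 * n / 2 - n * K / 4) := by
    intro v w hv hw
    set y := ∑ j, w j • a j with hy
    have h1 := measure_predictable_ge_le hν (fun i _ => v i • y) (fun i => measurable_const)
      (fun _ _ _ _ _ => rfl) (b := β) (τ := K / 4 * √(n * β)) (Real.sqrt_nonneg (n / β))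
    have hvw : ∀ z : Fin n → H, v ⬝ᵥ (mulTr z a *ᵥ w) = ∑ i, ⟪v i • y, z i⟫ := by
      intro z
      simp only [dotProduct, Matrix.mulVec, mulTr, Matrix.of_apply, hy, real_inner_smul_left,
        sum_inner, Finset.mul_sum]
      refine Finset.sum_congr rfl fun i _ => Finset.sum_congr rfl fun j _ => ?_
      rw [real_inner_comm]; ring
    have hq : ∑ i, ⟪Sg (v i • y), v i • y⟫ ≤ β := by
      have e : ∑ i, ⟪Sg (v i • y), v i • y⟫ = vnorm v ^ 2 * ⟪Sg y, y⟫ := by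
        simp only [map_smul, real_inner_smul_left, real_inner_smul_right, vnorm_sq, Finset.sum_mul]
        exact Finset.sum_congr rfl fun i _ => by ring
      rw [e]
      have h2 : vnorm v ^ 2 ≤ 1 := pow_le_one₀ (vnorm_nonneg v) hv
      have h3 : ⟪Sg y, y⟫ ≤ β * 1 := (ha w).trans (by
        gcongr; exact pow_le_one₀ (vnorm_nonneg w) hw)
      nlinarith [sq_nonneg (vnorm v)]
    refine (measure_mono fun z hz => ?_).trans (h1.trans (eexp_mono (le_of_eq ?_)))
    · exact ⟨by rw [← hvw]; exact hz.1, hq⟩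
    · have e1 : √(n / β) ^ 2 = n / β := Real.sq_sqrt (by positivity)
      have e2 : √(n / β) * √(n * β) = n := by
        rw [← Real.sqrt_mul (by positivity)]
        have : (n : ℝ) / β * (n * β) = n ^ 2 := by field_simp
        rw [this, Real.sqrt_sq hn'.le]
      have e3 : √(n / β) * (K / 4 * √(n * β)) = n * K / 4 := by
        calc _ = (√(n / β) * √(n * β)) * K / 4 := by ring
          _ = _ := by rw [e2]
      rw [e1, e3]
      field_simp
  have hnet := measure_norm_gt_le (fun z => mulTr z a) (fun _ => True) (by positivity) hbil
  refine (measure_mono fun z hz => ?_).trans (hnet.trans (eexp_mono ?_))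
  · refine ⟨lt_of_le_of_lt (le_of_eq ?_) hz, trivial⟩
    ring
  · have h5 : n * (4 * (C + 4 + α ^ 2)) ≤ n * K := by gcongr
    nlinarith [sq_nonneg α]

/-- The strictly lower triangular part of a matrix. -/
def lowerPart (A : Matrix (Fin n) (Fin n) ℝ) : Matrix (Fin n) (Fin n) ℝ :=
  Matrix.of fun i j => if j < i then A i j else 0

/-- Operator norm of the strictly lower triangular part of `Z Zᵀ`: its bilinear forms are
predictable sums, whose quadratic variation is controlled by the empirical quadratic form. -/
lemma measure_norm_lowerPart_gt_le (hn : 0 < n) (hν : ∀ i, SubGaussianLaw (ν i) α Sg)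
    {β K₁ : ℝ} (hβ0 : 0 < β) (hK₁ : 0 ≤ K₁)
    {C K : ℝ} (hK : 4 * (C + 4 + α ^ 2 * K₁) ≤ K) (hK0 : 0 ≤ K) :
    Measure.pi ν {z | K * √(n * β) < ‖lowerPart (mulTr z z)‖ ∧
      ∀ v : Fin n → ℝ, ⟪Sg (∑ i, v i • z i), ∑ i, v i • z i⟫ ≤ K₁ * β * vnorm v ^ 2} ≤
      eexp (-(C * n)) := by
  have hn' : (0 : ℝ) < n := by exact_mod_cast hn
  set E : (Fin n → H) → Prop := fun z => ∀ v : Fin n → ℝ,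
    ⟪Sg (∑ i, v i • z i), ∑ i, v i • z i⟫ ≤ K₁ * β * vnorm v ^ 2 with hE
  have hbil : ∀ v w : Fin n → ℝ, vnorm v ≤ 1 → vnorm w ≤ 1 →
      Measure.pi ν {z | K / 4 * √(n * β) ≤ v ⬝ᵥ (lowerPart (mulTr z z) *ᵥ w) ∧ E z} ≤
        eexp (α ^ 2 * K₁ * n / 2 - n * K / 4) := by
    intro v w hv hw
    -- the coefficient of `z_i` depends only on the noise vectors before the `i`-th
    set y : Fin n → (Fin n → H) → H := fun i z => ∑ j, (if j < i then w j else 0) • z j with hy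
    have hym : ∀ i, Measurable (y i) := fun i =>
      Finset.measurable_sum _ fun j _ => (measurable_pi_apply j).const_smul _
    have hyp : ∀ i j z x, i ≤ j → y i (Function.update z j x) = y i z := by
      intro i j z x hij
      refine Finset.sum_congr rfl fun k _ => ?_
      by_cases hk : k < i
      · have : k ≠ j := (lt_of_lt_of_le hk hij).ne
        rw [Function.update_of_ne this]
      · simp [hk]
    have h1 := measure_predictable_ge_le hν (fun i z => v i • y i z)
      (fun i => (hym i).const_smul (v i))
      (fun i j z x hij => by simp only [hyp i j z x hij])
      (b := K₁ * β) (τ := K / 4 * √(n * β)) (Real.sqrt_nonneg (n / β))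
    have hvw : ∀ z : Fin n → H,
        v ⬝ᵥ (lowerPart (mulTr z z) *ᵥ w) = ∑ i, ⟪v i • y i z, z i⟫ := by
      intro z
      simp only [dotProduct, Matrix.mulVec, lowerPart, mulTr, Matrix.of_apply, hy,
        real_inner_smul_left, sum_inner, Finset.mul_sum]
      refine Finset.sum_congr rfl fun i _ => Finset.sum_congr rfl fun j _ => ?_
      rw [real_inner_comm]
      split_ifs <;> ring
    have hq : ∀ z, E z → ∑ i, ⟪Sg (v i • y i z), v i • y i z⟫ ≤ K₁ * β := by
      intro z hz
      have e : ∑ i, ⟪Sg (v i • y i z), v i • y i z⟫ = ∑ i, v i ^ 2 * ⟪Sg (y i z), y i z⟫ := by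
        simp only [map_smul, real_inner_smul_left, real_inner_smul_right]
        exact Finset.sum_congr rfl fun i _ => by ring
      rw [e]
      have h2 : ∀ i, ⟪Sg (y i z), y i z⟫ ≤ K₁ * β := fun i => by
        have h3 := hz (fun j => if j < i then w j else 0)
        have h4 : vnorm (fun j => if j < i then w j else 0) ≤ 1 := (vnorm_ite_le _ w).trans hw
        have h5 : vnorm (fun j => if j < i then w j else 0) ^ 2 ≤ 1 :=
          pow_le_one₀ (vnorm_nonneg _) h4
        calc _ ≤ K₁ * β * vnorm (fun j => if j < i then w j else 0) ^ 2 := h3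
          _ ≤ K₁ * β * 1 := by gcongr
          _ = _ := mul_one _
      calc ∑ i, v i ^ 2 * ⟪Sg (y i z), y i z⟫ ≤ ∑ i, v i ^ 2 * (K₁ * β) :=
            Finset.sum_le_sum fun i _ => mul_le_mul_of_nonneg_left (h2 i) (sq_nonneg _)
        _ = vnorm v ^ 2 * (K₁ * β) := by rw [← Finset.sum_mul, vnorm_sq]
        _ ≤ 1 * (K₁ * β) := by gcongr; exact pow_le_one₀ (vnorm_nonneg v) hv
        _ = _ := one_mul _
    refine (measure_mono fun z hz => ?_).trans (h1.trans (eexp_mono (le_of_eq ?_)))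
    · exact ⟨by rw [← hvw]; exact hz.1, hq z hz.2⟩
    · have e1 : √(n / β) ^ 2 = n / β := Real.sq_sqrt (by positivity)
      have e2 : √(n / β) * √(n * β) = n := by
        rw [← Real.sqrt_mul (by positivity)]
        have : (n : ℝ) / β * (n * β) = n ^ 2 := by field_simp
        rw [this, Real.sqrt_sq hn'.le]
      have e3 : √(n / β) * (K / 4 * √(n * β)) = n * K / 4 := by
        calc _ = (√(n / β) * √(n * β)) * K / 4 := by ring
          _ = _ := by rw [e2]
      rw [e1, e3]
      field_simp
  have hnet := measure_norm_gt_le (fun z => lowerPart (mulTr z z)) E (by positivity) hbil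
  refine (measure_mono fun z hz => ?_).trans (hnet.trans (eexp_mono ?_))
  · exact ⟨lt_of_le_of_lt (le_of_eq (by ring)) hz.1, hz.2⟩
  · have h5 : n * (4 * (C + 4 + α ^ 2 * K₁)) ≤ n * K := by gcongr
    have : 0 ≤ α ^ 2 * K₁ * n := by positivity
    nlinarith

/-- The matrix whose `m`-th row is `∑_{j ≠ m} ⟨z_m, x_j⟩ (M m)_j`, where `(M m)_j` is the `j`-th row of
`M m`. In the leave-one-out analysis `M m` does not depend on the `m`-th noise vector. -/
noncomputable def loo {r : ℕ} (x : Fin n → H) (z : Fin n → H)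
    (M : Fin n → Matrix (Fin n) (Fin r) ℝ) : Matrix (Fin n) (Fin r) ℝ :=
  Matrix.of fun m k => ∑ j, if j ≠ m then ⟪z m, x j⟫ * M m j k else 0

/-- The `ℓ_{2,p}` norm of `m ↦ ∑_{j ≠ m} ⟨z_m, x_j⟩ M_j`, where `M = M m` does not depend on the
`m`-th noise vector: conditionally on the other noise vectors the `m`-th row is sub-Gaussian, and
the `p`-th moments of the rows are added up. -/
lemma measure_norm2p_loo_ge_le {r : ℕ} (hn : 0 < n) (hα : 0 < α)
    (hν : ∀ i, SubGaussianLaw (ν i) α Sg) (xbar : Fin n → H)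
    (M : Fin n → (Fin n → H) → Matrix (Fin n) (Fin r) ℝ)
    (hM : ∀ m j k, Measurable fun z => M m z j k)
    (hMu : ∀ m z y, M m (Function.update z m y) = M m z) {b : ℝ} (hb0 : 0 < b)
    (hb : ∀ m z (v : Fin r → ℝ), ⟪Sg (∑ j, (if j ≠ m then (M m z *ᵥ v) j else 0) • (xbar j + z j)),
      ∑ j, (if j ≠ m then (M m z *ᵥ v) j else 0) • (xbar j + z j)⟫ ≤ b * vnorm v ^ 2)
    {p C : ℝ} (hp : 0 < p) :
    Measure.pi ν {z | (n : ℝ) ^ (1 / p) * (Real.exp C * (3 * (α * √b) * √(p + r))) ≤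
      norm2p p (loo (fun j => xbar j + z j) z fun m => M m z)} ≤ eexp (-(C * p)) := by
  have hn' : (0 : ℝ) < n := by exact_mod_cast hn
  set D : (Fin n → H) → Matrix (Fin n) (Fin r) ℝ :=
    fun z => loo (fun j => xbar j + z j) z fun m => M m z with hD
  set τ := α * √b with hτ
  have hτ0 : 0 < τ := by positivity
  set R := 3 * τ * √(p + r) with hR
  have hR0 : 0 < R := by
    have : (0 : ℝ) ≤ r := by positivity
    have : 0 < √(p + r) := Real.sqrt_pos.2 (by linarith)
    positivity
  have hDm : ∀ m k, Measurable fun z => D z m k := by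
    intro m k
    simp only [hD, loo, Matrix.of_apply]
    refine Finset.measurable_sum _ fun j _ => ?_
    split_ifs
    · exact (((measurable_pi_apply m).inner
        (measurable_const.add (measurable_pi_apply j)))).mul (hM m j k)
    · exact measurable_const
  have hvm : ∀ m, Measurable fun z => ENNReal.ofReal (vnorm (D z m) ^ p) := by
    intro m
    refine ENNReal.measurable_ofReal.comp (Measurable.pow_const ?_ p)
    simp_rw [vnorm_eq_sqrt]
    exact (Finset.measurable_sum _ fun k _ => (hDm m k).pow_const 2).sqrt
  have hmom : ∀ m, ∫⁻ z, ENNReal.ofReal (vnorm (D z m) ^ p) ∂Measure.pi ν ≤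
      ENNReal.ofReal (R ^ p) := by
    intro m
    -- integrate over `z_m` first; the other noise vectors, hence `M m`, are then frozen
    rw [lintegral_pi_update ν (hvm m) m]
    calc _ ≤ ∫⁻ _ : Fin n → H, ENNReal.ofReal (R ^ p) ∂Measure.pi ν := by
          refine lintegral_mono fun z => ?_
          set u : (Fin r → ℝ) → H := fun t =>
            ∑ j, (if j ≠ m then (M m z *ᵥ t) j else 0) • (xbar j + z j) with hu
          have hDu : ∀ y k, D (Function.update z m y) m k =
              ∑ j, if j ≠ m then ⟪y, xbar j + z j⟫ * M m z j k else 0 := by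
            intro y k
            simp only [hD, loo, Matrix.of_apply, hMu, Function.update_self]
            refine Finset.sum_congr rfl fun j _ => ?_
            split_ifs with hj
            · rw [Function.update_of_ne hj]
            · rfl
          refine lintegral_vnorm_rpow_le (P := ν m) (w := fun k y => D (Function.update z m y) m k)
            (fun k => (hDm m k).comp (measurable_update z)) hτ0 hp fun t => ?_
          have e : ∀ y, ∑ k, t k * D (Function.update z m y) m k = ⟪u t, y⟫ := by
            intro y
            simp only [hDu, hu, sum_inner, real_inner_smul_left, Finset.mul_sum]
            rw [Finset.sum_comm]
            refine Finset.sum_congr rfl fun j _ => ?_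
            split_ifs
            · simp only [Matrix.mulVec, dotProduct, Finset.sum_mul]
              refine Finset.sum_congr rfl fun k _ => ?_
              rw [real_inner_comm]; ring
            · simp
          simp_rw [e]
          refine (hν m (u t)).trans (eexp_mono ?_)
          have h1 := hb m z t
          have h2 : τ ^ 2 = α ^ 2 * b := by rw [hτ, mul_pow, Real.sq_sqrt hb0.le]
          rw [h2]
          have : α ^ 2 * ⟪Sg (u t), u t⟫ ≤ α ^ 2 * (b * vnorm t ^ 2) := by gcongr
          linarith
      _ = _ := by simp
  have hsum : ∫⁻ z, ∑ m, ENNReal.ofReal (vnorm (D z m) ^ p) ∂Measure.pi ν ≤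
      ENNReal.ofReal (n * R ^ p) := by
    rw [lintegral_finsetSum _ fun m _ => hvm m]
    calc _ ≤ ∑ _m : Fin n, ENNReal.ofReal (R ^ p) := Finset.sum_le_sum fun m _ => hmom m
      _ = _ := by
        rw [Finset.sum_const, Finset.card_univ, Fintype.card_fin, nsmul_eq_mul,
          ENNReal.ofReal_mul hn'.le, ENNReal.ofReal_natCast]
  have hmarkov := mul_meas_ge_le_lintegral (μ := Measure.pi ν)
    (f := fun z => ∑ m, ENNReal.ofReal (vnorm (D z m) ^ p))
    (Finset.measurable_sum _ fun m _ => hvm m) (ENNReal.ofReal (n * (Real.exp C * R) ^ p))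
  have hnR : 0 < n * R ^ p := by positivity
  have hsplit : ENNReal.ofReal (n * (Real.exp C * R) ^ p) =
      ENNReal.ofReal (n * R ^ p) * eexp (C * p) := by
    rw [eexp, ← ENNReal.ofReal_mul hnR.le, Real.mul_rpow (Real.exp_pos C).le hR0.le,
      ← Real.exp_mul]
    congr 1; ring
  have hsub : {z | (n : ℝ) ^ (1 / p) * (Real.exp C * R) ≤ norm2p p (D z)} ⊆
      {z | ENNReal.ofReal (n * (Real.exp C * R) ^ p) ≤
        ∑ m, ENNReal.ofReal (vnorm (D z m) ^ p)} := by
    intro z hz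
    have hz' : (n : ℝ) ^ (1 / p) * (Real.exp C * R) ≤ norm2p p (D z) := hz
    have h1 := Real.rpow_le_rpow (by positivity) hz' hp.le
    have h2 : norm2p p (D z) ^ p = ∑ m, vnorm (D z m) ^ p := by
      rw [norm2p_eq_lpn, lpn, ← Real.rpow_mul (by positivity), one_div_mul_cancel hp.ne',
        Real.rpow_one]
      simp_rw [abs_of_nonneg (vnorm_nonneg _)]
    rw [h2, Real.mul_rpow (by positivity) (by positivity), ← Real.rpow_mul hn'.le,
      one_div_mul_cancel hp.ne', Real.rpow_one] at h1
    have h3 := ENNReal.ofReal_le_ofReal h1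
    rwa [ENNReal.ofReal_sum_of_nonneg fun m _ =>
      Real.rpow_nonneg (vnorm_nonneg (D z m)) p] at h3
  set q := Measure.pi ν {z | ENNReal.ofReal (n * (Real.exp C * R) ^ p) ≤
        ∑ m, ENNReal.ofReal (vnorm (D z m) ^ p)} with hq
  have h4 : ENNReal.ofReal (n * R ^ p) * (eexp (C * p) * q) ≤ ENNReal.ofReal (n * R ^ p) * 1 := by
    rw [← mul_assoc, ← hsplit, mul_one]
    exact hmarkov.trans hsum
  have h5 : eexp (C * p) * q ≤ 1 :=
    (ENNReal.mul_le_mul_iff_right (ENNReal.ofReal_pos.2 hnR).ne' ENNReal.ofReal_ne_top).1 h4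
  calc _ ≤ q := measure_mono hsub
    _ = eexp (-(C * p)) * (eexp (C * p) * q) := by rw [← mul_assoc, eexp_neg_mul, one_mul]
    _ ≤ eexp (-(C * p)) * 1 := by gcongr
    _ = _ := mul_one _

end Tails

end KPCA

/-! ### Leave-one-out analysis on a fixed event -/

namespace KPCA

section Deterministic

open scoped Matrix.Norms.L2Operator

variable {n r s : ℕ}

/-- The matrix `A` with its `m`-th row and column replaced by zero. -/
def zeroRowCol (m : Fin n) (A : Matrix (Fin n) (Fin n) ℝ) : Matrix (Fin n) (Fin n) ℝ :=
  Matrix.of fun i j => if i = m ∨ j = m then 0 else A i j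

lemma zeroRowCol_transpose {A : Matrix (Fin n) (Fin n) ℝ} (hA : Aᵀ = A) (m : Fin n) :
    (zeroRowCol m A)ᵀ = zeroRowCol m A := by
  ext i j
  have : A j i = A i j := congrFun (congrFun hA i) j
  simp [zeroRowCol, this, or_comm]

lemma norm_sub_zeroRowCol_le {A : Matrix (Fin n) (Fin n) ℝ} (hA : Aᵀ = A) (m : Fin n) :
    ‖A - zeroRowCol m A‖ ≤ 2 * vnorm (A m) := by
  refine (norm_le_sqrt_frobSq _).trans ?_
  have hv := vnorm_nonneg (A m)
  refine Real.sqrt_le_iff.2 ⟨by positivity, ?_⟩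
  have hpt : ∀ i j, (A - zeroRowCol m A) i j ^ 2 ≤
      (if i = m then A m j ^ 2 else 0) + (if j = m then A m i ^ 2 else 0) := by
    intro i j
    simp only [Matrix.sub_apply, zeroRowCol, Matrix.of_apply]
    have hs : A i m = A m i := congrFun (congrFun hA m) i
    by_cases hi : i = m <;> by_cases hj : j = m
    · simp [hi, hj]; positivity
    · simp [hi, hj]
    · simp [hi, hj, hs]
    · simp [hi, hj]
  calc frobSq (A - zeroRowCol m A)
      ≤ ∑ i, ∑ j, ((if i = m then A m j ^ 2 else 0) + (if j = m then A m i ^ 2 else 0)) :=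
        Finset.sum_le_sum fun i _ => Finset.sum_le_sum fun j _ => hpt i j
    _ = vnorm (A m) ^ 2 + vnorm (A m) ^ 2 := by
        simp only [Finset.sum_add_distrib, vnorm_sq]
        congr 1
        · rw [Finset.sum_comm]; simp
        · simp
    _ ≤ (2 * vnorm (A m)) ^ 2 := by nlinarith

lemma frobSq_sub_zeroRowCol_mul_le {A : Matrix (Fin n) (Fin n) ℝ} (hA : Aᵀ = A) (m : Fin n)
    (B : Matrix (Fin n) (Fin r) ℝ) :
    frobSq ((A - zeroRowCol m A) * B) ≤
      vnorm ((A * B) m) ^ 2 + vnorm (A m) ^ 2 * vnorm (B m) ^ 2 := by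
  have hrow : ∀ i k, ((A - zeroRowCol m A) * B) i k ^ 2 ≤
      (if i = m then (A * B) m k ^ 2 else 0) + A m i ^ 2 * B m k ^ 2 := by
    intro i k
    have hs : A i m = A m i := congrFun (congrFun hA m) i
    by_cases hi : i = m
    · have : ((A - zeroRowCol m A) * B) i k = (A * B) m k := by
        simp only [Matrix.mul_apply, Matrix.sub_apply, zeroRowCol, Matrix.of_apply, hi, true_or,
          if_true, sub_zero]
      rw [this, if_pos hi]
      have : 0 ≤ A m i ^ 2 * B m k ^ 2 := by positivity
      linarith
    · have : ((A - zeroRowCol m A) * B) i k = A m i * B m k := by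
        simp only [Matrix.mul_apply, Matrix.sub_apply, zeroRowCol, Matrix.of_apply, hi, false_or]
        rw [Finset.sum_eq_single m]
        · simp [hs]
        · intro j _ hj; simp [hj]
        · simp
      rw [this, if_neg hi, zero_add, mul_pow]
  calc frobSq ((A - zeroRowCol m A) * B)
      ≤ ∑ i, ∑ k, ((if i = m then (A * B) m k ^ 2 else 0) + A m i ^ 2 * B m k ^ 2) :=
        Finset.sum_le_sum fun i _ => Finset.sum_le_sum fun k _ => hrow i k
    _ = _ := by
        simp only [Finset.sum_add_distrib, vnorm_sq, Finset.sum_mul_sum]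
        congr 1
        rw [Finset.sum_comm]; simp

variable {H : Type*} [NormedAddCommGroup H] [InnerProductSpace ℝ H]

lemma mulTr_transpose (x : Fin n → H) : (mulTr x x)ᵀ = mulTr x x := by
  ext i j; simp only [Matrix.transpose_apply, mulTr, Matrix.of_apply, real_inner_comm]

lemma hollow_transpose {A : Matrix (Fin n) (Fin n) ℝ} (hA : Aᵀ = A) : (hollow A)ᵀ = hollow A := by
  ext i j
  have : A j i = A i j := congrFun (congrFun hA i) j
  simp [hollow, this, eq_comm]

/-- Sizes at a fixed `n`: the signals `xbar`, the spectral gap `Δ`, the condition number `κ`, the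
incoherence `μ` with `θ = √(r/n)`, and the signal-to-noise parameter `γ`. -/
structure Sizes (xbar : Fin n → H) (lb : Fin n → ℝ) (s r : ℕ) (Δ κ μ θ γ : ℝ) : Prop where
  Δ_pos : 0 < Δ
  one_le_κ : 1 ≤ κ
  one_le_μ : 1 ≤ μ
  θ_pos : 0 < θ
  gap : BlockGap lb lb s r Δ
  lb_ge : ∀ j, InBlock s r j → Δ ≤ lb j
  lb_le : ∀ j, InBlock s r j → lb j ≤ κ * Δ
  row_le : ∀ m, vnorm (mulTr xbar xbar m) ≤ κ * μ * θ * Δ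
  norm_le : ∀ m, ‖xbar m‖ ^ 2 ≤ (μ * θ) ^ 2 * (κ * Δ)
  le_γ : κ * μ * θ ≤ γ

namespace Sizes

variable {xbar : Fin n → H} {lb : Fin n → ℝ} {Δ κ μ θ γ : ℝ}

lemma γ_pos (h : Sizes xbar lb s r Δ κ μ θ γ) : 0 < γ := by
  have := h.one_le_κ
  have := h.one_le_μ
  have := h.θ_pos
  exact lt_of_lt_of_le (by positivity) h.le_γ

lemma κγ_le (h : Sizes xbar lb s r Δ κ μ θ γ) : κ * γ ≤ κ * μ * γ := by
  have := h.one_le_κ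
  have := h.γ_pos
  have h1 : κ * γ * 1 ≤ κ * γ * μ := by gcongr; exact h.one_le_μ
  linarith

lemma γμ_le (h : Sizes xbar lb s r Δ κ μ θ γ) : γ * μ ≤ κ * μ * γ := by
  have := h.one_le_μ
  have := h.γ_pos
  have h1 : γ * μ * 1 ≤ γ * μ * κ := by gcongr; exact h.one_le_κ
  linarith

lemma γ_le (h : Sizes xbar lb s r Δ κ μ θ γ) : γ ≤ κ * μ * γ := by
  have := h.γ_pos
  have h1 : γ * 1 ≤ γ * μ := by gcongr; exact h.one_le_μ
  linarith [h.γμ_le]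

lemma θμ_le (h : Sizes xbar lb s r Δ κ μ θ γ) : (μ * θ) ^ 2 * κ ≤ γ ^ 2 := by
  have h1 := h.one_le_κ
  have h2 := h.one_le_μ
  have h3 := h.θ_pos
  calc (μ * θ) ^ 2 * κ ≤ (μ * θ) ^ 2 * κ ^ 2 := by gcongr; nlinarith
    _ = (κ * μ * θ) ^ 2 := by ring
    _ ≤ γ ^ 2 := by gcongr; exact h.le_γ

end Sizes

variable {xbar : Fin n → H} {lb : Fin n → ℝ} {Δ κ μ θ γ : ℝ} {z x : Fin n → H}
  {Vb V : Matrix (Fin n) (Fin n) ℝ} {la : Fin n → ℝ} {K : ℝ} {G : Matrix (Fin n) (Fin n) ℝ}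

/-- The rows of the observed matrix are as small as those of the signal matrix allow. -/
lemma vnorm_row_G_le (h : Sizes xbar lb s r Δ κ μ θ γ) (hK : 1 ≤ K)
    (hE : ‖G - mulTr xbar xbar‖ ≤ K * γ * Δ) (m : Fin n) : vnorm (G m) ≤ 2 * K * γ * Δ := by
  have h1 : G m = (G - mulTr xbar xbar) m + mulTr xbar xbar m := by ext j; simp
  have hΔ := h.Δ_pos
  have hγ := h.γ_pos
  have h2 : κ * μ * θ * Δ ≤ γ * Δ := by gcongr; exact h.le_γ
  have h3 : 1 * (γ * Δ) ≤ K * (γ * Δ) := by gcongr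
  rw [h1]
  refine (vnorm_add_le _ _).trans ?_
  linarith [vnorm_row_le (G - mulTr xbar xbar) m, h.row_le m]

lemma norm_zeroRowCol_sub_le (h : Sizes xbar lb s r Δ κ μ θ γ) (hK : 1 ≤ K) (hG : Gᵀ = G)
    (hE : ‖G - mulTr xbar xbar‖ ≤ K * γ * Δ) (m : Fin n) :
    ‖zeroRowCol m G - mulTr xbar xbar‖ ≤ 5 * K * γ * Δ := by
  have h1 : zeroRowCol m G - mulTr xbar xbar =
      (G - mulTr xbar xbar) - (G - zeroRowCol m G) := by abel
  rw [h1]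
  refine (norm_sub_le _ _).trans ?_
  linarith [norm_sub_zeroRowCol_le hG m, vnorm_row_G_le h hK hE m]

/-- `sin Θ` bound relative to the signal eigenvectors. -/
lemma norm_one_sub_proj_mul_le (hsr : s + r ≤ n) (hr : 1 ≤ r) (h : Sizes xbar lb s r Δ κ μ θ γ)
    (hb : IsEigendecomposition (mulTr xbar xbar) lb Vb) {A : Matrix (Fin n) (Fin n) ℝ}
    (hA : IsEigendecomposition A la V) {ε : ℝ} (hε : ε ≤ 1 / 2)
    (hE : ‖A - mulTr xbar xbar‖ ≤ ε * Δ) :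
    ‖(1 - blockCols hsr V * (blockCols hsr V)ᵀ) * blockCols hsr Vb‖ ≤ 2 * ε := by
  have hΔ := h.Δ_pos
  have hg : BlockGap la lb s r (Δ - ε * Δ - 0) :=
    h.gap.perturb (fun i => (hA.abs_sub_le hb i).trans hE) (fun i => by simp)
  have hδ : Δ / 2 ≤ Δ - ε * Δ - 0 := by nlinarith
  have h1 := davisKahan_norm hsr hr hA hb (by linarith) hg
  have h2 := norm_nonneg ((1 - blockCols hsr V * (blockCols hsr V)ᵀ) * blockCols hsr Vb)
  have h3 : Δ / 2 * ‖(1 - blockCols hsr V * (blockCols hsr V)ᵀ) * blockCols hsr Vb‖ ≤ ε * Δ :=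
    (mul_le_mul_of_nonneg_right hδ h2).trans (h1.trans hE)
  nlinarith

lemma norm_blockDiag_id_le (hsr : s + r ≤ n) (h : Sizes xbar lb s r Δ κ μ θ γ)
    (hKγ : K * γ ≤ 1 / 100)
    (hb : IsEigendecomposition (mulTr xbar xbar) lb Vb)
    (hA : IsEigendecomposition G la V) (hE : ‖G - mulTr xbar xbar‖ ≤ K * γ * Δ) :
    ‖blockDiag hsr la id‖ ≤ 2 * κ * Δ := by
  have hΔ := h.Δ_pos
  have hκ := h.one_le_κ
  refine norm_diagonal_le _ (by positivity) fun j => ?_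
  have h1 := (hA.abs_sub_le hb (blockIdx hsr j)).trans hE
  have h2 := h.lb_le _ (inBlock_blockIdx hsr j)
  have h3 := h.lb_ge _ (inBlock_blockIdx hsr j)
  have h4 : K * γ * Δ ≤ κ * Δ := by
    have : K * γ ≤ κ := by linarith
    gcongr
  have h5 := abs_le.1 h1
  have h6 : 0 < κ * Δ := by positivity
  simp only [id]
  rw [abs_le]; constructor <;> linarith

/-- The leave-one-out projection is within `O(κ |U_m|)` of the full one. -/
lemma frobSq_proj_sub_zeroRowCol_le (hsr : s + r ≤ n) (h : Sizes xbar lb s r Δ κ μ θ γ)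
    (hK : 1 ≤ K) (hKγ : K * γ ≤ 1 / 100)
    (hb : IsEigendecomposition (mulTr xbar xbar) lb Vb) (hG : Gᵀ = G)
    (hA : IsEigendecomposition G la V) (hE : ‖G - mulTr xbar xbar‖ ≤ K * γ * Δ) {m : Fin n}
    {lm : Fin n → ℝ} {Vm : Matrix (Fin n) (Fin n) ℝ}
    (hm : IsEigendecomposition (zeroRowCol m G) lm Vm) :
    ‖blockCols hsr V * (blockCols hsr V)ᵀ - blockCols hsr Vm * (blockCols hsr Vm)ᵀ‖ ≤
      7 * κ * vnorm (blockCols hsr V m) := by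
  have hΔ := h.Δ_pos
  have hκ := h.one_le_κ
  have hu := vnorm_nonneg (blockCols hsr V m)
  set u := vnorm (blockCols hsr V m) with hudef
  have hEm := norm_zeroRowCol_sub_le h hK hG hE m
  have hg : BlockGap lm la s r (Δ - 5 * K * γ * Δ - K * γ * Δ) :=
    h.gap.perturb (fun i => (hm.abs_sub_le hb i).trans hEm) (fun i => (hA.abs_sub_le hb i).trans hE)
  have hδ : Δ * (9 / 10) ≤ Δ - 5 * K * γ * Δ - K * γ * Δ := by nlinarith
  have h1 := davisKahan_frobSq hsr hm hA (by linarith) hg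
  have h2 : frobSq ((zeroRowCol m G - G) * blockCols hsr V) ≤ 5 * (κ * Δ) ^ 2 * u ^ 2 := by
    have e : frobSq ((zeroRowCol m G - G) * blockCols hsr V) =
        frobSq ((G - zeroRowCol m G) * blockCols hsr V) := by
      rw [← neg_sub, Matrix.neg_mul]; simp [frobSq]
    rw [e]
    refine (frobSq_sub_zeroRowCol_mul_le hG m _).trans ?_
    have h3 : vnorm ((G * blockCols hsr V) m) ≤ u * (2 * κ * Δ) := by
      rw [mul_blockCols hsr hA, Matrix.mul_apply_eq_vecMul]
      refine (vnorm_vecMul_le _ _).trans ?_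
      gcongr
      exact norm_blockDiag_id_le hsr h hKγ hb hA hE
    have h4 : vnorm (G m) ≤ κ * Δ := by
      refine (vnorm_row_G_le h hK hE m).trans ?_
      have : 2 * K * γ ≤ κ := by linarith
      gcongr
    have h5 : vnorm ((G * blockCols hsr V) m) ^ 2 ≤ (u * (2 * κ * Δ)) ^ 2 :=
      pow_le_pow_left₀ (vnorm_nonneg _) h3 2
    have h6 : vnorm (G m) ^ 2 ≤ (κ * Δ) ^ 2 := pow_le_pow_left₀ (vnorm_nonneg _) h4 2
    nlinarith [mul_le_mul_of_nonneg_right h6 (sq_nonneg u)]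
  set F := frobSq ((1 - blockCols hsr Vm * (blockCols hsr Vm)ᵀ) * blockCols hsr V)
  have hF0 : 0 ≤ F := frobSq_nonneg _
  have h3 : (Δ * (9 / 10)) ^ 2 * F ≤ 5 * (κ * Δ) ^ 2 * u ^ 2 := by
    refine le_trans ?_ (h1.trans h2)
    gcongr
  have h4 : F ≤ 7 * κ ^ 2 * u ^ 2 := by
    have : Δ ^ 2 * ((81 / 100) * F) ≤ Δ ^ 2 * (5 * κ ^ 2 * u ^ 2) := by nlinarith
    have := le_of_mul_le_mul_left this (by positivity)
    have : 0 ≤ κ ^ 2 * u ^ 2 := by positivity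
    linarith
  refine (norm_le_sqrt_frobSq _).trans (Real.sqrt_le_iff.2 ⟨by positivity, ?_⟩)
  rw [frobSq_proj_sub (blockCols_orthonormal hsr hA.tmul) (blockCols_orthonormal hsr hm.tmul)]
  have : 0 ≤ κ ^ 2 * u ^ 2 := by positivity
  calc 2 * F ≤ 14 * (κ ^ 2 * u ^ 2) := by linarith
    _ ≤ (7 * κ * u) ^ 2 := by rw [mul_pow, mul_pow]; linarith

/-- The basic identity: `U H - G Ū Λ̄⁻¹` is an image of `U Uᵀ Ū - Ū` under `G`, up to a term in
`U`. -/
lemma mul_sub_mul_blockInv (hsr : s + r ≤ n) (hb : IsEigendecomposition (mulTr xbar xbar) lb Vb)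
    (hlb : ∀ j, InBlock s r j → lb j ≠ 0) (hA : IsEigendecomposition G la V) :
    blockCols hsr V * ((blockCols hsr V)ᵀ * blockCols hsr Vb) -
        G * blockCols hsr Vb * blockDiag hsr lb (fun t => t⁻¹) =
      (G * (blockCols hsr V * (blockCols hsr V)ᵀ * blockCols hsr Vb - blockCols hsr Vb) -
        blockCols hsr V * ((blockCols hsr V)ᵀ * ((G - mulTr xbar xbar) * blockCols hsr Vb))) *
        blockDiag hsr lb (fun t => t⁻¹) := by
  set U := blockCols hsr V
  set W := blockCols hsr Vb
  set L := blockDiag hsr lb id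
  set Li := blockDiag hsr lb (fun t => t⁻¹)
  have hLL : L * Li = 1 := by
    simp only [L, Li, blockDiag, Matrix.diagonal_mul_diagonal, id]
    rw [← Matrix.diagonal_one]
    congr 1
    ext j
    exact mul_inv_cancel₀ (hlb _ (inBlock_blockIdx hsr j))
  have hGU : G * U = U * blockDiag hsr la id := mul_blockCols hsr hA
  have hBW : mulTr xbar xbar * W = W * L := mul_blockCols hsr hb
  have hGs : Gᵀ = G := by
    rw [hA.eq_conj]; simp [Matrix.mul_assoc]
  have hUG : Uᵀ * G = blockDiag hsr la id * Uᵀ := by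
    have := congrArg Matrix.transpose hGU
    rw [Matrix.transpose_mul, Matrix.transpose_mul, hGs] at this
    rw [this]; simp [blockDiag]
  have key : U * (Uᵀ * ((G - mulTr xbar xbar) * W)) = G * (U * Uᵀ * W) - U * (Uᵀ * W) * L := by
    rw [Matrix.sub_mul, hBW, Matrix.mul_sub, Matrix.mul_sub, ← Matrix.mul_assoc Uᵀ G, hUG]
    congr 1
    · rw [← Matrix.mul_assoc G, ← Matrix.mul_assoc G, hGU]; simp only [Matrix.mul_assoc]
    · simp only [Matrix.mul_assoc]
  rw [key, Matrix.mul_sub]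
  have e : G * (U * Uᵀ * W) - G * W - (G * (U * Uᵀ * W) - U * (Uᵀ * W) * L) =
      U * (Uᵀ * W) * L - G * W := by abel
  rw [e, Matrix.sub_mul, Matrix.mul_assoc _ L, hLL, Matrix.mul_one]

lemma norm_blockInv_le (hsr : s + r ≤ n) (h : Sizes xbar lb s r Δ κ μ θ γ) :
    ‖blockDiag hsr lb (fun t => t⁻¹)‖ ≤ Δ⁻¹ := by
  have hΔ := h.Δ_pos
  refine norm_diagonal_le _ (by positivity) fun j => ?_
  have h1 := h.lb_ge _ (inBlock_blockIdx hsr j)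
  rw [abs_of_nonneg (by have := hΔ.trans_le h1; positivity)]
  exact inv_anti₀ hΔ h1

/-- One row of the hollowed Gram matrix times a matrix, up to the noise term `loo`: the part that
comes from the signal `x̄_m`. -/
lemma vnorm_row_signal_le (hx : ∀ i, x i = xbar i + z i) (hG : G = hollow (mulTr x x))
    (M : Fin n → Matrix (Fin n) (Fin r) ℝ) (m : Fin n) :
    vnorm ((G * M m) m - loo x z M m) ≤
      (vnorm (mulTr xbar xbar m) + vnorm (fun i => ⟪z i, xbar m⟫)) * ‖M m‖ := by
  have e : (G * M m) m - loo x z M m =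
      ((fun j => if j ≠ m then mulTr xbar xbar m j else 0) +
        (fun j => if j ≠ m then ⟪z j, xbar m⟫ else 0)) ᵥ* M m := by
    ext k
    rw [Pi.sub_apply, Matrix.mul_apply, loo, Matrix.of_apply, Matrix.vecMul, dotProduct,
      ← Finset.sum_sub_distrib]
    refine Finset.sum_congr rfl fun j _ => ?_
    by_cases hj : j = m
    · subst hj; simp [hG, hollow]
    · have hj' : m ≠ j := Ne.symm hj
      simp only [hG, hollow, mulTr, Matrix.of_apply, if_neg hj', ne_eq, hj,
        not_false_eq_true, if_true, Pi.add_apply]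
      rw [hx m, hx j, real_inner_comm (xbar m) (z j)]
      simp only [inner_add_left, inner_add_right]
      ring
  rw [e]
  refine (vnorm_vecMul_le _ _).trans ?_
  gcongr
  exact (vnorm_add_le _ _).trans (add_le_add (vnorm_ite_le _ _) (vnorm_ite_le _ _))

/-- The row-wise leave-one-out bound. -/
lemma vnorm_row_le_loo (hsr : s + r ≤ n) (hr : 1 ≤ r) (h : Sizes xbar lb s r Δ κ μ θ γ)
    (hK : 1 ≤ K) (hKγ : K * γ ≤ 1 / 100)
    (hb : IsEigendecomposition (mulTr xbar xbar) lb Vb)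
    (hx : ∀ i, x i = xbar i + z i) (hG : G = hollow (mulTr x x))
    (hA : IsEigendecomposition G la V) (hE : ‖G - mulTr xbar xbar‖ ≤ K * γ * Δ)
    (hz : ∀ m, vnorm (fun i => ⟪z i, xbar m⟫) ≤ K * γ * Δ * (μ * θ))
    {M : Fin n → Matrix (Fin n) (Fin r) ℝ} {lm : Fin n → Fin n → ℝ}
    {Vm : Fin n → Matrix (Fin n) (Fin n) ℝ}
    (hm : ∀ m, IsEigendecomposition (zeroRowCol m G) (lm m) (Vm m))
    (hM : ∀ m, M m = blockCols hsr (Vm m) * (blockCols hsr (Vm m))ᵀ * blockCols hsr Vb -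
      blockCols hsr Vb) (m : Fin n) :
    vnorm ((blockCols hsr V * ((blockCols hsr V)ᵀ * blockCols hsr Vb) -
        G * blockCols hsr Vb * blockDiag hsr lb (fun t => t⁻¹)) m) ≤
      15 * K * (κ * γ) * vnorm (blockCols hsr V m) + 20 * K * (κ * μ * γ) * θ +
        Δ⁻¹ * vnorm (loo x z M m) := by
  have hΔ := h.Δ_pos
  have hκ := h.one_le_κ
  have hμ := h.one_le_μ
  have hγ := h.γ_pos
  have hθ := h.θ_pos
  have hGs : Gᵀ = G := by rw [hG]; exact hollow_transpose (mulTr_transpose x)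
  have hlb : ∀ j, InBlock s r j → lb j ≠ 0 := fun j hj => (hΔ.trans_le (h.lb_ge j hj)).ne'
  rw [mul_sub_mul_blockInv hsr hb hlb hA, Matrix.mul_apply_eq_vecMul]
  have hW1 : ‖blockCols hsr Vb‖ ≤ 1 := norm_le_one_of_orthonormal (blockCols_orthonormal hsr hb.tmul)
  have hU1 : ‖blockCols hsr V‖ ≤ 1 := norm_le_one_of_orthonormal (blockCols_orthonormal hsr hA.tmul)
  have hrowG := vnorm_row_G_le h hK hE m
  have hproj := frobSq_proj_sub_zeroRowCol_le hsr h hK hKγ hb hGs hA hE (hm m)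
  set U := blockCols hsr V
  set W := blockCols hsr Vb
  set u := vnorm (U m)
  have hu : 0 ≤ u := vnorm_nonneg _
  have hMn : ‖M m‖ ≤ 10 * K * γ := by
    have h1 := norm_one_sub_proj_mul_le hsr hr h hb (hm m) (ε := 5 * K * γ) (by linarith)
      (norm_zeroRowCol_sub_le h hK hGs hE m)
    rw [hM m, ← norm_neg, neg_sub]
    rw [Matrix.sub_mul, Matrix.one_mul] at h1
    linarith
  -- replace the projection by its leave-one-out version
  have hsplit : G * (U * Uᵀ * W - W) =
      G * ((U * Uᵀ - blockCols hsr (Vm m) * (blockCols hsr (Vm m))ᵀ) * W) + G * M m := by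
    rw [hM m, ← Matrix.mul_add, Matrix.sub_mul]; congr 1; abel
  have h1 : vnorm ((G * ((U * Uᵀ - blockCols hsr (Vm m) * (blockCols hsr (Vm m))ᵀ) * W)) m) ≤
      2 * K * γ * Δ * (7 * κ * u) := by
    rw [Matrix.mul_apply_eq_vecMul]
    refine (vnorm_vecMul_le _ _).trans ?_
    gcongr
    refine (norm_mul_le' _ _).trans ?_
    calc _ ≤ 7 * κ * u * 1 := by gcongr
      _ = _ := mul_one _
  have h2 : vnorm ((G * M m) m) ≤ 20 * K * (κ * μ * γ) * θ * Δ + vnorm (loo x z M m) := by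
    have e : (G * M m) m = ((G * M m) m - loo x z M m) + loo x z M m := by abel
    rw [e]
    refine (vnorm_add_le _ _).trans ?_
    gcongr
    refine (vnorm_row_signal_le hx hG M m).trans ?_
    have h3 : vnorm (mulTr xbar xbar m) + vnorm (fun i => ⟪z i, xbar m⟫) ≤ 2 * (κ * μ * θ * Δ) := by
      have h4 : K * γ * Δ * (μ * θ) ≤ κ * Δ * (μ * θ) := by
        have : K * γ ≤ κ := by linarith
        gcongr
      linarith [h.row_le m, hz m]
    calc _ ≤ 2 * (κ * μ * θ * Δ) * (10 * K * γ) := by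
          gcongr
      _ = _ := by ring
  have h3 : vnorm ((U * (Uᵀ * ((G - mulTr xbar xbar) * W))) m) ≤ u * (K * γ * Δ) := by
    rw [Matrix.mul_apply_eq_vecMul]
    refine (vnorm_vecMul_le _ _).trans ?_
    gcongr
    refine (norm_mul_le' _ _).trans ?_
    rw [norm_transpose]
    calc _ ≤ 1 * (K * γ * Δ * 1) := by
          gcongr
          refine (norm_mul_le' _ _).trans ?_
          gcongr
      _ = _ := by ring
  have h4 : vnorm ((G * (U * Uᵀ * W - W) - U * (Uᵀ * ((G - mulTr xbar xbar) * W))) m) ≤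
      2 * K * γ * Δ * (7 * κ * u) + (20 * K * (κ * μ * γ) * θ * Δ + vnorm (loo x z M m)) +
        u * (K * γ * Δ) := by
    rw [hsplit]
    refine (vnorm_sub_le _ _).trans (add_le_add ?_ h3)
    exact (vnorm_add_le _ _).trans (add_le_add h1 h2)
  refine (vnorm_vecMul_le _ _).trans ?_
  calc _ ≤ (2 * K * γ * Δ * (7 * κ * u) + (20 * K * (κ * μ * γ) * θ * Δ + vnorm (loo x z M m)) +
        u * (K * γ * Δ)) * Δ⁻¹ := by
        have := vnorm_nonneg (loo x z M m)
        gcongr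
        exact norm_blockInv_le hsr h
    _ = 14 * K * (κ * γ) * u + 20 * K * (κ * μ * γ) * θ + Δ⁻¹ * vnorm (loo x z M m) +
        K * γ * u * 1 := by
        field_simp; ring
    _ ≤ 14 * K * (κ * γ) * u + 20 * K * (κ * μ * γ) * θ + Δ⁻¹ * vnorm (loo x z M m) +
        K * γ * u * κ := by gcongr
    _ = _ := by ring

end Deterministic

end KPCA

/-! ### The `ℓ_{2,p}` bounds on a fixed event -/

namespace KPCA

section DeterministicMain

open scoped Matrix.Norms.L2Operator

variable {n r s : ℕ} {H : Type*} [NormedAddCommGroup H] [InnerProductSpace ℝ H]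
  {xbar : Fin n → H} {lb : Fin n → ℝ} {Δ κ μ θ γ p : ℝ} {z x : Fin n → H}
  {Vb V : Matrix (Fin n) (Fin n) ℝ} {la : Fin n → ℝ} {K : ℝ} {G : Matrix (Fin n) (Fin n) ℝ}

/-- Multiplication by `Λ̄⁻¹` costs the factor `Δ⁻¹`. -/
lemma norm2p_mul_blockInv_le (hsr : s + r ≤ n) (h : Sizes xbar lb s r Δ κ μ θ γ) (hp : 0 < p)
    (A : Matrix (Fin n) (Fin r) ℝ) :
    norm2p p (A * blockDiag hsr lb (fun t => t⁻¹)) ≤ Δ⁻¹ * norm2p p A := by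
  rw [mul_comm]
  exact (norm2p_mul_le hp _ _).trans
    (mul_le_mul_of_nonneg_left (norm_blockInv_le hsr h) (norm2p_nonneg A))

/-- Summation of the row-wise leave-one-out bounds. -/
lemma norm2p_align_le (hsr : s + r ≤ n) (hr : 1 ≤ r) (h : Sizes xbar lb s r Δ κ μ θ γ)
    (hK : 1 ≤ K) (hKγ : K * γ ≤ 1 / 100) (hp : 2 ≤ p)
    (hb : IsEigendecomposition (mulTr xbar xbar) lb Vb)
    (hθ : (n : ℝ) ^ (1 / p) * θ ≤ norm2p p (blockCols hsr Vb))
    (hx : ∀ i, x i = xbar i + z i) (hG : G = hollow (mulTr x x))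
    (hA : IsEigendecomposition G la V) (hE : ‖G - mulTr xbar xbar‖ ≤ K * γ * Δ)
    (hz : ∀ m, vnorm (fun i => ⟪z i, xbar m⟫) ≤ K * γ * Δ * (μ * θ))
    {M : Fin n → Matrix (Fin n) (Fin r) ℝ} {lm : Fin n → Fin n → ℝ}
    {Vm : Fin n → Matrix (Fin n) (Fin n) ℝ}
    (hm : ∀ m, IsEigendecomposition (zeroRowCol m G) (lm m) (Vm m))
    (hM : ∀ m, M m = blockCols hsr (Vm m) * (blockCols hsr (Vm m))ᵀ * blockCols hsr Vb -
      blockCols hsr Vb)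
    (hloo : norm2p p (loo x z M) ≤ K * γ * Δ * norm2p p (blockCols hsr Vb)) :
    norm2p p (blockCols hsr V * ((blockCols hsr V)ᵀ * blockCols hsr Vb) -
        G * blockCols hsr Vb * blockDiag hsr lb (fun t => t⁻¹)) ≤
      21 * K * (κ * μ * γ) * (norm2p p (blockCols hsr V) + norm2p p (blockCols hsr Vb)) := by
  have hp0 : 0 < p := by linarith
  have hΔ := h.Δ_pos
  have hκ := h.one_le_κ
  have hμ := h.one_le_μ
  have hγ := h.γ_pos
  have hθ0 := h.θ_pos
  set N := norm2p p (blockCols hsr Vb)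
  set T := norm2p p (blockCols hsr V)
  have hN : 0 ≤ N := norm2p_nonneg _
  have hT : 0 ≤ T := norm2p_nonneg _
  have h1 := norm2p_le_lpn hp0 (vnorm_row_le_loo hsr hr h hK hKγ hb hx hG hA hE hz hm hM)
  refine h1.trans ?_
  have h2 := lpn_add_le (p := p) (by linarith)
    ((fun m => 15 * K * (κ * γ) * vnorm (blockCols hsr V m)) + fun _ => 20 * K * (κ * μ * γ) * θ)
    (fun m => Δ⁻¹ * vnorm (loo x z M m))
  have h3 := lpn_add_le (p := p) (by linarith)
    (fun m => 15 * K * (κ * γ) * vnorm (blockCols hsr V m)) (fun _ => 20 * K * (κ * μ * γ) * θ)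
  rw [lpn_const_mul hp0, ← norm2p_eq_lpn, abs_of_nonneg (by positivity),
    lpn_const hp0 (by positivity)] at h3
  rw [lpn_const_mul hp0 Δ⁻¹, ← norm2p_eq_lpn, abs_of_nonneg (by positivity)] at h2
  have h4 : Δ⁻¹ * norm2p p (loo x z M) ≤ K * γ * N := by
    calc _ ≤ Δ⁻¹ * (K * γ * Δ * N) := by gcongr
      _ = _ := by field_simp
  have h5 : (n : ℝ) ^ (1 / p) * (20 * K * (κ * μ * γ) * θ) ≤ 20 * K * (κ * μ * γ) * N := by
    calc _ = 20 * K * (κ * μ * γ) * ((n : ℝ) ^ (1 / p) * θ) := by ring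
      _ ≤ _ := by gcongr
  have h6 : K * γ * N ≤ K * (κ * μ * γ) * N := by gcongr; exact h.γ_le
  have h7 : 15 * K * (κ * γ) * T ≤ 15 * K * (κ * μ * γ) * T :=
    mul_le_mul_of_nonneg_right (mul_le_mul_of_nonneg_left h.κγ_le (by positivity)) hT
  have h8 : 0 ≤ K * (κ * μ * γ) * T := by positivity
  refine h2.trans ?_
  linarith

/-- Linearisation of `G Ū Λ̄⁻¹`: since `Ū = Ḡ Ū Λ̄⁻¹`, what is left are the cross terms
`⟨z_j, x̄_m⟩`, `j ≠ m`, and the diagonal of `Ḡ`. -/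
lemma norm2p_linear_le (hsr : s + r ≤ n) (h : Sizes xbar lb s r Δ κ μ θ γ)
    (hK : 1 ≤ K) (hKγ : K * γ ≤ 1 / 100) (hp : 2 ≤ p)
    (hb : IsEigendecomposition (mulTr xbar xbar) lb Vb)
    (hθ : (n : ℝ) ^ (1 / p) * θ ≤ norm2p p (blockCols hsr Vb))
    (hx : ∀ i, x i = xbar i + z i) (hG : G = hollow (mulTr x x))
    (hz : ∀ m, vnorm (fun i => ⟪z i, xbar m⟫) ≤ K * γ * Δ * (μ * θ)) :
    norm2p p (G * blockCols hsr Vb * blockDiag hsr lb (fun t => t⁻¹) - (blockCols hsr Vb +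
        hollow (mulTr z x) * blockCols hsr Vb * blockDiag hsr lb (fun t => t⁻¹))) ≤
      2 * K * (κ * μ * γ) * norm2p p (blockCols hsr Vb) := by
  have hp0 : 0 < p := by linarith
  have hΔ := h.Δ_pos
  have hκ := h.one_le_κ
  have hμ := h.one_le_μ
  have hγ := h.γ_pos
  have hθ0 := h.θ_pos
  set W := blockCols hsr Vb with hW
  set N := norm2p p W
  set Li := blockDiag hsr lb (fun t => t⁻¹) with hLi
  have hN : 0 ≤ N := norm2p_nonneg _
  have hW1 : ‖W‖ ≤ 1 := norm_le_one_of_orthonormal (blockCols_orthonormal hsr hb.tmul)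
  have hWB : W = mulTr xbar xbar * W * Li := by
    rw [hW, mul_blockCols hsr hb, Matrix.mul_assoc, hLi, blockDiag, blockDiag,
      Matrix.diagonal_mul_diagonal]
    have : (fun j => id (lb (blockIdx hsr j)) * (lb (blockIdx hsr j))⁻¹) = fun _ => (1 : ℝ) := by
      ext j
      exact mul_inv_cancel₀ (hΔ.trans_le (h.lb_ge _ (inBlock_blockIdx hsr j))).ne'
    rw [this, Matrix.diagonal_one, Matrix.mul_one]
  have hdiff : G * W * Li - (W + hollow (mulTr z x) * W * Li) =
      (G * W - mulTr xbar xbar * W - hollow (mulTr z x) * W) * Li := by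
    rw [Matrix.sub_mul, Matrix.sub_mul, ← hWB]; abel
  rw [hdiff]
  have hrow : ∀ m, vnorm ((G * W - mulTr xbar xbar * W - hollow (mulTr z x) * W) m) ≤
      K * γ * Δ * μ * θ + γ ^ 2 * Δ * vnorm (W m) := by
    intro m
    have e : (G * W - mulTr xbar xbar * W - hollow (mulTr z x) * W) m =
        (fun j => if j ≠ m then ⟪z j, xbar m⟫ else 0) ᵥ* W - (‖xbar m‖ ^ 2) • W m := by
      ext k
      simp only [Matrix.sub_apply, Matrix.mul_apply, Pi.sub_apply, Matrix.vecMul, dotProduct,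
        ← Finset.sum_sub_distrib, Pi.smul_apply, smul_eq_mul]
      have : ‖xbar m‖ ^ 2 * W m k = ∑ j, if j = m then ‖xbar m‖ ^ 2 * W j k else 0 := by simp
      rw [this, ← Finset.sum_sub_distrib]
      refine Finset.sum_congr rfl fun j _ => ?_
      by_cases hj : j = m
      · subst hj; simp [hG, hollow, mulTr]
      · have hj' : m ≠ j := Ne.symm hj
        simp only [hG, hollow, mulTr, Matrix.of_apply, if_neg hj', ne_eq, hj,
          not_false_eq_true, if_true, if_false]
        rw [hx m, hx j, real_inner_comm (xbar m) (z j)]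
        simp only [inner_add_left, inner_add_right]
        ring
    rw [e]
    refine (vnorm_sub_le _ _).trans (add_le_add ?_ ?_)
    · refine (vnorm_vecMul_le _ _).trans ?_
      calc _ ≤ K * γ * Δ * (μ * θ) * 1 := by
            gcongr
            exact (vnorm_ite_le _ _).trans (hz m)
        _ = _ := by ring
    · rw [vnorm_smul, abs_of_nonneg (by positivity)]
      gcongr
      · exact vnorm_nonneg _
      · calc ‖xbar m‖ ^ 2 ≤ (μ * θ) ^ 2 * κ * Δ := by linarith [h.norm_le m]
          _ ≤ _ := by gcongr; exact h.θμ_le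
  have h1 := norm2p_le_lpn hp0 hrow
  have h2 := lpn_add_le (p := p) (by linarith) (fun _ : Fin n => K * γ * Δ * μ * θ)
    (fun m => γ ^ 2 * Δ * vnorm (W m))
  rw [lpn_const_mul hp0 (γ ^ 2 * Δ), ← norm2p_eq_lpn, abs_of_nonneg (by positivity),
    lpn_const hp0 (by positivity)] at h2
  refine (norm2p_mul_blockInv_le hsr h hp0 _).trans ?_
  have h3 : (n : ℝ) ^ (1 / p) * (K * γ * Δ * μ * θ) ≤ K * γ * Δ * μ * N := by
    calc _ = K * γ * Δ * μ * ((n : ℝ) ^ (1 / p) * θ) := by ring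
      _ ≤ _ := by gcongr
  calc _ ≤ Δ⁻¹ * (K * γ * Δ * μ * N + γ ^ 2 * Δ * N) := by
        gcongr
        exact h1.trans (h2.trans (by linarith))
    _ = (K * (γ * μ) + γ * γ) * N := by field_simp
    _ ≤ (K * (κ * μ * γ) + K * (κ * μ * γ)) * N := by
        have h4 := h.γμ_le
        have h5 : γ ≤ K := by nlinarith
        have h6 := h.γ_le
        gcongr
    _ = _ := by ring

/-- The square roots of the two blocks of eigenvalues are intertwined by `S`, up to a relative
error `2 K γ`. -/
lemma norm_sqrt_blockDiag_comm_le (hsr : s + r ≤ n) (hr : 1 ≤ r)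
    (h : Sizes xbar lb s r Δ κ μ θ γ)
    (hK : 1 ≤ K) (hKγ : K * γ ≤ 1 / 100) (hKκγ : K * (κ * γ) ≤ 1 / 100)
    (hb : IsEigendecomposition (mulTr xbar xbar) lb Vb)
    (hA : IsEigendecomposition G la V) {S : Matrix (Fin r) (Fin r) ℝ}
    (hS : IsMatrixSign ((blockCols hsr V)ᵀ * blockCols hsr Vb) S)
    (hE : ‖G - mulTr xbar xbar‖ ≤ K * γ * Δ) (hGs : Gᵀ = G) :
    ‖blockDiag hsr la Real.sqrt * S - S * blockDiag hsr lb Real.sqrt‖ ≤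
      2 * K * γ * ‖blockDiag hsr lb Real.sqrt‖ := by
  have hΔ := h.Δ_pos
  have hκ := h.one_le_κ
  have hγ := h.γ_pos
  have hWo := blockCols_orthonormal hsr hb.tmul
  have hUo := blockCols_orthonormal hsr hA.tmul
  have hsin := norm_one_sub_proj_mul_le hsr hr h hb hA (ε := K * γ) (by linarith) hE
  have hsign := hS.norm_sub_le hUo hWo
  have hSo := hS.orthonormal
  have hLnorm := norm_blockDiag_id_le hsr h hKγ hb hA hE
  have hGU : blockCols hsr V * blockDiag hsr la id = G * blockCols hsr V :=
    (mul_blockCols hsr hA).symm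
  have hBW : mulTr xbar xbar * blockCols hsr Vb = blockCols hsr Vb * blockDiag hsr lb id :=
    mul_blockCols hsr hb
  set U := blockCols hsr V
  set W := blockCols hsr Vb
  set L := blockDiag hsr lb Real.sqrt with hL
  have hlbpos : ∀ j, 0 < lb (blockIdx hsr j) := fun j =>
    hΔ.trans_le (h.lb_ge _ (inBlock_blockIdx hsr j))
  have hLge : √Δ ≤ ‖L‖ := by
    have h1 := abs_entry_le_norm L ⟨0, hr⟩ ⟨0, hr⟩
    refine le_trans ?_ h1
    simp only [hL, blockDiag, Matrix.diagonal_apply_eq]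
    rw [abs_of_nonneg (Real.sqrt_nonneg _)]
    exact Real.sqrt_le_sqrt (h.lb_ge _ (inBlock_blockIdx hsr _))
  have hSH : ‖Uᵀ * W - S‖ ≤ 4 * (K * γ) ^ 2 := by
    refine hsign.trans ?_
    calc _ ≤ (2 * (K * γ)) ^ 2 := pow_le_pow_left₀ (norm_nonneg _) hsin 2
      _ = _ := by ring
  have hc : (√Δ / 2) ^ 2 = Δ / 4 := by rw [div_pow, Real.sq_sqrt hΔ.le]; norm_num
  have h1 := norm_sqrt_comm_le hSo (a := fun j => la (blockIdx hsr j))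
    (b := fun j => lb (blockIdx hsr j)) (c := √Δ / 2) (by positivity)
    (fun j => by
      rw [hc]
      have h2 := abs_le.1 ((hA.abs_sub_le hb (blockIdx hsr j)).trans hE)
      have h3 := h.lb_ge _ (inBlock_blockIdx hsr j)
      have h4 : K * γ * Δ ≤ 1 / 100 * Δ := by gcongr
      linarith)
    (fun j => by
      rw [hc]
      have h3 := h.lb_ge _ (inBlock_blockIdx hsr j)
      linarith)
  have hR : ‖blockDiag hsr la id * S - S * blockDiag hsr lb id‖ ≤ 2 * K * γ * Δ := by
    have hcomm : blockDiag hsr la id * (Uᵀ * W) - Uᵀ * W * blockDiag hsr lb id =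
        Uᵀ * ((G - mulTr xbar xbar) * W) := by
      have hUG : Uᵀ * G = blockDiag hsr la id * Uᵀ := by
        have := congrArg Matrix.transpose hGU
        rw [Matrix.transpose_mul, Matrix.transpose_mul, hGs] at this
        rw [← this]; simp [blockDiag]
      rw [Matrix.sub_mul, Matrix.mul_sub, ← Matrix.mul_assoc Uᵀ G, hUG, hBW]
      simp only [Matrix.mul_assoc]
    have e : blockDiag hsr la id * S - S * blockDiag hsr lb id =
        Uᵀ * ((G - mulTr xbar xbar) * W) - blockDiag hsr la id * (Uᵀ * W - S) +
          (Uᵀ * W - S) * blockDiag hsr lb id := by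
      rw [← hcomm, Matrix.mul_sub, Matrix.sub_mul]; abel
    have hlbn : ‖blockDiag hsr lb id‖ ≤ κ * Δ := norm_diagonal_le _ (by positivity) fun j => by
      simp only [id]
      rw [abs_of_pos (hlbpos j)]
      exact h.lb_le _ (inBlock_blockIdx hsr j)
    have hU1 : ‖U‖ ≤ 1 := norm_le_one_of_orthonormal hUo
    have hW1 : ‖W‖ ≤ 1 := norm_le_one_of_orthonormal hWo
    have f1 : ‖Uᵀ * ((G - mulTr xbar xbar) * W)‖ ≤ K * γ * Δ := by
      refine (norm_mul_le' _ _).trans ?_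
      rw [norm_transpose]
      calc _ ≤ 1 * (K * γ * Δ * 1) := by
            gcongr
            refine (norm_mul_le' _ _).trans ?_
            gcongr
        _ = _ := by ring
    have f2 : ‖blockDiag hsr la id * (Uᵀ * W - S)‖ ≤ 2 * κ * Δ * (4 * (K * γ) ^ 2) :=
      (norm_mul_le' _ _).trans (by gcongr)
    have f3 : ‖(Uᵀ * W - S) * blockDiag hsr lb id‖ ≤ 4 * (K * γ) ^ 2 * (κ * Δ) :=
      (norm_mul_le' _ _).trans (by gcongr)
    rw [e]
    refine (norm_add_le _ _).trans ((add_le_add (norm_sub_le _ _) le_rfl).trans ?_)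
    have f4 : 12 * (K * (κ * γ)) * (K * γ * Δ) ≤ 1 * (K * γ * Δ) := by gcongr; linarith
    calc _ ≤ K * γ * Δ + 2 * κ * Δ * (4 * (K * γ) ^ 2) + 4 * (K * γ) ^ 2 * (κ * Δ) := by gcongr
      _ = K * γ * Δ + 12 * (K * (κ * γ)) * (K * γ * Δ) := by ring
      _ ≤ _ := by linarith
  have h2 : √Δ * ‖blockDiag hsr la Real.sqrt * S - S * L‖ ≤ √Δ * (2 * K * γ * √Δ) := by
    calc √Δ * ‖blockDiag hsr la Real.sqrt * S - S * L‖
        = 2 * (√Δ / 2) * ‖blockDiag hsr la Real.sqrt * S - S * L‖ := by ring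
      _ ≤ 2 * K * γ * Δ := h1.trans hR
      _ = 2 * K * γ * (√Δ * √Δ) := by rw [Real.mul_self_sqrt hΔ.le]
      _ = _ := by ring
  have h3 := le_of_mul_le_mul_left h2 (Real.sqrt_pos.2 hΔ)
  refine h3.trans ?_
  gcongr

set_option maxHeartbeats 1000000 in
/-- On the event described by the hypotheses all the claimed approximations hold, with the rate
`κ μ γ`. -/
theorem norm2p_bounds (hsr : s + r ≤ n) (hr : 1 ≤ r) (h : Sizes xbar lb s r Δ κ μ θ γ)
    (hK : 1 ≤ K) (hKw : 100 * K * (κ * μ * γ) ≤ 1) (hp : 2 ≤ p)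
    (hb : IsEigendecomposition (mulTr xbar xbar) lb Vb)
    (hθ : (n : ℝ) ^ (1 / p) * θ ≤ norm2p p (blockCols hsr Vb))
    (hx : ∀ i, x i = xbar i + z i) (hG : G = hollow (mulTr x x))
    (hA : IsEigendecomposition G la V) {S : Matrix (Fin r) (Fin r) ℝ}
    (hS : IsMatrixSign ((blockCols hsr V)ᵀ * blockCols hsr Vb) S)
    (hE : ‖G - mulTr xbar xbar‖ ≤ K * γ * Δ)
    (hz : ∀ m, vnorm (fun i => ⟪z i, xbar m⟫) ≤ K * γ * Δ * (μ * θ))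
    {M : Fin n → Matrix (Fin n) (Fin r) ℝ} {lm : Fin n → Fin n → ℝ}
    {Vm : Fin n → Matrix (Fin n) (Fin n) ℝ}
    (hm : ∀ m, IsEigendecomposition (zeroRowCol m G) (lm m) (Vm m))
    (hM : ∀ m, M m = blockCols hsr (Vm m) * (blockCols hsr (Vm m))ᵀ * blockCols hsr Vb -
      blockCols hsr Vb)
    (hloo : norm2p p (loo x z M) ≤ K * γ * Δ * norm2p p (blockCols hsr Vb))
    (hlin : norm2p p (loo x z fun _ => blockCols hsr Vb) ≤ K * Δ * norm2p p (blockCols hsr Vb)) :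
    norm2p p (blockCols hsr V * S - G * blockCols hsr Vb * blockDiag hsr lb (fun t => t⁻¹)) ≤
        200 * K ^ 2 * ((κ * μ * γ) * norm2p p (blockCols hsr Vb)) ∧
      norm2p p (blockCols hsr V * S - (blockCols hsr Vb +
          hollow (mulTr z x) * blockCols hsr Vb * blockDiag hsr lb (fun t => t⁻¹))) ≤
        200 * K ^ 2 * ((κ * μ * γ) * norm2p p (blockCols hsr Vb)) ∧
      norm2p p (blockCols hsr V * S) ≤ 200 * K ^ 2 * norm2p p (blockCols hsr Vb) ∧
      norm2p p (blockCols hsr V * blockDiag hsr la Real.sqrt * S -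
          G * blockCols hsr Vb * blockDiag hsr lb (fun t => (√t)⁻¹)) ≤
        200 * K ^ 2 * ((κ * μ * γ) *
          (norm2p p (blockCols hsr Vb) * specNorm (blockDiag hsr lb Real.sqrt))) ∧
      norm2p p (blockCols hsr V * blockDiag hsr la Real.sqrt * S -
          (blockCols hsr Vb * blockDiag hsr lb Real.sqrt +
            hollow (mulTr z x) * blockCols hsr Vb * blockDiag hsr lb (fun t => (√t)⁻¹))) ≤
        200 * K ^ 2 * ((κ * μ * γ) *
          (norm2p p (blockCols hsr Vb) * specNorm (blockDiag hsr lb Real.sqrt))) := by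
  have hp0 : 0 < p := by linarith
  have hp1 : 1 ≤ p := by linarith
  have hΔ := h.Δ_pos
  have hκ := h.one_le_κ
  have hμ := h.one_le_μ
  have hγ := h.γ_pos
  have hγw := h.γ_le
  have hκγw := h.κγ_le
  have hKγ : K * γ ≤ 1 / 100 := by
    have : K * γ ≤ K * (κ * μ * γ) := by gcongr
    linarith
  have hKκγ : K * (κ * γ) ≤ 1 / 100 := by
    have : K * (κ * γ) ≤ K * (κ * μ * γ) := by gcongr
    linarith
  have hal := norm2p_align_le hsr hr h hK hKγ hp hb hθ hx hG hA hE hz hm hM hloo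
  have hli := norm2p_linear_le hsr h hK hKγ hp hb hθ hx hG hz
  have hWo := blockCols_orthonormal hsr hb.tmul
  have hUo := blockCols_orthonormal hsr hA.tmul
  have hsin := norm_one_sub_proj_mul_le hsr hr h hb hA (ε := K * γ) (by linarith) hE
  have hsign := hS.norm_sub_le hUo hWo
  have hSo := hS.orthonormal
  have hLnorm := norm_blockDiag_id_le hsr h hKγ hb hA hE
  have hLinv := norm2p_mul_blockInv_le hsr h hp0
    (hollow (mulTr z x) * blockCols hsr Vb)
  have hGU : blockCols hsr V * blockDiag hsr la id = G * blockCols hsr V := (mul_blockCols hsr hA).symm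
  have hBW : mulTr xbar xbar * blockCols hsr Vb = blockCols hsr Vb * blockDiag hsr lb id :=
    mul_blockCols hsr hb
  have hlooW : (loo x z fun _ => blockCols hsr Vb) = hollow (mulTr z x) * blockCols hsr Vb := by
    ext m k
    simp only [loo, Matrix.of_apply, Matrix.mul_apply, hollow, mulTr]
    refine Finset.sum_congr rfl fun j _ => ?_
    by_cases hj : j = m
    · simp [hj]
    · simp [hj, Ne.symm hj]
  rw [hlooW] at hlin
  set U := blockCols hsr V with hU
  set W := blockCols hsr Vb with hW
  set w := κ * μ * γ with hw
  set N := norm2p p W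
  set T := norm2p p U
  set Li := blockDiag hsr lb (fun t => t⁻¹) with hLi
  set L := blockDiag hsr lb Real.sqrt with hL
  set Lis := blockDiag hsr lb (fun t => (√t)⁻¹) with hLis
  set HZ := hollow (mulTr z x)
  have hN : 0 ≤ N := norm2p_nonneg _
  have hT : 0 ≤ T := norm2p_nonneg _
  have hw0 : 0 < w := by positivity
  have hSt : S * Sᵀ = 1 := mul_eq_one_comm.1 hSo
  have hS1 : ‖S‖ ≤ 1 := norm_le_one_of_orthonormal hSo
  have hSH : ‖Uᵀ * W - S‖ ≤ 4 * (K * γ) ^ 2 := by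
    refine hsign.trans ?_
    calc _ ≤ (2 * (K * γ)) ^ 2 := pow_le_pow_left₀ (norm_nonneg _) hsin 2
      _ = _ := by ring
  -- the sign in place of `H`
  have ha : norm2p p (U * S - G * W * Li) ≤ 22 * K * w * (T + N) := by
    have e : U * S - G * W * Li = (U * (Uᵀ * W) - G * W * Li) - U * (Uᵀ * W - S) := by
      rw [Matrix.mul_sub]; abel
    rw [e]
    refine (norm2p_sub_le hp1 _ _).trans ?_
    have h1 : norm2p p (U * (Uᵀ * W - S)) ≤ T * (K * w) := by
      refine (norm2p_mul_le hp0 _ _).trans ?_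
      gcongr
      refine hSH.trans ?_
      have h2 : 4 * (K * γ) ^ 2 = (4 * (K * γ)) * (K * γ) := by ring
      rw [h2]
      calc (4 * (K * γ)) * (K * γ) ≤ 1 * (K * w) := by
            gcongr; linarith
        _ = _ := one_mul _
    have h3 : 0 ≤ K * w * N := by positivity
    linarith
  have hg : norm2p p (G * W * Li) ≤ 3 * K * N := by
    have e : G * W * Li = (G * W * Li - (W + HZ * W * Li)) + (W + HZ * W * Li) := by abel
    rw [e]
    refine (norm2p_add_le hp1 _ _).trans ?_
    have h1 := norm2p_add_le hp1 W (HZ * W * Li)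
    have h2 : norm2p p (HZ * W * Li) ≤ K * N := by
      refine hLinv.trans ?_
      calc _ ≤ Δ⁻¹ * (K * Δ * N) := by gcongr
        _ = _ := by field_simp
    have h3 : 2 * K * w * N ≤ 1 * N := by gcongr; linarith
    have h4 : 1 * N ≤ K * N := by gcongr
    have h5 : (2 * K * w) * N ≤ (1 / 50) * N := by gcongr; linarith
    have h6 : norm2p p W = N := rfl
    linarith
  have hTS : T ≤ norm2p p (U * S) := by
    have e : U = U * S * Sᵀ := by rw [Matrix.mul_assoc, hSt, Matrix.mul_one]
    calc T = norm2p p (U * S * Sᵀ) := by rw [← e]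
      _ ≤ norm2p p (U * S) * ‖Sᵀ‖ := norm2p_mul_le hp0 _ _
      _ ≤ norm2p p (U * S) * 1 := by
          rw [norm_transpose]
          gcongr
          exact norm2p_nonneg _
      _ = _ := mul_one _
  have hST : norm2p p (U * S) ≤ T := (norm2p_mul_le hp0 _ _).trans
    (mul_le_of_le_one_right hT hS1)
  have hT7 : T ≤ 7 * K * N := by
    have h1 : norm2p p (U * S) ≤ norm2p p (U * S - G * W * Li) + norm2p p (G * W * Li) := by
      have := norm2p_add_le hp1 (U * S - G * W * Li) (G * W * Li)
      rwa [sub_add_cancel] at this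
    have h2 : 22 * K * w * (T + N) ≤ 1 / 2 * (T + N) := by gcongr; linarith
    have h3 : 1 * N ≤ K * N := by gcongr
    linarith
  have hKK : K * N ≤ K ^ 2 * N := by gcongr; nlinarith
  have ha' : norm2p p (U * S - G * W * Li) ≤ 176 * K ^ 2 * (w * N) := by
    refine ha.trans ?_
    have h1 : T + N ≤ 8 * K * N := by
      have h3 : 1 * N ≤ K * N := by gcongr
      linarith
    calc 22 * K * w * (T + N) ≤ 22 * K * w * (8 * K * N) := by gcongr
      _ = _ := by ring
  have hKwN : K * (w * N) ≤ K ^ 2 * (w * N) := by gcongr; nlinarith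
  have hwN : 0 ≤ K ^ 2 * (w * N) := by positivity
  -- square roots of the eigenvalues
  have hlbpos : ∀ j, 0 < lb (blockIdx hsr j) := fun j =>
    hΔ.trans_le (h.lb_ge _ (inBlock_blockIdx hsr j))
  have hLiL : Li * L = Lis := by
    simp only [hLi, hL, hLis, blockDiag, Matrix.diagonal_mul_diagonal]
    congr 1
    ext j
    have h1 := Real.sqrt_pos.2 (hlbpos j)
    have h2 := Real.mul_self_sqrt (hlbpos j).le
    refine eq_inv_of_mul_eq_one_left ?_
    rw [mul_assoc, h2]
    exact inv_mul_cancel₀ (hlbpos j).ne'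
  have hspec : specNorm L = ‖L‖ := (Matrix.cstar_norm_def L).symm
  have hGs : Gᵀ = G := by rw [hG]; exact hollow_transpose (mulTr_transpose x)
  have hY := norm_sqrt_blockDiag_comm_le hsr hr h hK hKγ hKκγ hb hA hS hE hGs
  have hfour : norm2p p (U * blockDiag hsr la Real.sqrt * S - G * W * Lis) ≤
      190 * K ^ 2 * (w * (N * ‖L‖)) := by
    have e : U * blockDiag hsr la Real.sqrt * S - G * W * Lis =
        U * (blockDiag hsr la Real.sqrt * S - S * L) + (U * S - G * W * Li) * L := by
      rw [Matrix.mul_sub, Matrix.sub_mul, ← hLiL, Matrix.mul_assoc (G * W)]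
      simp only [Matrix.mul_assoc]; abel
    rw [e]
    refine (norm2p_add_le hp1 _ _).trans ?_
    have h1 : norm2p p (U * (blockDiag hsr la Real.sqrt * S - S * L)) ≤
        7 * K * N * (2 * K * w * ‖L‖) := by
      refine (norm2p_mul_le hp0 _ _).trans ?_
      have : 2 * K * γ * ‖L‖ ≤ 2 * K * w * ‖L‖ := by gcongr
      gcongr
      exact hY.trans this
    have h2 : norm2p p ((U * S - G * W * Li) * L) ≤ 176 * K ^ 2 * (w * N) * ‖L‖ :=
      (norm2p_mul_le hp0 _ _).trans (by gcongr)
    calc _ ≤ 7 * K * N * (2 * K * w * ‖L‖) + 176 * K ^ 2 * (w * N) * ‖L‖ := add_le_add h1 h2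
      _ = _ := by ring
  refine ⟨by linarith, ?_, ?_, ?_, ?_⟩
  · have e : U * S - (W + HZ * W * Li) =
        (U * S - G * W * Li) + (G * W * Li - (W + HZ * W * Li)) := by abel
    rw [e]
    refine (norm2p_add_le hp1 _ _).trans ?_
    linarith
  · have : 0 ≤ K ^ 2 * N := by positivity
    linarith
  · rw [hspec]
    have : 0 ≤ K ^ 2 * (w * (N * ‖L‖)) := by positivity
    linarith
  · have e : U * blockDiag hsr la Real.sqrt * S - (W * L + HZ * W * Lis) =
        (U * blockDiag hsr la Real.sqrt * S - G * W * Lis) +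
          (G * W * Li - (W + HZ * W * Li)) * L := by
      rw [Matrix.sub_mul, Matrix.add_mul, ← hLiL]
      simp only [Matrix.mul_assoc]; abel
    rw [e, hspec]
    refine (norm2p_add_le hp1 _ _).trans ?_
    have h1 : norm2p p ((G * W * Li - (W + HZ * W * Li)) * L) ≤ 2 * K * w * N * ‖L‖ :=
      (norm2p_mul_le hp0 _ _).trans (by gcongr)
    have h2 : K * (w * N) * ‖L‖ ≤ K ^ 2 * (w * N) * ‖L‖ := by gcongr
    have : 0 ≤ K ^ 2 * (w * (N * ‖L‖)) := by positivity
    linarith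

end DeterministicMain

end KPCA

/-! ### Spectral projections and measurability of the leave-one-out errors -/

namespace KPCA

section SpectralProjection

open scoped Matrix.Norms.L2Operator

variable {n r s : ℕ}

open Classical in
/-- The orthogonal projection onto the eigenvectors number `s + 1, …, s + r` of a symmetric
matrix, for some choice of the eigenvectors (immaterial when the block is separated from the other
eigenvalues); zero if the matrix is not symmetric. -/
noncomputable def specProj (hsr : s + r ≤ n) (A : Matrix (Fin n) (Fin n) ℝ) :
    Matrix (Fin n) (Fin n) ℝ :=
  if hA : Aᵀ = A then
    blockCols hsr (exists_isEigendecomposition hA).choose_spec.choose *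
      (blockCols hsr (exists_isEigendecomposition hA).choose_spec.choose)ᵀ
  else 0

/-- The projection is `V Vᵀ` for the block `V` of some eigendecomposition. -/
lemma exists_specProj_eq (hsr : s + r ≤ n) {A : Matrix (Fin n) (Fin n) ℝ} (hA : Aᵀ = A) :
    ∃ la V, IsEigendecomposition A la V ∧
      specProj hsr A = blockCols hsr V * (blockCols hsr V)ᵀ :=
  ⟨_, _, (exists_isEigendecomposition hA).choose_spec.choose_spec, by rw [specProj, dif_pos hA]⟩

lemma frobSq_mul_le {m k l : Type*} [Fintype m] [Fintype k] [Fintype l] [DecidableEq m]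
    [DecidableEq k] [DecidableEq l] (A : Matrix m k ℝ) (B : Matrix k l ℝ) :
    frobSq (A * B) ≤ ‖A‖ ^ 2 * frobSq B := by
  rw [frobSq_eq_sum_col, frobSq_eq_sum_col, Finset.mul_sum]
  refine Finset.sum_le_sum fun j _ => ?_
  rw [← mul_pow]
  exact pow_le_pow_left₀ (vnorm_nonneg _) (vnorm_mulVec_le A fun i => B i j) 2

lemma frobSq_blockCols (hsr : s + r ≤ n) {V : Matrix (Fin n) (Fin n) ℝ} (hV : Vᵀ * V = 1) :
    frobSq (blockCols hsr V) = r := by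
  rw [frobSq_eq_trace, blockCols_orthonormal hsr hV, Matrix.trace_one, Fintype.card_fin]

/-- By the Davis–Kahan theorem, the spectral projection is Lipschitz near a matrix at which the
block of eigenvalues is separated. -/
lemma continuousOn_specProj (hsr : s + r ≤ n) {B : Matrix (Fin n) (Fin n) ℝ} {lb : Fin n → ℝ}
    {Vb : Matrix (Fin n) (Fin n) ℝ} (hb : IsEigendecomposition B lb Vb) {Δ : ℝ} (hΔ : 0 < Δ)
    (hg : BlockGap lb lb s r Δ) :
    ContinuousOn (specProj hsr) {A | Aᵀ = A ∧ ‖A - B‖ ≤ Δ / 8} := by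
  have hlip : LipschitzOnWith (Real.toNNReal (√(2 * r) * 2 / Δ)) (specProj hsr)
      {A | Aᵀ = A ∧ ‖A - B‖ ≤ Δ / 8} := by
    refine LipschitzOnWith.of_dist_le_mul fun A₁ h₁ A₂ h₂ => ?_
    obtain ⟨l₁, V₁, e₁, p₁⟩ := exists_specProj_eq hsr h₁.1
    obtain ⟨l₂, V₂, e₂, p₂⟩ := exists_specProj_eq hsr h₂.1
    rw [dist_eq_norm, dist_eq_norm, p₁, p₂, Real.coe_toNNReal _ (by positivity)]
    have hg' : BlockGap l₂ l₁ s r (Δ - Δ / 8 - Δ / 8) :=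
      hg.perturb (fun i => (e₂.abs_sub_le hb i).trans h₂.2)
        (fun i => (e₁.abs_sub_le hb i).trans h₁.2)
    have h1 := davisKahan_frobSq hsr e₂ e₁ (by linarith) hg'
    have h2 := frobSq_mul_le (A₂ - A₁) (blockCols hsr V₁)
    rw [frobSq_blockCols hsr e₁.tmul, norm_sub_rev] at h2
    set F := frobSq ((1 - blockCols hsr V₂ * (blockCols hsr V₂)ᵀ) * blockCols hsr V₁)
    have hF : 0 ≤ F := frobSq_nonneg _
    refine (norm_le_sqrt_frobSq _).trans (Real.sqrt_le_iff.2 ⟨by positivity, ?_⟩)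
    rw [frobSq_proj_sub (blockCols_orthonormal hsr e₁.tmul) (blockCols_orthonormal hsr e₂.tmul)]
    have h3 : (Δ / 2) ^ 2 * F ≤ (Δ - Δ / 8 - Δ / 8) ^ 2 * F := by
      gcongr; linarith
    have h4 : (√(2 * r) * 2 / Δ * ‖A₁ - A₂‖) ^ 2 = 8 / Δ ^ 2 * (‖A₁ - A₂‖ ^ 2 * r) := by
      rw [mul_pow, div_pow, mul_pow, Real.sq_sqrt (by positivity)]; ring
    rw [h4]
    have h5 : Δ ^ 2 * F ≤ 4 * (‖A₁ - A₂‖ ^ 2 * r) := by linarith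
    calc 2 * F = 2 / Δ ^ 2 * (Δ ^ 2 * F) := by field_simp
      _ ≤ 2 / Δ ^ 2 * (4 * (‖A₁ - A₂‖ ^ 2 * r)) := by gcongr
      _ = _ := by ring
  exact hlip.continuousOn

end SpectralProjection

section LeaveOneOut

open scoped Matrix.Norms.L2Operator

variable {n r s : ℕ} {H : Type*} [NormedAddCommGroup H] [InnerProductSpace ℝ H]

/-- The hollowed Gram matrix of the samples `x̄_j + z_j`. -/
def sampleGram (xbar z : Fin n → H) : Matrix (Fin n) (Fin n) ℝ :=
  hollow (mulTr (fun j => xbar j + z j) fun j => xbar j + z j)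

lemma sampleGram_transpose (xbar z : Fin n → H) : (sampleGram xbar z)ᵀ = sampleGram xbar z :=
  hollow_transpose (mulTr_transpose _)

lemma continuous_zeroRowCol_sampleGram (xbar : Fin n → H) (m : Fin n) :
    Continuous fun z : Fin n → H => zeroRowCol m (sampleGram xbar z) := by
  refine continuous_matrix fun i j => ?_
  simp only [zeroRowCol, sampleGram, hollow, mulTr, Matrix.of_apply]
  split_ifs <;> fun_prop

lemma zeroRowCol_sampleGram_update (xbar z : Fin n → H) (m : Fin n) (y : H) :
    zeroRowCol m (sampleGram xbar (Function.update z m y)) = zeroRowCol m (sampleGram xbar z) := by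
  ext i j
  simp only [zeroRowCol, sampleGram, hollow, mulTr, Matrix.of_apply]
  by_cases hi : i = m
  · simp [hi]
  · by_cases hj : j = m
    · simp [hj]
    · simp [hi, hj]

/-- The noise configurations for which the Gram matrix without the `m`-th sample is within `ρ` of
the signal Gram matrix, and the quadratic form `⟨Σ Xᵀc, Xᵀc⟩` without the `m`-th sample is at most
`b |c|²`. It does not involve the `m`-th noise vector. There the block of eigenvalues of the
leave-one-out matrix is separated from the others, so that its projection depends continuously on
the noise, and the conditional variances are under control. -/
def looSet (Sg : H →L[ℝ] H) (xbar : Fin n → H) (m : Fin n) (ρ b : ℝ) : Set (Fin n → H) :=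
  {z | ‖zeroRowCol m (sampleGram xbar z) - mulTr xbar xbar‖ ≤ ρ ∧
    ∀ c : Fin n → ℝ, ⟪Sg (∑ j, (if j ≠ m then c j else 0) • (xbar j + z j)),
      ∑ j, (if j ≠ m then c j else 0) • (xbar j + z j)⟫ ≤ b * vnorm c ^ 2}

lemma isClosed_looSet (Sg : H →L[ℝ] H) (xbar : Fin n → H) (m : Fin n) (ρ b : ℝ) :
    IsClosed (looSet Sg xbar m ρ b) := by
  refine IsClosed.and ?_ ?_
  · refine isClosed_le ?_ continuous_const
    exact ((continuous_zeroRowCol_sampleGram xbar m).sub continuous_const).norm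
  · simp only [Set.ofPred_forall]
    refine isClosed_iInter fun c => isClosed_le ?_ continuous_const
    fun_prop

lemma update_mem_looSet_iff {Sg : H →L[ℝ] H} {xbar : Fin n → H} {m : Fin n} {ρ b : ℝ}
    {z : Fin n → H} (y : H) :
    Function.update z m y ∈ looSet Sg xbar m ρ b ↔ z ∈ looSet Sg xbar m ρ b := by
  have h : ∀ c : Fin n → ℝ,
      ∑ j, (if j ≠ m then c j else 0) • (xbar j + Function.update z m y j) =
        ∑ j, (if j ≠ m then c j else 0) • (xbar j + z j) := fun c =>
    Finset.sum_congr rfl fun j _ => by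
      by_cases hj : j = m
      · simp [hj]
      · simp [hj]
  simp only [looSet, Set.mem_ofPred_eq, zeroRowCol_sampleGram_update, h]

open Classical in
/-- The leave-one-out error `P_m Ū - Ū` of the eigenvectors, cut off outside `looSet`. -/
noncomputable def looErr (hsr : s + r ≤ n) (Sg : H →L[ℝ] H) (xbar : Fin n → H) (ρ b : ℝ)
    (W : Matrix (Fin n) (Fin r) ℝ) (m : Fin n) (z : Fin n → H) : Matrix (Fin n) (Fin r) ℝ :=
  if z ∈ looSet Sg xbar m ρ b then specProj hsr (zeroRowCol m (sampleGram xbar z)) * W - W else 0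

open Classical in
/-- The matrix `Ū`, cut off outside `looSet`. -/
noncomputable def looSignal (Sg : H →L[ℝ] H) (xbar : Fin n → H) (ρ b : ℝ)
    (W : Matrix (Fin n) (Fin r) ℝ) (m : Fin n) (z : Fin n → H) : Matrix (Fin n) (Fin r) ℝ :=
  if z ∈ looSet Sg xbar m ρ b then W else 0

lemma looErr_update (hsr : s + r ≤ n) (Sg : H →L[ℝ] H) (xbar : Fin n → H) (ρ b : ℝ)
    (W : Matrix (Fin n) (Fin r) ℝ) (m : Fin n) (z : Fin n → H) (y : H) :
    looErr hsr Sg xbar ρ b W m (Function.update z m y) = looErr hsr Sg xbar ρ b W m z := by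
  rw [looErr, looErr, zeroRowCol_sampleGram_update]
  classical exact if_congr (update_mem_looSet_iff y) rfl rfl

lemma looSignal_update (Sg : H →L[ℝ] H) (xbar : Fin n → H) (ρ b : ℝ)
    (W : Matrix (Fin n) (Fin r) ℝ) (m : Fin n) (z : Fin n → H) (y : H) :
    looSignal Sg xbar ρ b W m (Function.update z m y) = looSignal Sg xbar ρ b W m z := by
  rw [looSignal, looSignal]
  classical exact if_congr (update_mem_looSet_iff y) rfl rfl

variable [SecondCountableTopology H] [MeasurableSpace H] [BorelSpace H]

lemma measurable_looSignal (Sg : H →L[ℝ] H) (xbar : Fin n → H) (ρ b : ℝ)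
    (W : Matrix (Fin n) (Fin r) ℝ) (m j : Fin n) (k : Fin r) :
    Measurable fun z => looSignal Sg xbar ρ b W m z j k := by
  classical
  have e : (fun z => looSignal Sg xbar ρ b W m z j k) =
      (looSet Sg xbar m ρ b).piecewise (fun _ => W j k) fun _ => 0 := by
    ext z
    by_cases hz : z ∈ looSet Sg xbar m ρ b <;> simp [looSignal, Set.piecewise, hz]
  rw [e]
  exact measurable_const.piecewise (isClosed_looSet Sg xbar m ρ b).measurableSet measurable_const

lemma measurable_looErr (hsr : s + r ≤ n) (Sg : H →L[ℝ] H) {xbar : Fin n → H} {lb : Fin n → ℝ}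
    {Vb : Matrix (Fin n) (Fin n) ℝ} (hb : IsEigendecomposition (mulTr xbar xbar) lb Vb) {Δ : ℝ}
    (hΔ : 0 < Δ) (hg : BlockGap lb lb s r Δ) {ρ : ℝ} (hρ : ρ ≤ Δ / 8) (b : ℝ)
    (W : Matrix (Fin n) (Fin r) ℝ) (m j : Fin n) (k : Fin r) :
    Measurable fun z => looErr hsr Sg xbar ρ b W m z j k := by
  classical
  have e : (fun z => looErr hsr Sg xbar ρ b W m z j k) =
      (looSet Sg xbar m ρ b).piecewise
        (fun z => (specProj hsr (zeroRowCol m (sampleGram xbar z)) * W - W) j k) fun _ => 0 := by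
    ext z
    by_cases hz : z ∈ looSet Sg xbar m ρ b <;> simp [looErr, Set.piecewise, hz]
  rw [e]
  refine ContinuousOn.measurable_piecewise ?_ continuousOn_const
    (isClosed_looSet Sg xbar m ρ b).measurableSet
  have h1 : ContinuousOn (fun z => specProj hsr (zeroRowCol m (sampleGram xbar z)))
      (looSet Sg xbar m ρ b) := by
    refine (continuousOn_specProj hsr hb hΔ hg).comp
      (continuous_zeroRowCol_sampleGram xbar m).continuousOn fun z hz => ?_
    exact ⟨zeroRowCol_transpose (sampleGram_transpose xbar z) m, hz.1.trans hρ⟩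
  have h2 : Continuous fun A : Matrix (Fin n) (Fin n) ℝ => (A * W - W) j k := by fun_prop
  exact h2.comp_continuousOn h1

end LeaveOneOut

end KPCA

/-! ### Probability of the good event -/

namespace KPCA

section Perturbation

open scoped Matrix.Norms.L2Operator

variable {n r s : ℕ} {H : Type*} [NormedAddCommGroup H] [InnerProductSpace ℝ H]

/-- The noise in the hollowed Gram matrix: cross terms between noise and signal, the part of `Z Zᵀ`
off the diagonal, and a correction for the missing diagonal. -/
lemma sampleGram_sub_eq (xbar z : Fin n → H) :
    sampleGram xbar z - mulTr xbar xbar =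
      mulTr z xbar + (mulTr z xbar)ᵀ + lowerPart (mulTr z z) + (lowerPart (mulTr z z))ᵀ -
        Matrix.diagonal (fun i => 2 * mulTr z xbar i i) -
        Matrix.diagonal (fun i => ‖xbar i‖ ^ 2) := by
  ext i j
  simp only [sampleGram, hollow, mulTr, lowerPart, Matrix.sub_apply, Matrix.add_apply,
    Matrix.of_apply, Matrix.transpose_apply, Matrix.diagonal_apply]
  rcases lt_trichotomy i j with h | h | h
  · simp only [h.ne, h.not_gt, h, if_true, if_false, inner_add_left, inner_add_right]
    rw [real_inner_comm (z j) (xbar i), real_inner_comm (z i) (z j)]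
    ring
  · subst h
    simp only [lt_irrefl, if_true, if_false, real_inner_self_eq_norm_sq]
    ring
  · simp only [h.ne', h.not_gt, h, if_true, if_false, inner_add_left, inner_add_right]
    rw [real_inner_comm (z j) (xbar i)]
    ring

lemma norm_sampleGram_sub_le (xbar z : Fin n → H) {a l c : ℝ} (hc : 0 ≤ c)
    (ha : ‖mulTr z xbar‖ ≤ a) (hl : ‖lowerPart (mulTr z z)‖ ≤ l) (hx : ∀ i, ‖xbar i‖ ^ 2 ≤ c) :
    ‖sampleGram xbar z - mulTr xbar xbar‖ ≤ 4 * a + 2 * l + c := by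
  have ha0 : 0 ≤ a := (norm_nonneg _).trans ha
  have h1 : ‖Matrix.diagonal (fun i => 2 * mulTr z xbar i i)‖ ≤ 2 * a :=
    norm_diagonal_le _ (by positivity) fun i => by
      rw [abs_mul, abs_two]
      gcongr
      exact (abs_entry_le_norm _ i i).trans ha
  have h2 : ‖Matrix.diagonal (fun i => ‖xbar i‖ ^ 2)‖ ≤ c :=
    norm_diagonal_le _ hc fun i => by
      rw [abs_of_nonneg (by positivity)]; exact hx i
  rw [sampleGram_sub_eq]
  refine (norm_sub_le _ _).trans ((add_le_add ((norm_sub_le _ _).trans (add_le_add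
    ((norm_add_le _ _).trans (add_le_add ((norm_add_le _ _).trans (add_le_add
      (norm_add_le _ _) le_rfl)) le_rfl)) le_rfl)) le_rfl).trans ?_)
  rw [norm_transpose, norm_transpose]
  linarith

/-- A column of a matrix, as the operator norm of a matrix whose other columns vanish. -/
lemma vnorm_le_norm_mulTr_single (z : Fin n → H) (y : H) (m : Fin n) :
    vnorm (fun i => ⟪z i, y⟫) ≤ ‖mulTr z fun j => if j = m then y else 0‖ := by
  have h := vnorm_mulVec_le (mulTr z fun j => if j = m then y else 0) (Pi.single m 1)
  have h1 : vnorm (Pi.single m 1 : Fin n → ℝ) = 1 := by simp [vnorm]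
  rw [h1, mul_one] at h
  convert h using 2
  ext i
  simp [mulTr]

lemma norm_sum_smul_sq (x : Fin n → H) (w : Fin n → ℝ) :
    ‖∑ j, w j • x j‖ ^ 2 = w ⬝ᵥ (mulTr x x *ᵥ w) := by
  rw [← real_inner_self_eq_norm_sq, sum_inner]
  simp only [dotProduct, Matrix.mulVec, mulTr, Matrix.of_apply]
  refine Finset.sum_congr rfl fun i _ => ?_
  rw [real_inner_smul_left, inner_sum]
  simp only [real_inner_smul_right, mul_comm]

lemma quadForm_sum_le [CompleteSpace H] (Sg : H →L[ℝ] H) (x : Fin n → H) (w : Fin n → ℝ) :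
    ⟪Sg (∑ j, w j • x j), ∑ j, w j • x j⟫ ≤ ‖Sg‖ * ‖mulTr x x‖ * vnorm w ^ 2 := by
  refine (quadForm_le_norm Sg _).trans ?_
  rw [norm_sum_smul_sq, mul_assoc]
  gcongr
  refine (le_abs_self _).trans ((abs_dotProduct_le _ _).trans ?_)
  calc _ ≤ vnorm w * (‖mulTr x x‖ * vnorm w) := by
        have := vnorm_nonneg w
        gcongr
        exact vnorm_mulVec_le _ _
    _ = _ := by ring

end Perturbation

section GoodEvent

open scoped Matrix.Norms.L2Operator

variable {n r s : ℕ} {H : Type*} [NormedAddCommGroup H] [InnerProductSpace ℝ H]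

/-- Constant in the bound for the quadratic form `⟨Σ Zᵀv, Zᵀv⟩`. -/
noncomputable def quadConst (α C : ℝ) : ℝ := 16 * α ^ 2 * (C + 6)

/-- Constant in the bounds for the operator norms of the noise matrices. -/
noncomputable def noiseConst (α C : ℝ) : ℝ := 4 * (C + 5 + α ^ 2 * (quadConst α C + 1))

/-- Constant in the bound for the operator norm of the hollowed Gram matrix minus its signal
part. -/
noncomputable def opConst (α C : ℝ) : ℝ := 6 * noiseConst α C + 1

/-- Constant in all the bounds that hold with probability `1 - O(exp(-C p))`, if
`p ≤ c₁ (μ γ)⁻²`. -/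
noncomputable def rateConst (α C c₁ : ℝ) : ℝ :=
  opConst α (C * c₁) *
    (1 + 30 * (Real.exp C * (α * √(2 * (1 + quadConst α (C * c₁)) * (1 + c₁)))))

lemma quadConst_nonneg (α : ℝ) {C : ℝ} (hC : 0 ≤ C) : 0 ≤ quadConst α C := by
  unfold quadConst; positivity

lemma noiseConst_nonneg (α : ℝ) {C : ℝ} (hC : 0 ≤ C) : 0 ≤ noiseConst α C := by
  have := quadConst_nonneg α hC
  unfold noiseConst; positivity

lemma one_le_opConst (α : ℝ) {C : ℝ} (hC : 0 ≤ C) : 1 ≤ opConst α C := by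
  have := noiseConst_nonneg α hC
  unfold opConst; linarith

lemma opConst_le_rateConst {α C c₁ : ℝ} (hα : 0 < α) (hC : 0 ≤ C) (hc : 0 ≤ c₁) :
    opConst α (C * c₁) ≤ rateConst α C c₁ := by
  have h1 := one_le_opConst α (mul_nonneg hC hc)
  refine le_mul_of_one_le_right (by linarith) ?_
  have : 0 ≤ 30 * (Real.exp C * (α * √(2 * (1 + quadConst α (C * c₁)) * (1 + c₁)))) := by
    positivity
  linarith

/-- The event on which the deterministic analysis applies; `W` stands for `Ū`, and the projections
`specProj hsr (zeroRowCol m _)` are the leave-one-out ones. -/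
structure GoodEvent (hsr : s + r ≤ n) (xbar : Fin n → H) (W : Matrix (Fin n) (Fin r) ℝ)
    (K Δ μ θ γ p : ℝ) (z : Fin n → H) : Prop where
  norm_le : ‖sampleGram xbar z - mulTr xbar xbar‖ ≤ K * γ * Δ
  cross_le : ∀ m, vnorm (fun i => ⟪z i, xbar m⟫) ≤ K * γ * Δ * (μ * θ)
  looErr_le : norm2p p (loo (fun j => xbar j + z j) z fun m =>
    specProj hsr (zeroRowCol m (sampleGram xbar z)) * W - W) ≤ K * γ * Δ * norm2p p W
  looSignal_le : norm2p p (loo (fun j => xbar j + z j) z fun _ => W) ≤ K * Δ * norm2p p W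

variable {xbar : Fin n → H} {lb : Fin n → ℝ} {Δ κ μ θ γ p : ℝ}
  {Vb : Matrix (Fin n) (Fin n) ℝ} {Sg : H →L[ℝ] H} {α C c₁ : ℝ}

/-- The quadratic form of `Σ` along the samples, from the ones along the signals and along the
noise. -/
lemma mem_looSet [CompleteSpace H] (hsa : IsSelfAdjoint Sg) (hpos : ∀ u, 0 ≤ ⟪Sg u, u⟫)
    {β K₁ ρ : ℝ} {z : Fin n → H}
    (hbar : ‖Sg‖ * ‖mulTr xbar xbar‖ ≤ β) (hβ : 0 ≤ β) (hK₁ : 0 ≤ K₁)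
    (hz : ∀ v : Fin n → ℝ, ⟪Sg (∑ i, v i • z i), ∑ i, v i • z i⟫ ≤ K₁ * β * vnorm v ^ 2)
    {m : Fin n} (hρ : ‖zeroRowCol m (sampleGram xbar z) - mulTr xbar xbar‖ ≤ ρ) :
    z ∈ looSet Sg xbar m ρ (2 * (1 + K₁) * β) := by
  refine ⟨hρ, fun c => ?_⟩
  set c' : Fin n → ℝ := fun j => if j ≠ m then c j else 0
  have hc : vnorm c' ≤ vnorm c := vnorm_ite_le _ c
  have e : ∑ j, (if j ≠ m then c j else 0) • (xbar j + z j) =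
      ∑ j, c' j • xbar j + ∑ j, c' j • z j := by
    simp only [smul_add, Finset.sum_add_distrib, c']
  rw [e]
  refine (quadForm_add_le hsa hpos _ _).trans ?_
  have h1 := quadForm_sum_le Sg xbar c'
  have h2 := hz c'
  have h3 : ‖Sg‖ * ‖mulTr xbar xbar‖ * vnorm c' ^ 2 ≤ β * vnorm c' ^ 2 := by gcongr
  have h4 : vnorm c' ^ 2 ≤ vnorm c ^ 2 := pow_le_pow_left₀ (vnorm_nonneg _) hc 2
  calc _ ≤ 2 * (1 + K₁) * β * vnorm c' ^ 2 := by linarith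
    _ ≤ _ := by gcongr

/-- The quadratic forms that control the leave-one-out errors `P_m Ū - Ū`: on `looSet` the error has
operator norm at most `2 ε`, by Davis–Kahan. -/
lemma quadForm_looErr_le (hsr : s + r ≤ n) (hr : 1 ≤ r) (h : Sizes xbar lb s r Δ κ μ θ γ)
    (hb : IsEigendecomposition (mulTr xbar xbar) lb Vb) {ε b : ℝ} (hε : ε ≤ 1 / 2)
    (hb0 : 0 ≤ b) (m : Fin n) (z : Fin n → H) (v : Fin r → ℝ) :
    ⟪Sg (∑ j, (if j ≠ m then
        (looErr hsr Sg xbar (ε * Δ) b (blockCols hsr Vb) m z *ᵥ v) j else 0) • (xbar j + z j)),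
      ∑ j, (if j ≠ m then
        (looErr hsr Sg xbar (ε * Δ) b (blockCols hsr Vb) m z *ᵥ v) j else 0) •
          (xbar j + z j)⟫ ≤ (2 * ε) ^ 2 * b * vnorm v ^ 2 := by
  by_cases hz : z ∈ looSet Sg xbar m (ε * Δ) b
  · refine (hz.2 _).trans ?_
    obtain ⟨la, V, e, hP⟩ := exists_specProj_eq hsr
      (zeroRowCol_transpose (sampleGram_transpose xbar z) m)
    have h1 := norm_one_sub_proj_mul_le hsr hr h hb e hε hz.1
    rw [← hP, Matrix.sub_mul, Matrix.one_mul, norm_sub_rev] at h1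
    rw [looErr, if_pos hz]
    have h2 : vnorm ((specProj hsr (zeroRowCol m (sampleGram xbar z)) * blockCols hsr Vb -
        blockCols hsr Vb) *ᵥ v) ≤ 2 * ε * vnorm v :=
      (vnorm_mulVec_le _ _).trans (mul_le_mul_of_nonneg_right h1 (vnorm_nonneg v))
    calc _ ≤ b * (2 * ε * vnorm v) ^ 2 := by
          gcongr
          exact vnorm_nonneg _
      _ = _ := by ring
  · simp only [looErr, if_neg hz, Matrix.zero_mulVec, Pi.zero_apply, ite_self, zero_smul,
      Finset.sum_const_zero, inner_zero_right]
    positivity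

/-- The same for `Ū` in place of the leave-one-out error `P_m Ū - Ū`. -/
lemma quadForm_looSignal_le (hsr : s + r ≤ n) (hVb : Vbᵀ * Vb = 1) {ρ b : ℝ}
    (hb0 : 0 ≤ b) (m : Fin n) (z : Fin n → H) (v : Fin r → ℝ) :
    ⟪Sg (∑ j, (if j ≠ m then
        (looSignal Sg xbar ρ b (blockCols hsr Vb) m z *ᵥ v) j else 0) • (xbar j + z j)),
      ∑ j, (if j ≠ m then
        (looSignal Sg xbar ρ b (blockCols hsr Vb) m z *ᵥ v) j else 0) •
          (xbar j + z j)⟫ ≤ b * vnorm v ^ 2 := by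
  by_cases hz : z ∈ looSet Sg xbar m ρ b
  · refine (hz.2 _).trans_eq ?_
    rw [looSignal, if_pos hz, vnorm_mulVec_of_orthonormal (blockCols_orthonormal hsr hVb)]
  · simp only [looSignal, if_neg hz, Matrix.zero_mulVec, Pi.zero_apply, ite_self, zero_smul,
      Finset.sum_const_zero, inner_zero_right]
    positivity

variable [CompleteSpace H] [SecondCountableTopology H] [MeasurableSpace H] [BorelSpace H]
  {ν : Fin n → Measure H} [∀ i, IsProbabilityMeasure (ν i)]

/-- All row-wise bounds on `(⟨z_i, x̄_m⟩)_i` hold simultaneously. -/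
lemma measure_exists_cross_gt_le (hn : 0 < n) (hν : ∀ i, SubGaussianLaw (ν i) α Sg) {β t : ℝ}
    (hβ0 : 0 < β) (ht : 0 < t) (hx : ∀ m, ‖Sg‖ * ‖xbar m‖ ^ 2 ≤ β * t ^ 2)
    {K : ℝ} (hK : 4 * (C + 5 + α ^ 2) ≤ K) (hK0 : 0 ≤ K) :
    Measure.pi ν {z | ∃ m, K * (√(n * β) * t) < vnorm (fun i => ⟪z i, xbar m⟫)} ≤
      eexp (-(C * n)) := by
  have hm : ∀ m, Measure.pi ν {z | K * (√(n * β) * t) < vnorm (fun i => ⟪z i, xbar m⟫)} ≤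
      eexp (-((C + 1) * n)) := fun m => by
    have h1 := measure_norm_cross_gt_le (C := C + 1) (K := K) hn hν (β := β * t ^ 2)
      (by positivity) (fun j => if j = m then xbar m else 0) (fun w => by
        have e : ∑ j, w j • (if j = m then xbar m else 0) = w m • xbar m := by simp
        rw [e]
        refine (quadForm_le_norm Sg _).trans ?_
        rw [norm_smul, mul_pow, Real.norm_eq_abs, sq_abs]
        have h2 : w m ^ 2 ≤ vnorm w ^ 2 := sq_le_sq.2 (by
          rw [abs_of_nonneg (vnorm_nonneg w)]; exact abs_apply_le_vnorm w m)
        calc ‖Sg‖ * (w m ^ 2 * ‖xbar m‖ ^ 2) = ‖Sg‖ * ‖xbar m‖ ^ 2 * w m ^ 2 := by ring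
          _ ≤ β * t ^ 2 * vnorm w ^ 2 := by
              exact mul_le_mul (hx m) h2 (sq_nonneg _) (by positivity)) (by linarith) hK0
    refine (measure_mono fun z hz => ?_).trans h1
    simp only [Set.mem_ofPred_eq] at hz ⊢
    have e : √(n * (β * t ^ 2)) = √(n * β) * t := by
      rw [← mul_assoc, Real.sqrt_mul (by positivity), Real.sqrt_sq ht.le]
    rw [e]
    exact hz.trans_le (vnorm_le_norm_mulTr_single z (xbar m) m)
  have hU : {z : Fin n → H | ∃ m, K * (√(n * β) * t) < vnorm (fun i => ⟪z i, xbar m⟫)} =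
      ⋃ m, {z | K * (√(n * β) * t) < vnorm (fun i => ⟪z i, xbar m⟫)} := by
    ext z; simp
  rw [hU]
  refine (measure_iUnion_fintype_le _ _).trans ((Finset.sum_le_sum fun m _ => hm m).trans ?_)
  have e : (-((C + 1) * n) : ℝ) = -(C * n) + -n := by ring
  rw [Finset.sum_const, Finset.card_univ, Fintype.card_fin, nsmul_eq_mul, e, eexp_add]
  have h3 : (n : ENNReal) * eexp (-n) ≤ 1 := by
    have : (n : ENNReal) = ENNReal.ofReal n := by simp
    rw [this, eexp, ← ENNReal.ofReal_mul (by positivity), ← ENNReal.ofReal_one]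
    refine ENNReal.ofReal_le_ofReal ?_
    rw [Real.exp_neg, ← div_eq_mul_inv]
    exact div_le_one_of_le₀ (by linarith [Real.add_one_le_exp (n : ℝ)]) (Real.exp_pos _).le
  calc (n : ENNReal) * (eexp (-(C * n)) * eexp (-n)) = eexp (-(C * n)) * (n * eexp (-n)) := by ring
    _ ≤ eexp (-(C * n)) * 1 := by gcongr
    _ = _ := mul_one _

set_option maxHeartbeats 1000000 in
/-- The deterministic analysis applies with probability `1 - O(exp(-C p))`. -/
theorem measure_not_goodEvent_le (hsr : s + r ≤ n) (hr : 1 ≤ r) (h : Sizes xbar lb s r Δ κ μ θ γ)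
    (hb : IsEigendecomposition (mulTr xbar xbar) lb Vb) (hα : 0 < α) (hsa : IsSelfAdjoint Sg)
    (hpos : ∀ u, 0 ≤ ⟪Sg u, u⟫) (hν : ∀ i, SubGaussianLaw (ν i) α Sg) (hC : 0 ≤ C) (hc₁ : 0 ≤ c₁)
    (hp : 2 ≤ p) {β : ℝ} (hβ : n * β = (γ * Δ) ^ 2)
    (hHS : ∀ (k : ℕ) (e : Fin k → H), Orthonormal ℝ e → ∑ i, ‖Sg (e i)‖ ^ 2 ≤ β)
    (hop : n * ‖Sg‖ ^ 2 ≤ β) (hSκ : ‖Sg‖ * (κ * Δ) ≤ β) (hbar : ‖mulTr xbar xbar‖ ≤ κ * Δ)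
    (hθ : θ ^ 2 = r / n) (hpγ : p * (μ * γ) ^ 2 ≤ c₁) (hsmall : 40 * rateConst α C c₁ * γ ≤ 1) :
    Measure.pi ν {z | ¬ GoodEvent hsr xbar (blockCols hsr Vb) (rateConst α C c₁) Δ μ θ γ p z} ≤
      6 * eexp (-(C * p)) := by
  have hn : 0 < n := by omega
  have hn' : (0 : ℝ) < n := by exact_mod_cast hn
  have hr' : (1 : ℝ) ≤ r := by exact_mod_cast hr
  have hΔ := h.Δ_pos
  have hκ := h.one_le_κ
  have hμ := h.one_le_μ
  have hγ := h.γ_pos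
  have hθ0 := h.θ_pos
  have hβ0 : 0 < β := by
    have : 0 < n * β := by rw [hβ]; positivity
    exact pos_of_mul_pos_right this hn'.le
  have hsq : √(n * β) = γ * Δ := by rw [hβ, Real.sqrt_sq (by positivity)]
  set C' := C * c₁ with hC'
  have hC'0 : 0 ≤ C' := mul_nonneg hC hc₁
  set K₁ := quadConst α C' with hK₁
  set K₂ := noiseConst α C' with hK₂
  set K₀ := opConst α C' with hK₀
  set K := rateConst α C c₁ with hK
  have hK₁0 : 0 ≤ K₁ := quadConst_nonneg α hC'0
  have hK₂0 : 0 ≤ K₂ := noiseConst_nonneg α hC'0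
  have hK₀1 : 1 ≤ K₀ := one_le_opConst α hC'0
  have hK₀K : K₀ ≤ K := opConst_le_rateConst hα hC hc₁
  have hK₀γ : 40 * K₀ * γ ≤ 1 := le_trans (by gcongr) hsmall
  have hγ1 : γ ≤ 1 := by nlinarith
  have hμθ : μ * θ ≤ γ := by
    refine le_trans ?_ h.le_γ
    rw [mul_assoc]
    exact le_mul_of_one_le_left (by positivity) hκ
  have hθγ : θ ≤ μ * γ := by
    have h1 : 1 * θ ≤ μ * θ := by gcongr
    have h2 : 1 * γ ≤ μ * γ := by gcongr
    linarith
  -- `θ ≤ μ γ` turns `p ≲ (μ γ)⁻²` into `p ≲ n`, so that bounds with probability `1 - exp(-C' n)` suffice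
  have hpn : p ≤ c₁ * n := by
    have h1 : p * θ ^ 2 ≤ c₁ := le_trans (by gcongr) hpγ
    have h2 : p * 1 ≤ p * r := by gcongr
    have h3 : p * r = p * θ ^ 2 * n := by rw [hθ]; field_simp
    have h4 : p * θ ^ 2 * n ≤ c₁ * n := by gcongr
    linarith
  have hexp : eexp (-(C' * n)) ≤ eexp (-(C * p)) := eexp_mono (by
    have : C * p ≤ C * (c₁ * n) := by gcongr
    rw [hC']; linarith)
  set W := blockCols hsr Vb with hW
  set N := norm2p p W with hN
  have hθN : (n : ℝ) ^ (1 / p) * θ ≤ N := by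
    have h1 := rpow_mul_sqrt_le_norm2p hn hp W
    rw [frobSq_blockCols hsr hb.tmul, ← hθ, Real.sqrt_sq hθ0.le] at h1
    exact h1
  -- the threshold in the two leave-one-out bounds
  set Q := √(2 * (1 + K₁) * (1 + c₁)) with hQ
  have hthr : √(2 * (1 + K₁) * β) * √(p + r) ≤ Q * (Δ * θ) := by
    rw [← Real.sqrt_mul (by positivity)]
    refine Real.sqrt_le_iff.2 ⟨by positivity, ?_⟩
    rw [mul_pow, hQ, Real.sq_sqrt (by positivity)]
    have h1 : β * (p + r) ≤ (1 + c₁) * (Δ * θ) ^ 2 := by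
      have h2 : γ ^ 2 * p ≤ c₁ := by
        have : γ ^ 2 ≤ (μ * γ) ^ 2 := by
          gcongr
          exact le_mul_of_one_le_left hγ.le hμ
        calc γ ^ 2 * p ≤ (μ * γ) ^ 2 * p := by gcongr
          _ ≤ c₁ := by linarith
      have h3 : γ ^ 2 * r ≤ 1 * r := by gcongr; exact pow_le_one₀ hγ.le hγ1
      have h4 : γ ^ 2 * (p + r) ≤ (1 + c₁) * r := by nlinarith
      have h5 : n * (β * (p + r)) ≤ n * ((1 + c₁) * (Δ * θ) ^ 2) := by
        calc n * (β * (p + r)) = Δ ^ 2 * (γ ^ 2 * (p + r)) := by rw [← mul_assoc, hβ]; ring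
          _ ≤ Δ ^ 2 * ((1 + c₁) * r) := by gcongr
          _ = _ := by rw [mul_pow, hθ]; field_simp
      exact le_of_mul_le_mul_left h5 hn'
    calc 2 * (1 + K₁) * β * (p + r) = 2 * (1 + K₁) * (β * (p + r)) := by ring
      _ ≤ 2 * (1 + K₁) * ((1 + c₁) * (Δ * θ) ^ 2) := by gcongr
      _ = _ := by ring
  have hK0 : 0 < K := by linarith
  have hKeq : K = K₀ * (1 + 30 * (Real.exp C * (α * Q))) := rfl
  set R := Real.exp C * (α * Q) with hR
  have hR0 : 0 ≤ R := by positivity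
  have hKR : 30 * (K₀ * R) ≤ K := by rw [hKeq]; nlinarith
  have hKR' : 30 * R ≤ K := le_trans (by nlinarith) hKR
  have h1 := measure_quadForm_sum_gt_le hn hα hsa hpos hν hβ0 hHS hop hC'0
  have hαK : 0 ≤ α ^ 2 * K₁ := by positivity
  have hα2 : 0 ≤ α ^ 2 := by positivity
  have h2 := measure_norm_cross_gt_le (C := C') (K := K₂) hn hν hβ0 xbar (fun w =>
    (quadForm_sum_le Sg xbar w).trans (by
      gcongr
      exact le_trans (by gcongr) hSκ)) (by rw [hK₂, noiseConst]; linarith) hK₂0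
  have h3 := measure_exists_cross_gt_le (C := C') (K := K₂) (xbar := xbar) (t := μ * θ) hn hν hβ0
    (by positivity) (fun m => by
      calc ‖Sg‖ * ‖xbar m‖ ^ 2 ≤ ‖Sg‖ * ((μ * θ) ^ 2 * (κ * Δ)) := by gcongr; exact h.norm_le m
        _ = ‖Sg‖ * (κ * Δ) * (μ * θ) ^ 2 := by ring
        _ ≤ _ := by gcongr) (by rw [hK₂, noiseConst]; linarith) hK₂0
  have h4 := measure_norm_lowerPart_gt_le (C := C') (K := K₂) (K₁ := K₁) hn hν hβ0 hK₁0
    (by rw [hK₂, noiseConst]; linarith) hK₂0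
  set b := 2 * (1 + K₁) * β with hbdef
  have hb0 : 0 < b := by positivity
  -- `5 K₀ γ Δ` bounds the distance of the leave-one-out matrices to the signal Gram matrix
  set ε := 5 * K₀ * γ with hε
  have hε0 : 0 < ε := by positivity
  have hε1 : ε ≤ 1 / 8 := by rw [hε]; linarith
  have h5 := measure_norm2p_loo_ge_le (C := C) (p := p) hn hα hν xbar
    (looErr hsr Sg xbar (ε * Δ) b W)
    (fun m j k => measurable_looErr hsr Sg hb hΔ h.gap (by nlinarith) b W m j k)
    (looErr_update hsr Sg xbar (ε * Δ) b W) (b := (2 * ε) ^ 2 * b) (by positivity)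
    (fun m z v => quadForm_looErr_le hsr hr h hb (by linarith) hb0.le m z v) (by linarith)
  have h6 := measure_norm2p_loo_ge_le (C := C) (p := p) hn hα hν xbar
    (looSignal Sg xbar (ε * Δ) b W)
    (fun m j k => measurable_looSignal Sg xbar (ε * Δ) b W m j k)
    (looSignal_update Sg xbar (ε * Δ) b W) (b := b) hb0
    (fun m z v => quadForm_looSignal_le hsr hb.tmul hb0.le m z v) (by linarith)
  set B1 := {z : Fin n → H | ¬ ∀ v : Fin n → ℝ, ⟪Sg (∑ i, v i • z i), ∑ i, v i • z i⟫ ≤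
    (16 * α ^ 2 * (C' + 6)) * β * vnorm v ^ 2} with hB1
  set B2 := {z : Fin n → H | K₂ * √(n * β) < ‖mulTr z xbar‖} with hB2
  set B3 := {z : Fin n → H | ∃ m, K₂ * (√(n * β) * (μ * θ)) < vnorm (fun i => ⟪z i, xbar m⟫)}
    with hB3
  set B4 := {z : Fin n → H | K₂ * √(n * β) < ‖lowerPart (mulTr z z)‖ ∧
      ∀ v : Fin n → ℝ, ⟪Sg (∑ i, v i • z i), ∑ i, v i • z i⟫ ≤ K₁ * β * vnorm v ^ 2} with hB4
  set B5 := {z : Fin n → H |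
    (n : ℝ) ^ (1 / p) * (Real.exp C * (3 * (α * √((2 * ε) ^ 2 * b)) * √(p + r))) ≤
      norm2p p (loo (fun j => xbar j + z j) z fun m => looErr hsr Sg xbar (ε * Δ) b W m z)} with hB5
  set B6 := {z : Fin n → H |
    (n : ℝ) ^ (1 / p) * (Real.exp C * (3 * (α * √b) * √(p + r))) ≤
      norm2p p (loo (fun j => xbar j + z j) z fun m => looSignal Sg xbar (ε * Δ) b W m z)} with hB6
  -- outside the six exceptional events no cut-off is active
  have hsub : {z | ¬ GoodEvent hsr xbar W K Δ μ θ γ p z} ⊆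
      B1 ∪ B2 ∪ B3 ∪ B4 ∪ B5 ∪ B6 := by
    intro z hz
    by_contra hcon
    simp only [Set.mem_union, not_or] at hcon
    obtain ⟨⟨⟨⟨⟨n1, n2⟩, n3⟩, n4⟩, n5⟩, n6⟩ := hcon
    simp only [hB1, Set.mem_ofPred_eq, not_not] at n1
    simp only [hB2, Set.mem_ofPred_eq, not_lt, hsq] at n2
    simp only [hB3, Set.mem_ofPred_eq, not_exists, not_lt, hsq] at n3
    simp only [hB4, Set.mem_ofPred_eq, not_and, hsq] at n4
    simp only [hB5, Set.mem_ofPred_eq, not_le] at n5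
    simp only [hB6, Set.mem_ofPred_eq, not_le] at n6
    have n4' : ‖lowerPart (mulTr z z)‖ ≤ K₂ * (γ * Δ) := by
      by_contra hh
      exact n4 (not_le.1 hh) n1
    have hE0 : ‖sampleGram xbar z - mulTr xbar xbar‖ ≤ K₀ * γ * Δ := by
      refine (norm_sampleGram_sub_le xbar z (c := γ * Δ) (by positivity) n2 n4' fun i => ?_).trans ?_
      · calc ‖xbar i‖ ^ 2 ≤ (μ * θ) ^ 2 * κ * Δ := by linarith [h.norm_le i]
          _ ≤ γ ^ 2 * Δ := by gcongr; exact h.θμ_le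
          _ ≤ γ * Δ := by gcongr; nlinarith
      · rw [hK₀, opConst, ← hK₂]; apply le_of_eq; ring
    have hmem : ∀ m, z ∈ looSet Sg xbar m (ε * Δ) b := fun m =>
      mem_looSet hsa hpos (le_trans (by gcongr) hSκ) hβ0.le hK₁0 n1
        (norm_zeroRowCol_sub_le h hK₀1 (sampleGram_transpose xbar z) hE0 m)
    simp only [looErr, if_pos (hmem _)] at n5
    simp only [looSignal, if_pos (hmem _)] at n6
    refine hz ⟨hE0.trans (by gcongr), fun m => (n3 m).trans ?_, n5.le.trans ?_, n6.le.trans ?_⟩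
    · have : K₂ ≤ K := le_trans (by rw [hK₀, opConst, ← hK₂]; linarith) hK₀K
      calc _ ≤ K * (γ * Δ * (μ * θ)) := by gcongr
        _ = _ := by ring
    · rw [Real.sqrt_mul (by positivity), Real.sqrt_sq (by positivity)]
      calc (n : ℝ) ^ (1 / p) * (Real.exp C * (3 * (α * (2 * ε * √b)) * √(p + r)))
          = (n : ℝ) ^ (1 / p) * (Real.exp C * α * 6 * ε) * (√b * √(p + r)) := by ring
        _ ≤ (n : ℝ) ^ (1 / p) * (Real.exp C * α * 6 * ε) * (Q * (Δ * θ)) := by gcongr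
        _ = 30 * (K₀ * R) * γ * Δ * ((n : ℝ) ^ (1 / p) * θ) := by rw [hR, hε]; ring
        _ ≤ K * γ * Δ * N := by gcongr
    · calc (n : ℝ) ^ (1 / p) * (Real.exp C * (3 * (α * √b) * √(p + r)))
          = (n : ℝ) ^ (1 / p) * (Real.exp C * α * 3) * (√b * √(p + r)) := by ring
        _ ≤ (n : ℝ) ^ (1 / p) * (Real.exp C * α * 3) * (Q * (Δ * θ)) := by gcongr
        _ = 3 * R * Δ * ((n : ℝ) ^ (1 / p) * θ) := by rw [hR]; ring
        _ ≤ K * Δ * N := by gcongr; linarith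
  calc Measure.pi ν {z | ¬ GoodEvent hsr xbar W K Δ μ θ γ p z}
      ≤ Measure.pi ν (B1 ∪ B2 ∪ B3 ∪ B4 ∪ B5 ∪ B6) := measure_mono hsub
    _ ≤ Measure.pi ν B1 + Measure.pi ν B2 + Measure.pi ν B3 + Measure.pi ν B4 +
        Measure.pi ν B5 + Measure.pi ν B6 := by
        refine (measure_union_le _ _).trans (add_le_add ?_ le_rfl)
        refine (measure_union_le _ _).trans (add_le_add ?_ le_rfl)
        refine (measure_union_le _ _).trans (add_le_add ?_ le_rfl)
        refine (measure_union_le _ _).trans (add_le_add ?_ le_rfl)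
        exact measure_union_le _ _
    _ ≤ eexp (-(C * p)) + eexp (-(C * p)) + eexp (-(C * p)) + eexp (-(C * p)) +
        eexp (-(C * p)) + eexp (-(C * p)) := by
        gcongr
        · exact h1.trans hexp
        · exact h2.trans hexp
        · exact h3.trans hexp
        · exact h4.trans hexp
    _ = _ := by ring

end GoodEvent

end KPCA

/-! ### The signal Gram matrix -/

namespace KPCA

section Signal

open scoped Matrix.Norms.L2Operator

variable {n r s : ℕ} {H : Type*} [NormedAddCommGroup H] [InnerProductSpace ℝ H]
  {xbar : Fin n → H} {lb : Fin n → ℝ} {Vb : Matrix (Fin n) (Fin n) ℝ}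

lemma extEig_zero (lb : Fin n → ℝ) : extEig lb 0 = ⊤ := by simp [extEig]

lemma extEig_succ (lb : Fin n → ℝ) {k : ℕ} (hk : k < n) : extEig lb (k + 1) = (lb ⟨k, hk⟩ : EReal) := by
  simp [extEig, hk]

lemma extEig_top (lb : Fin n → ℝ) : extEig lb (n + 1) = ⊥ := by simp [extEig]

/-- The two inequalities behind a finite positive eigen-gap; each side of the block that reaches
the end of the spectrum gives no condition. -/
lemma gap_spec (hgap : 0 < eigengap lb s r ∧ eigengap lb s r < ⊤) :
    0 < gap lb s r ∧
      (∀ (h0 : 0 < s) (h1 : s < n), lb ⟨s, h1⟩ + gap lb s r ≤ lb ⟨s - 1, by omega⟩) ∧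
      (∀ (h0 : 0 < r) (h1 : s + r < n),
        lb ⟨s + r, h1⟩ + gap lb s r ≤ lb ⟨s + r - 1, by omega⟩) := by
  have hcoe : ((gap lb s r : ℝ) : EReal) = eigengap lb s r :=
    EReal.coe_toReal hgap.2.ne (ne_bot_of_gt hgap.1)
  have h1 : ((gap lb s r : ℝ) : EReal) ≤ extEig lb s - extEig lb (s + 1) := by
    rw [hcoe]; exact min_le_left _ _
  have h2 : ((gap lb s r : ℝ) : EReal) ≤ extEig lb (s + r) - extEig lb (s + r + 1) := by
    rw [hcoe]; exact min_le_right _ _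
  refine ⟨?_, fun h0 hs => ?_, fun h0 hs => ?_⟩
  · have := hgap.1
    rw [← hcoe] at this
    exact_mod_cast this
  · obtain ⟨k, rfl⟩ : ∃ k, s = k + 1 := ⟨s - 1, by omega⟩
    rw [extEig_succ lb hs, extEig_succ lb (by omega : k < n), ← EReal.coe_sub] at h1
    have := EReal.coe_le_coe_iff.1 h1
    simp only [Nat.add_sub_cancel]
    linarith
  · obtain ⟨k, hk⟩ : ∃ k, s + r = k + 1 := ⟨s + r - 1, by omega⟩
    rw [extEig_succ lb hs, show extEig lb (s + r) = _ from hk ▸ extEig_succ lb (by omega : k < n),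
      ← EReal.coe_sub] at h2
    have := EReal.coe_le_coe_iff.1 h2
    have e : (⟨s + r - 1, by omega⟩ : Fin n) = ⟨k, by omega⟩ := Fin.ext (by simp [hk])
    rw [e]
    linarith

/-- A block that contains all the eigenvalues has infinite eigen-gap. -/
lemma pos_or_lt_of_eigengap_lt_top (hsr : s + r ≤ n) (hr : 1 ≤ r) (hgap : eigengap lb s r < ⊤) :
    0 < s ∨ s + r < n := by
  by_contra hcon
  push Not at hcon
  obtain ⟨h0, h1⟩ := hcon
  obtain rfl : s = 0 := by omega
  obtain rfl : n = r := by omega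
  refine absurd hgap (not_lt.2 ?_)
  obtain ⟨k, rfl⟩ : ∃ k, n = k + 1 := ⟨n - 1, by omega⟩
  have a1 : extEig lb (0 + 1) = (lb ⟨0, by omega⟩ : EReal) := extEig_succ lb (by omega)
  have a2 : extEig lb (0 + (k + 1)) = (lb ⟨k, by omega⟩ : EReal) := by
    rw [zero_add]; exact extEig_succ lb (by omega)
  have a3 : extEig lb (0 + (k + 1) + 1) = ⊥ := by rw [zero_add]; exact extEig_top lb
  rw [eigengap, extEig_zero, a1, a2, a3]
  simp

lemma blockGap_gap (hsr : s + r ≤ n) (hr : 1 ≤ r) (hlb : Antitone lb)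
    (hgap : 0 < eigengap lb s r ∧ eigengap lb s r < ⊤) : BlockGap lb lb s r (gap lb s r) := by
  obtain ⟨-, h1, h2⟩ := gap_spec hgap
  intro i j hi hj
  simp only [InBlock] at hi hj
  constructor
  · intro hij
    have hij' : (i : ℕ) < j := hij
    have h3 := h1 (by omega) (by omega)
    have h4 : lb ⟨s - 1, by omega⟩ ≤ lb i := hlb (by simp only [Fin.le_def]; omega)
    have h5 : lb j ≤ lb ⟨s, by omega⟩ := hlb (by simp only [Fin.le_def]; omega)
    linarith
  · intro hij
    have hij' : (j : ℕ) < i := hij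
    have h3 := h2 (by omega) (by omega)
    have h4 : lb i ≤ lb ⟨s + r, by omega⟩ := hlb (by simp only [Fin.le_def]; omega)
    have h5 : lb ⟨s + r - 1, by omega⟩ ≤ lb j := hlb (by simp only [Fin.le_def]; omega)
    linarith

lemma eig_nonneg (hb : IsEigendecomposition (mulTr xbar xbar) lb Vb) (j : Fin n) : 0 ≤ lb j := by
  have h1 := norm_sum_smul_sq xbar (Vb *ᵥ Pi.single j 1)
  rw [hb.quadForm, Matrix.mulVec_mulVec, hb.tmul, Matrix.one_mulVec] at h1
  have h2 : ∑ i, lb i * (Pi.single j 1 : Fin n → ℝ) i ^ 2 = lb j := by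
    rw [Finset.sum_eq_single j]
    · simp
    · intro i _ hi; simp [hi]
    · simp
  rw [← h2, ← h1]
  positivity

lemma norm_mulTr_le (hn : 0 < n) (hb : IsEigendecomposition (mulTr xbar xbar) lb Vb) :
    ‖mulTr xbar xbar‖ ≤ lb ⟨0, hn⟩ := by
  have h0 := eig_nonneg hb ⟨0, hn⟩
  have h1 : ‖Vb‖ ≤ 1 := norm_le_one_of_orthonormal hb.tmul
  have h2 : ‖Matrix.diagonal lb‖ ≤ lb ⟨0, hn⟩ := norm_diagonal_le _ h0 fun i => by
    rw [abs_of_nonneg (eig_nonneg hb i)]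
    exact hb.antitone (by simp [Fin.le_def])
  rw [hb.eq_conj]
  calc _ ≤ 1 * lb ⟨0, hn⟩ * 1 := by
        refine (norm_mul_le' _ _).trans ?_
        rw [norm_transpose]
        gcongr
        refine (norm_mul_le' _ _).trans ?_
        gcongr
    _ = _ := by ring

lemma norm_dataOp_le (hn : 0 < n) (hb : IsEigendecomposition (mulTr xbar xbar) lb Vb) :
    ‖dataOp xbar‖ ≤ √(lb ⟨0, hn⟩) := by
  have h0 := eig_nonneg hb ⟨0, hn⟩
  refine ContinuousLinearMap.opNorm_le_bound _ (Real.sqrt_nonneg _) fun u => ?_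
  set w : Fin n → ℝ := fun i => ⟪xbar i, u⟫ with hw
  have e : ‖dataOp xbar u‖ = vnorm w := rfl
  rw [e]
  have h1 : vnorm w ^ 2 = ⟪∑ i, w i • xbar i, u⟫ := by
    rw [vnorm_sq, sum_inner]
    refine Finset.sum_congr rfl fun i _ => ?_
    rw [real_inner_smul_left, sq]
  have h2 : ‖∑ i, w i • xbar i‖ ≤ √(lb ⟨0, hn⟩) * vnorm w := by
    refine le_of_sq_le_sq ?_ (mul_nonneg (Real.sqrt_nonneg _) (vnorm_nonneg w))
    rw [norm_sum_smul_sq, mul_pow, Real.sq_sqrt h0]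
    refine (le_abs_self _).trans ((abs_dotProduct_le _ _).trans ?_)
    have h3 := vnorm_mulVec_le (mulTr xbar xbar) w
    have h4 := norm_mulTr_le hn hb
    have h5 := vnorm_nonneg w
    calc _ ≤ vnorm w * (lb ⟨0, hn⟩ * vnorm w) := by
          gcongr
          exact h3.trans (by gcongr)
      _ = _ := by ring
  have h3 : vnorm w * vnorm w ≤ vnorm w * (√(lb ⟨0, hn⟩) * ‖u‖) := by
    rw [← sq, h1]
    refine (real_inner_le_norm _ _).trans ?_
    calc _ ≤ √(lb ⟨0, hn⟩) * vnorm w * ‖u‖ := by gcongr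
      _ = _ := by ring
  rcases (vnorm_nonneg w).eq_or_lt with h4 | h4
  · rw [← h4]; positivity
  · exact le_of_mul_le_mul_left h3 h4

/-- The incoherence bound in terms of the largest eigenvalue, as `‖X̄‖² ≤ λ̄₁`. -/
lemma norm_le_incoh (hn : 0 < n) (hr : 1 ≤ r)
    (hb : IsEigendecomposition (mulTr xbar xbar) lb Vb) (m : Fin n) :
    ‖xbar m‖ ≤ incoh xbar r * √((r : ℝ) / n) * √(lb ⟨0, hn⟩) := by
  have hn' : (0 : ℝ) < n := by exact_mod_cast hn
  have hr' : (0 : ℝ) < r := by exact_mod_cast hr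
  have hμ : 1 ≤ incoh xbar r := le_max_right _ _
  rcases (norm_nonneg (dataOp xbar)).eq_or_lt with h0 | h0
  · -- a vanishing operator norm means that all the signals vanish
    have h1 : dataOp xbar (xbar m) = 0 := by rw [norm_eq_zero.1 h0.symm]; simp
    have h2 : (dataOp xbar (xbar m)) m = ⟪xbar m, xbar m⟫ := rfl
    rw [h1] at h2
    have h3 : xbar m = 0 := inner_self_eq_zero.1 h2.symm
    rw [h3, norm_zero]
    positivity
  · have h1 : ‖xbar m‖ ≤ ⨆ i, ‖xbar i‖ := le_ciSup (f := fun i => ‖xbar i‖) (Set.finite_range _).bddAbove m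
    have h2 : (⨆ i, ‖xbar i‖) / ‖dataOp xbar‖ * √((n : ℝ) / r) ≤ incoh xbar r := le_max_left _ _
    have h3 : √((n : ℝ) / r) * √((r : ℝ) / n) = 1 := by
      rw [← Real.sqrt_mul (by positivity), div_mul_div_cancel₀ hr'.ne', div_self hn'.ne',
        Real.sqrt_one]
    calc ‖xbar m‖ ≤ ⨆ i, ‖xbar i‖ := h1
      _ = ((⨆ i, ‖xbar i‖) / ‖dataOp xbar‖ * (√((n : ℝ) / r) * √((r : ℝ) / n))) *
          ‖dataOp xbar‖ := by rw [h3]; field_simp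
      _ = ((⨆ i, ‖xbar i‖) / ‖dataOp xbar‖ * √((n : ℝ) / r)) * √((r : ℝ) / n) *
          ‖dataOp xbar‖ := by ring
      _ ≤ incoh xbar r * √((r : ℝ) / n) * √(lb ⟨0, hn⟩) := by
          gcongr
          exact norm_dataOp_le hn hb

lemma sum_eig_eq (hb : IsEigendecomposition (mulTr xbar xbar) lb Vb) :
    ∑ i, lb i = ∑ i, ‖xbar i‖ ^ 2 := by
  have h1 : (mulTr xbar xbar).trace = ∑ i, lb i := by
    rw [hb.eq_conj, Matrix.trace_mul_comm, ← Matrix.mul_assoc, hb.tmul, Matrix.one_mul,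
      Matrix.trace_diagonal]
  rw [← h1]
  simp [Matrix.trace, mulTr]

lemma gap_le_eig_zero (hsr : s + r ≤ n) (hr : 1 ≤ r) (hn : 0 < n)
    (hb : IsEigendecomposition (mulTr xbar xbar) lb Vb)
    (hgap : 0 < eigengap lb s r ∧ eigengap lb s r < ⊤) : gap lb s r ≤ lb ⟨0, hn⟩ := by
  obtain ⟨-, h1, h2⟩ := gap_spec hgap
  rcases pos_or_lt_of_eigengap_lt_top hsr hr hgap.2 with h | h
  · have h3 := h1 h (by omega)
    have h4 : lb ⟨s - 1, by omega⟩ ≤ lb ⟨0, hn⟩ := hb.antitone (by simp [Fin.le_def])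
    linarith [eig_nonneg hb ⟨s, by omega⟩]
  · have h3 := h2 (by omega) h
    have h4 : lb ⟨s + r - 1, by omega⟩ ≤ lb ⟨0, hn⟩ := hb.antitone (by simp [Fin.le_def])
    linarith [eig_nonneg hb ⟨s + r, h⟩]

lemma cond_mul_gap (hn : 0 < n) (hΔ : 0 < gap lb s r) : cond lb s r * gap lb s r = lb ⟨0, hn⟩ := by
  have e : extEig lb 1 = (lb ⟨0, hn⟩ : EReal) := extEig_succ lb hn
  rw [cond, e, EReal.toReal_coe, div_mul_cancel₀ _ hΔ.ne']

lemma one_le_cond (hsr : s + r ≤ n) (hr : 1 ≤ r)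
    (hb : IsEigendecomposition (mulTr xbar xbar) lb Vb)
    (hgap : 0 < eigengap lb s r ∧ eigengap lb s r < ⊤) : 1 ≤ cond lb s r := by
  have hn : 0 < n := by omega
  have hΔ := (gap_spec hgap).1
  have h1 := gap_le_eig_zero hsr hr hn hb hgap
  rw [← cond_mul_gap hn hΔ] at h1
  exact le_of_mul_le_mul_right (by linarith) hΔ

/-- Incoherence excludes that the block reaches the last eigenvalue: otherwise the `s = n - r`
eigenvalues above the block would be at least `Δ`, and the trace of the signal Gram matrix too
large. -/
lemma add_lt_of_incoh (hsr : s + r ≤ n) (hr : 1 ≤ r)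
    (hb : IsEigendecomposition (mulTr xbar xbar) lb Vb)
    (hgap : 0 < eigengap lb s r ∧ eigengap lb s r < ⊤)
    (hγ : cond lb s r * incoh xbar r * √((r : ℝ) / n) ≤ 1 / 2) : s + r < n := by
  by_contra hcon
  have hn : 0 < n := by omega
  have hn' : (0 : ℝ) < n := by exact_mod_cast hn
  have hr' : (1 : ℝ) ≤ r := by exact_mod_cast hr
  have hsn : (s : ℝ) + r = n := by
    have : s + r = n := by omega
    exact_mod_cast this
  obtain ⟨hΔ, h1, -⟩ := gap_spec hgap
  have hκ := one_le_cond hsr hr hb hgap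
  have hκΔ := cond_mul_gap hn hΔ
  have hx := norm_le_incoh hn hr hb
  have hμ : 1 ≤ incoh xbar r := le_max_right _ _
  have h0 := eig_nonneg hb ⟨0, hn⟩
  rw [← hκΔ] at hx h0
  set κ := cond lb s r
  set Δ := gap lb s r
  set μ := incoh xbar r
  have hs0 : 0 < s := by
    rcases pos_or_lt_of_eigengap_lt_top hsr hr hgap.2 with h | h
    · exact h
    · exact absurd h hcon
  -- the trace of the signal Gram matrix from above and from below
  have h2 : ∑ i, ‖xbar i‖ ^ 2 ≤ n * (μ ^ 2 * (r / n) * (κ * Δ)) := by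
    calc _ ≤ ∑ _ : Fin n, (μ ^ 2 * (r / n) * (κ * Δ)) := Finset.sum_le_sum fun i _ => by
          have := pow_le_pow_left₀ (norm_nonneg _) (hx i) 2
          rwa [mul_pow, mul_pow, Real.sq_sqrt (by positivity), Real.sq_sqrt h0] at this
      _ = _ := by simp
  have h3 : s * Δ ≤ ∑ i, lb i := by
    have h4 : ∀ i : Fin n, (if (i : ℕ) < s then Δ else 0) ≤ lb i := fun i => by
      split_ifs with hi
      · have h5 := h1 hs0 (by omega)
        have h6 : lb ⟨s - 1, by omega⟩ ≤ lb i := hb.antitone (by simp only [Fin.le_def]; omega)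
        linarith [eig_nonneg hb ⟨s, by omega⟩]
      · exact eig_nonneg hb i
    refine le_trans (le_of_eq ?_) (Finset.sum_le_sum fun i _ => h4 i)
    rw [← Finset.sum_filter, Finset.sum_const, nsmul_eq_mul, Fin.card_filter_val_lt]
    have : min n s = s := by omega
    rw [this]
  rw [sum_eig_eq hb] at h3
  have h4 : s * Δ ≤ (μ ^ 2 * r * κ) * Δ := by
    refine (h3.trans h2).trans_eq ?_
    field_simp
  have h5 := le_of_mul_le_mul_right h4 hΔ
  have h6 : (κ * μ) ^ 2 * (r / n) ≤ 1 / 4 := by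
    have := pow_le_pow_left₀ (by positivity) hγ 2
    rw [mul_pow, Real.sq_sqrt (by positivity)] at this
    linarith
  have h7 : (κ * μ) ^ 2 * r ≤ 1 / 4 * n := by
    have : (κ * μ) ^ 2 * (r / n) * n ≤ 1 / 4 * n := by gcongr
    calc (κ * μ) ^ 2 * r = (κ * μ) ^ 2 * (r / n) * n := by field_simp
      _ ≤ _ := this
  have h8 : μ ^ 2 * r * κ ≤ (κ * μ) ^ 2 * r := by
    have : κ ≤ κ ^ 2 := by nlinarith
    calc μ ^ 2 * r * κ ≤ μ ^ 2 * r * κ ^ 2 := by gcongr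
      _ = _ := by ring
  -- together these give `s ≤ n / 4` and `r ≤ n / 4`, against `s + r = n`
  have h9 : 1 * (r : ℝ) ≤ (κ * μ) ^ 2 * r := by
    gcongr
    exact one_le_pow₀ (one_le_mul_of_one_le_of_one_le hκ hμ)
  linarith

/-- The assumptions on the signal give the size conditions, with `θ = √(r / n)`. -/
lemma sizes_of_assumptions (hsr : s + r ≤ n) (hr : 1 ≤ r)
    (hb : IsEigendecomposition (mulTr xbar xbar) lb Vb)
    (hgap : 0 < eigengap lb s r ∧ eigengap lb s r < ⊤) {γ : ℝ}
    (hγ : cond lb s r * incoh xbar r * √((r : ℝ) / n) ≤ γ) (hγ2 : γ ≤ 1 / 2) :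
    Sizes xbar lb s r (gap lb s r) (cond lb s r) (incoh xbar r) (√((r : ℝ) / n)) γ := by
  have hn : 0 < n := by omega
  have hn' : (0 : ℝ) < n := by exact_mod_cast hn
  have hr' : (0 : ℝ) < r := by exact_mod_cast hr
  obtain ⟨hΔ, -, h2⟩ := gap_spec hgap
  have hlt := add_lt_of_incoh hsr hr hb hgap (hγ.trans hγ2)
  have hκ := one_le_cond hsr hr hb hgap
  have hκΔ := cond_mul_gap hn hΔ
  have hx := norm_le_incoh hn hr hb
  have h0 := eig_nonneg hb ⟨0, hn⟩
  have hμ : 1 ≤ incoh xbar r := le_max_right _ _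
  have hN : ∀ m, ‖xbar m‖ ^ 2 ≤ (incoh xbar r * √((r : ℝ) / n)) ^ 2 * lb ⟨0, hn⟩ := fun m => by
    have := pow_le_pow_left₀ (norm_nonneg _) (hx m) 2
    rwa [mul_pow, Real.sq_sqrt h0] at this
  refine ⟨hΔ, hκ, hμ, by positivity, blockGap_gap hsr hr hb.antitone hgap, fun j hj => ?_,
    fun j hj => ?_, fun m => ?_, fun m => ?_, hγ⟩
  · have h3 := h2 (by omega) hlt
    have h4 : lb ⟨s + r - 1, by omega⟩ ≤ lb j :=
      hb.antitone (by have := hj.2; simp only [Fin.le_def]; omega)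
    linarith [eig_nonneg hb ⟨s + r, hlt⟩]
  · rw [hκΔ]
    exact hb.antitone (by simp [Fin.le_def])
  · -- `Ḡ_m` is the image of `x̄_m` under the signal operator
    have e : vnorm (mulTr xbar xbar m) = ‖dataOp xbar (xbar m)‖ := by
      have : mulTr xbar xbar m = fun i => ⟪xbar i, xbar m⟫ := by
        ext i; simp only [mulTr, Matrix.of_apply, real_inner_comm]
      rw [this]; rfl
    rw [e]
    refine ((dataOp xbar).le_opNorm _).trans ?_
    calc ‖dataOp xbar‖ * ‖xbar m‖ ≤ √(lb ⟨0, hn⟩) *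
          (incoh xbar r * √((r : ℝ) / n) * √(lb ⟨0, hn⟩)) := by
          gcongr
          · exact norm_dataOp_le hn hb
          · exact hx m
      _ = incoh xbar r * √((r : ℝ) / n) * (√(lb ⟨0, hn⟩) * √(lb ⟨0, hn⟩)) := by ring
      _ = incoh xbar r * √((r : ℝ) / n) * (cond lb s r * gap lb s r) := by
          rw [Real.mul_self_sqrt h0, hκΔ]
      _ = _ := by ring
  · rw [hκΔ]; exact hN m

end Signal

end KPCA

/-! ### From fixed `n` to the probabilistic order notation -/

namespace KPCA

section Noise

open scoped Matrix.Norms.L2Operator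

variable {n r s : ℕ} {H : Type*} [NormedAddCommGroup H] [InnerProductSpace ℝ H]
  [MeasurableSpace H] [BorelSpace H] {Ω : Type*} [MeasurableSpace Ω] {P : Measure Ω}
  {z : Fin n → Ω → H} {α : ℝ} {Sg : H →L[ℝ] H}

lemma IsSubGaussianNoise.subGaussianLaw (hz : IsSubGaussianNoise P z α Sg) (i : Fin n) :
    SubGaussianLaw (P.map (z i)) α Sg := by
  intro u
  have hm : Measurable fun y : H => eexp ⟪u, y⟫ :=
    measurable_eexp.comp (by fun_prop : Continuous fun y : H => ⟪u, y⟫).measurable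
  rw [lintegral_map hm (hz.measurable i)]
  simp only [eexp]
  rw [← ofReal_integral_eq_lintegral_ofReal (hz.integrable_exp i u)
    (ae_of_all _ fun ω => (Real.exp_pos _).le)]
  exact ENNReal.ofReal_le_ofReal (hz.mgf_le i u)

variable [CompleteSpace H] [SecondCountableTopology H] [IsProbabilityMeasure P]
  {xbar : Fin n → H} {lb : Fin n → ℝ} {Vb : Matrix (Fin n) (Fin n) ℝ} {ι : Type*}
  {h : HilbertBasis ι ℝ H} {Δ κ μ θ γ p C c₁ : ℝ}

/-- The probability bound for the good event under the concentration hypothesis, which provides one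
parameter `β = (γ Δ)² / n` that dominates `‖Σ‖_HS²`, `n ‖Σ‖²` and `κ Δ ‖Σ‖`. -/
lemma IsSubGaussianNoise.measureReal_not_goodEvent_le (hz : IsSubGaussianNoise P z α Sg)
    (hsr : s + r ≤ n) (hr : 1 ≤ r) (hS : Sizes xbar lb s r Δ κ μ θ γ)
    (hb : IsEigendecomposition (mulTr xbar xbar) lb Vb) (hα : 0 < α)
    (hSg : IsPosTraceClass h Sg) (hC : 0 ≤ C) (hc₁ : 0 ≤ c₁) (hp : 2 ≤ p)
    (hconc : √(n : ℝ) * max (√(κ * ‖Sg‖ / Δ)) (hsNorm h Sg / Δ) ≤ γ)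
    (hκΔ : ∀ hn : 0 < n, κ * Δ = lb ⟨0, hn⟩)
    (hθ : θ ^ 2 = r / n) (hpγ : p * (μ * γ) ^ 2 ≤ c₁) (hsmall : 40 * rateConst α C c₁ * γ ≤ 1) :
    P.real {ω | ¬ GoodEvent hsr xbar (blockCols hsr Vb) (rateConst α C c₁) Δ μ θ γ p
      fun i => z i ω} ≤ 6 * Real.exp (-(C * p)) := by
  have hn : 0 < n := by omega
  have hn' : (0 : ℝ) < n := by exact_mod_cast hn
  have hΔ := hS.Δ_pos
  have hκ := hS.one_le_κ
  have hγ := hS.γ_pos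
  have hγ1 : γ ≤ 1 := by
    have h1 := (one_le_opConst α (mul_nonneg hC hc₁)).trans (opConst_le_rateConst hα hC hc₁)
    nlinarith
  have hprob : ∀ i, IsProbabilityMeasure (P.map (z i)) := fun i =>
    Measure.isProbabilityMeasure_map (hz.measurable i).aemeasurable
  have h1 : n * (κ * ‖Sg‖ / Δ) ≤ γ ^ 2 := by
    have h2 : √(n : ℝ) * √(κ * ‖Sg‖ / Δ) ≤ γ :=
      le_trans (mul_le_mul_of_nonneg_left (le_max_left _ _) (Real.sqrt_nonneg _)) hconc
    have h3 := pow_le_pow_left₀ (by positivity) h2 2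
    rwa [mul_pow, Real.sq_sqrt hn'.le, Real.sq_sqrt (by positivity)] at h3
  have hHS0 : 0 ≤ hsNorm h Sg := Real.sqrt_nonneg _
  have h2 : n * (hsNorm h Sg / Δ) ^ 2 ≤ γ ^ 2 := by
    have h2 : √(n : ℝ) * (hsNorm h Sg / Δ) ≤ γ :=
      le_trans (mul_le_mul_of_nonneg_left (le_max_right _ _) (Real.sqrt_nonneg _)) hconc
    have h3 := pow_le_pow_left₀ (by positivity) h2 2
    rwa [mul_pow, Real.sq_sqrt hn'.le] at h3
  have h4 : n * (‖Sg‖ * (κ * Δ)) ≤ (γ * Δ) ^ 2 := by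
    calc n * (‖Sg‖ * (κ * Δ)) = n * (κ * ‖Sg‖ / Δ) * Δ ^ 2 := by field_simp
      _ ≤ γ ^ 2 * Δ ^ 2 := by gcongr
      _ = _ := by ring
  have h5 : n * ‖Sg‖ ≤ γ * Δ := by
    have h6 : n * ‖Sg‖ * Δ ≤ γ * Δ * Δ := by
      calc n * ‖Sg‖ * Δ = n * (‖Sg‖ * (1 * Δ)) := by ring
        _ ≤ n * (‖Sg‖ * (κ * Δ)) := by gcongr
        _ ≤ (γ * Δ) ^ 2 := h4
        _ = γ * (γ * Δ * Δ) := by ring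
        _ ≤ 1 * (γ * Δ * Δ) := by gcongr
        _ = _ := one_mul _
    exact le_of_mul_le_mul_right h6 hΔ
  set β := (γ * Δ) ^ 2 / n with hβ
  have key := measure_not_goodEvent_le (ν := fun i => P.map (z i)) hsr hr hS hb hα hSg.1 hSg.2.1
    hz.subGaussianLaw hC hc₁ hp (β := β) (by rw [hβ]; field_simp)
    (fun k e he => by
      refine (sum_norm_sq_le_hsNorm_sq hSg he).trans ?_
      rw [hβ, le_div_iff₀ hn']
      calc hsNorm h Sg ^ 2 * n = n * (hsNorm h Sg / Δ) ^ 2 * Δ ^ 2 := by field_simp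
        _ ≤ γ ^ 2 * Δ ^ 2 := by gcongr
        _ = _ := by ring)
    (by
      rw [hβ, le_div_iff₀ hn']
      calc n * ‖Sg‖ ^ 2 * n = (n * ‖Sg‖) ^ 2 := by ring
        _ ≤ _ := by gcongr)
    (by rw [hβ, le_div_iff₀ hn']; linarith)
    ((norm_mulTr_le hn hb).trans_eq (hκΔ hn).symm) hθ hpγ hsmall
  rw [← (iIndepFun_iff_map_fun_eq_pi_map fun i => (hz.measurable i).aemeasurable).1 hz.indep] at key
  have h6 := (Measure.le_map_apply (μ := P)
    (measurable_pi_lambda _ hz.measurable).aemeasurable _).trans key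
  have h7 : (6 : ENNReal) * eexp (-(C * p)) = ENNReal.ofReal (6 * Real.exp (-(C * p))) := by
    rw [eexp, ENNReal.ofReal_mul (by norm_num)]; simp
  rw [h7] at h6
  exact ENNReal.toReal_le_of_le_ofReal (by positivity) h6

end Noise

section Assembly

open scoped Matrix.Norms.L2Operator

variable {n r s : ℕ} {H : Type*} [NormedAddCommGroup H] [InnerProductSpace ℝ H]
  {xbar : Fin n → H} {lb : Fin n → ℝ} {Δ κ μ θ γ p : ℝ} {z x : Fin n → H}
  {Vb V : Matrix (Fin n) (Fin n) ℝ} {la : Fin n → ℝ} {K : ℝ} {G : Matrix (Fin n) (Fin n) ℝ}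

/-- On the good event all the claimed approximations hold, with the rate `κ μ γ`. -/
lemma GoodEvent.bounds (hsr : s + r ≤ n) (hr : 1 ≤ r) (h : Sizes xbar lb s r Δ κ μ θ γ)
    (hK : 1 ≤ K) (hKw : 100 * K * (κ * μ * γ) ≤ 1) (hp : 2 ≤ p) (hθ : θ ^ 2 = r / n)
    (hb : IsEigendecomposition (mulTr xbar xbar) lb Vb)
    (hgood : GoodEvent hsr xbar (blockCols hsr Vb) K Δ μ θ γ p z)
    (hx : ∀ i, x i = xbar i + z i) (hG : G = hollow (mulTr x x))
    (hA : IsEigendecomposition G la V) {S : Matrix (Fin r) (Fin r) ℝ}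
    (hS : IsMatrixSign ((blockCols hsr V)ᵀ * blockCols hsr Vb) S) :
    norm2p p (blockCols hsr V * S - G * blockCols hsr Vb * blockDiag hsr lb (fun t => t⁻¹)) ≤
        200 * K ^ 2 * ((κ * μ * γ) * norm2p p (blockCols hsr Vb)) ∧
      norm2p p (blockCols hsr V * S - (blockCols hsr Vb +
          hollow (mulTr z x) * blockCols hsr Vb * blockDiag hsr lb (fun t => t⁻¹))) ≤
        200 * K ^ 2 * ((κ * μ * γ) * norm2p p (blockCols hsr Vb)) ∧
      norm2p p (blockCols hsr V * S) ≤ 200 * K ^ 2 * norm2p p (blockCols hsr Vb) ∧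
      norm2p p (blockCols hsr V * blockDiag hsr la Real.sqrt * S -
          G * blockCols hsr Vb * blockDiag hsr lb (fun t => (√t)⁻¹)) ≤
        200 * K ^ 2 * ((κ * μ * γ) *
          (norm2p p (blockCols hsr Vb) * specNorm (blockDiag hsr lb Real.sqrt))) ∧
      norm2p p (blockCols hsr V * blockDiag hsr la Real.sqrt * S -
          (blockCols hsr Vb * blockDiag hsr lb Real.sqrt +
            hollow (mulTr z x) * blockCols hsr Vb * blockDiag hsr lb (fun t => (√t)⁻¹))) ≤
        200 * K ^ 2 * ((κ * μ * γ) *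
          (norm2p p (blockCols hsr Vb) * specNorm (blockDiag hsr lb Real.sqrt))) := by
  have hn : 0 < n := by omega
  have hx' : x = fun j => xbar j + z j := funext hx
  have hG' : G = sampleGram xbar z := by rw [hG, hx']; rfl
  have hGs : Gᵀ = G := by rw [hG]; exact hollow_transpose (mulTr_transpose x)
  choose lm Vm hm hP using fun m => exists_specProj_eq hsr (zeroRowCol_transpose hGs m)
  have hθN : (n : ℝ) ^ (1 / p) * θ ≤ norm2p p (blockCols hsr Vb) := by
    have h1 := rpow_mul_sqrt_le_norm2p hn hp (blockCols hsr Vb)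
    rw [frobSq_blockCols hsr hb.tmul, ← hθ, Real.sqrt_sq h.θ_pos.le] at h1
    exact h1
  obtain ⟨g1, g2, g3, g4⟩ := hgood
  rw [← hG'] at g1
  simp only [← hG', hP, ← hx'] at g3
  rw [← hx'] at g4
  exact norm2p_bounds hsr hr h hK hKw hp hb hθN hx hG hA hS g1 g2 hm (fun m => rfl) g3 g4

lemma norm2p_blockCols_pos (hsr : s + r ≤ n) (hr : 1 ≤ r) (hp : 2 ≤ p) (hV : Vbᵀ * Vb = 1) :
    0 < norm2p p (blockCols hsr Vb) := by
  have hn : 0 < n := by omega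
  have hn' : (0 : ℝ) < n := by exact_mod_cast hn
  have hr' : (0 : ℝ) < r := by exact_mod_cast hr
  have h1 := rpow_mul_sqrt_le_norm2p hn hp (blockCols hsr Vb)
  rw [frobSq_blockCols hsr hV] at h1
  exact lt_of_lt_of_le (by positivity) h1

lemma specNorm_blockDiag_sqrt_pos (hsr : s + r ≤ n) (hr : 1 ≤ r)
    (h : Sizes xbar lb s r Δ κ μ θ γ) : 0 < specNorm (blockDiag hsr lb Real.sqrt) := by
  have hspec : specNorm (blockDiag hsr lb Real.sqrt) = ‖blockDiag hsr lb Real.sqrt‖ :=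
    (Matrix.cstar_norm_def _).symm
  rw [hspec]
  refine lt_of_lt_of_le ?_ (abs_entry_le_norm _ ⟨0, hr⟩ ⟨0, hr⟩)
  simp only [blockDiag, Matrix.diagonal_apply_eq]
  rw [abs_of_nonneg (Real.sqrt_nonneg _)]
  exact Real.sqrt_pos.2 (h.Δ_pos.trans_le (h.lb_ge _ (inBlock_blockIdx hsr _)))

/-- A deterministic bound on events of probability `1 - O(exp(-C ρ))`, for every `C`, is a bound in
the sense of `IsBigOP`. The event in the latter is defined by a non-strict inequality, hence the
factor `2` in the constant. -/
lemma isBigOP_of_events {Ω : ℕ → Type*} [∀ n, MeasurableSpace (Ω n)] {P : ∀ n, Measure (Ω n)}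
    [∀ n, IsProbabilityMeasure (P n)] {X : ∀ n, Ω n → ℝ} {Y : ℕ → ℝ} {ρ : ℕ → ℝ}
    (hE : ∀ C : ℝ, 0 < C → ∃ A : ℝ, 0 < A ∧ ∃ E : ∀ n, Set (Ω n), ∀ᶠ n in atTop,
      (P n).real (E n)ᶜ ≤ 6 * Real.exp (-(C * ρ n)) ∧ 0 < Y n ∧ ∀ ω ∈ E n, |X n ω| ≤ A * Y n) :
    IsBigOP P X (fun n _ => Y n) ρ := by
  refine ⟨6, by norm_num, fun C hC => ?_⟩
  obtain ⟨A, hA, E, hev⟩ := hE C hC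
  obtain ⟨N, hN⟩ := eventually_atTop.1 hev
  refine ⟨2 * A, by positivity, N, fun n hn => ?_⟩
  obtain ⟨h1, h2, h3⟩ := hN n hn
  refine (measureReal_mono fun ω hω hωE => ?_).trans h1
  have h4 := h3 ω hωE
  simp only [Set.mem_ofPred_eq, abs_of_pos h2] at hω
  have : 0 < A * Y n := by positivity
  linarith

end Assembly

end KPCA

theorem mainTheorem1
    -- probability spaces, separable real Hilbert spaces with orthonormal bases
    {Ω : ℕ → Type*} [∀ n, MeasurableSpace (Ω n)]
    (P : ∀ n, Measure (Ω n)) [∀ n, IsProbabilityMeasure (P n)]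
    {H : ℕ → Type*} [∀ n, NormedAddCommGroup (H n)] [∀ n, InnerProductSpace ℝ (H n)]
    [∀ n, CompleteSpace (H n)] [∀ n, TopologicalSpace.SeparableSpace (H n)]
    [∀ n, MeasurableSpace (H n)] [∀ n, BorelSpace (H n)]
    {ι : ℕ → Type*} (h : ∀ n, HilbertBasis (ι n) ℝ (H n))
    -- signals, noises, samples
    (xbar : ∀ n, Fin n → H n) (z : ∀ n, Fin n → Ω n → H n)
    (x : ∀ n, Ω n → Fin n → H n) (hx : ∀ n ω i, x n ω i = xbar n i + z n i ω)
    -- the block of eigenvalues under study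
    (s r : ℕ → ℕ) (hsr : ∀ n, s n + r n ≤ n) (hr : ∀ᶠ n in atTop, 1 ≤ r n)
    -- eigenvalues and eigenvectors of the Gram matrix of the signals
    (lamBar : ∀ n, Fin n → ℝ) (Vbar : ∀ n, Matrix (Fin n) (Fin n) ℝ)
    (hbar : ∀ n, KPCA.IsEigendecomposition (KPCA.mulTr (xbar n) (xbar n)) (lamBar n) (Vbar n))
    -- the hollowed Gram matrix of the samples, its eigenvalues and eigenvectors
    (G : ∀ n, Ω n → Matrix (Fin n) (Fin n) ℝ)
    (hG : ∀ n ω, G n ω = KPCA.hollow (KPCA.mulTr (x n ω) (x n ω)))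
    (lam : ∀ n, Ω n → Fin n → ℝ) (V : ∀ n, Ω n → Matrix (Fin n) (Fin n) ℝ)
    (hV : ∀ n ω, KPCA.IsEigendecomposition (G n ω) (lam n ω) (V n ω))
    -- the eigenvector blocks, their alignment, and the matrix `H(Z Xᵀ)`
    (Ubar : ∀ n, Matrix (Fin n) (Fin (r n)) ℝ)
    (hUbar : ∀ n, Ubar n = KPCA.blockCols (hsr n) (Vbar n))
    (U : ∀ n, Ω n → Matrix (Fin n) (Fin (r n)) ℝ)
    (hU : ∀ n ω, U n ω = KPCA.blockCols (hsr n) (V n ω))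
    (S : ∀ n, Ω n → Matrix (Fin (r n)) (Fin (r n)) ℝ)
    (hS : ∀ n ω, KPCA.IsMatrixSign ((U n ω)ᵀ * Ubar n) (S n ω))
    (W : ∀ n, Ω n → Matrix (Fin n) (Fin n) ℝ)
    (hW : ∀ n ω, W n ω = KPCA.hollow (KPCA.mulTr (fun i => z n i ω) (x n ω)))
    -- `Λ^{1/2}`, `Λbar^{1/2}`, `Λbar^{-1/2}`, `Λbar^{-1}`
    (LamSqrt : ∀ n, Ω n → Matrix (Fin (r n)) (Fin (r n)) ℝ)
    (hLamSqrt : ∀ n ω, LamSqrt n ω = KPCA.blockDiag (hsr n) (lam n ω) Real.sqrt)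
    (LbarSqrt LbarInvSqrt LbarInv : ∀ n, Matrix (Fin (r n)) (Fin (r n)) ℝ)
    (hLbarSqrt : ∀ n, LbarSqrt n = KPCA.blockDiag (hsr n) (lamBar n) Real.sqrt)
    (hLbarInvSqrt : ∀ n, LbarInvSqrt n =
      KPCA.blockDiag (hsr n) (lamBar n) fun t => (Real.sqrt t)⁻¹)
    (hLbarInv : ∀ n, LbarInv n = KPCA.blockDiag (hsr n) (lamBar n) fun t => t⁻¹)
    -- the eigen-gap is positive and finite; `Δ`, `κ`, `μ`
    (hgap : ∀ᶠ n in atTop, 0 < KPCA.eigengap (lamBar n) (s n) (r n) ∧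
      KPCA.eigengap (lamBar n) (s n) (r n) < ⊤)
    (Δ κ μ : ℕ → ℝ)
    (hΔ : ∀ n, Δ n = KPCA.gap (lamBar n) (s n) (r n))
    (hκ : ∀ n, κ n = KPCA.cond (lamBar n) (s n) (r n))
    (hμ : ∀ n, μ n = KPCA.incoh (xbar n) (r n))
    -- incoherence
    (γ : ℕ → ℝ)
    (hγ_lower : ∀ᶠ n : ℕ in atTop, κ n * μ n * Real.sqrt ((r n : ℝ) / (n : ℝ)) ≤ γ n)
    (hγ_upper : γ =o[atTop] fun n => 1 / (κ n * μ n))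
    -- sub-Gaussianity
    (α : ℝ) (hα : 0 < α) (Sg : ∀ n, H n →L[ℝ] H n)
    (hSg : ∀ n, KPCA.IsPosTraceClass (h n) (Sg n))
    (hz : ∀ n, KPCA.IsSubGaussianNoise (P n) (z n) α (Sg n))
    -- concentration
    (hconc : ∀ᶠ n : ℕ in atTop, Real.sqrt (n : ℝ) *
      max (Real.sqrt (κ n * ‖Sg n‖ / Δ n)) (KPCA.hsNorm (h n) (Sg n) / Δ n) ≤ γ n)
    -- `2 ≤ p ≲ (μ γ)^{-2}`
    (p : ℕ → ℝ) (hp_lower : ∀ᶠ n in atTop, 2 ≤ p n)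
    (hp_upper : p =O[atTop] fun n => ((μ n * γ n) ^ 2)⁻¹) :
    KPCA.IsLittleOP P
      (fun n ω => KPCA.norm2p (p n) (U n ω * S n ω - G n ω * Ubar n * LbarInv n))
      (fun n _ => KPCA.norm2p (p n) (Ubar n)) p ∧
    KPCA.IsLittleOP P
      (fun n ω => KPCA.norm2p (p n)
        (U n ω * S n ω - (Ubar n + W n ω * Ubar n * LbarInv n)))
      (fun n _ => KPCA.norm2p (p n) (Ubar n)) p ∧
    KPCA.IsBigOP P
      (fun n ω => KPCA.norm2p (p n) (U n ω * S n ω))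
      (fun n _ => KPCA.norm2p (p n) (Ubar n)) p ∧
    ((fun n => κ n ^ (3 / 2 : ℝ) * γ n) =o[atTop] (fun _ => (1 : ℝ)) →
      KPCA.IsLittleOP P
        (fun n ω => KPCA.norm2p (p n)
          (U n ω * LamSqrt n ω * S n ω - G n ω * Ubar n * LbarInvSqrt n))
        (fun n _ => KPCA.norm2p (p n) (Ubar n) * KPCA.specNorm (LbarSqrt n)) p ∧
      KPCA.IsLittleOP P
        (fun n ω => KPCA.norm2p (p n)
          (U n ω * LamSqrt n ω * S n ω -
            (Ubar n * LbarSqrt n + W n ω * Ubar n * LbarInvSqrt n)))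
        (fun n _ => KPCA.norm2p (p n) (Ubar n) * KPCA.specNorm (LbarSqrt n)) p) := by
  -- the rate in the `o_P` statements
  set w : ℕ → ℝ := fun n => κ n * μ n * γ n with hw
  have hw0 : Tendsto w atTop (𝓝 0) := by
    refine (hγ_upper.tendsto_div_nhds_zero).congr fun n => ?_
    simp only [hw, div_div_eq_mul_div, div_one]
    ring
  obtain ⟨c, hc⟩ := hp_upper.bound
  have hsec : ∀ n, SecondCountableTopology (H n) := fun n =>
    UniformSpace.secondCountable_of_separable (H n)
  -- the sizes of the signal, for large `n`
  have hsizes : ∀ᶠ n in atTop, 1 ≤ r n ∧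
      KPCA.Sizes (xbar n) (lamBar n) (s n) (r n) (Δ n) (κ n) (μ n) (√((r n : ℝ) / n)) (γ n) ∧
      ∀ hn : 0 < n, κ n * Δ n = lamBar n ⟨0, hn⟩ := by
    filter_upwards [hr, hgap, hγ_lower, hw0.eventually_le_const (by norm_num : (0 : ℝ) < 1 / 2)]
      with n hrn hgapn hγn hwn
    have hκ1 := KPCA.one_le_cond (hsr n) hrn (hbar n) hgapn
    have hμ1 : 1 ≤ KPCA.incoh (xbar n) (r n) := le_max_right _ _
    simp only [hw] at hwn
    rw [hΔ n]
    rw [hκ n, hμ n] at *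
    have hγ0 : 0 ≤ γ n := le_trans (by positivity) hγn
    refine ⟨hrn, KPCA.sizes_of_assumptions (hsr n) hrn (hbar n) hgapn hγn (le_trans ?_ hwn),
      fun hn => KPCA.cond_mul_gap hn (KPCA.gap_spec hgapn).1⟩
    exact le_mul_of_one_le_left hγ0 (one_le_mul_of_one_le_of_one_le hκ1 hμ1)
  -- all the bounds at once, on events of large probability
  have key : ∀ C : ℝ, 0 < C → ∃ A : ℝ, 0 < A ∧ ∃ E : ∀ n, Set (Ω n), ∀ᶠ n in atTop,
      (P n).real (E n)ᶜ ≤ 6 * Real.exp (-(C * p n)) ∧ 0 < w n ∧ 0 < KPCA.norm2p (p n) (Ubar n) ∧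
      0 < KPCA.specNorm (LbarSqrt n) ∧ ∀ ω ∈ E n,
        KPCA.norm2p (p n) (U n ω * S n ω - G n ω * Ubar n * LbarInv n) ≤
          A * (w n * KPCA.norm2p (p n) (Ubar n)) ∧
        KPCA.norm2p (p n) (U n ω * S n ω - (Ubar n + W n ω * Ubar n * LbarInv n)) ≤
          A * (w n * KPCA.norm2p (p n) (Ubar n)) ∧
        KPCA.norm2p (p n) (U n ω * S n ω) ≤ A * KPCA.norm2p (p n) (Ubar n) ∧
        KPCA.norm2p (p n) (U n ω * LamSqrt n ω * S n ω - G n ω * Ubar n * LbarInvSqrt n) ≤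
          A * (w n * (KPCA.norm2p (p n) (Ubar n) * KPCA.specNorm (LbarSqrt n))) ∧
        KPCA.norm2p (p n) (U n ω * LamSqrt n ω * S n ω -
            (Ubar n * LbarSqrt n + W n ω * Ubar n * LbarInvSqrt n)) ≤
          A * (w n * (KPCA.norm2p (p n) (Ubar n) * KPCA.specNorm (LbarSqrt n))) := by
    intro C hC
    set c₁ := max c 0 with hc₁
    have hc₁0 : 0 ≤ c₁ := le_max_right _ _
    set K := KPCA.rateConst α C c₁ with hK
    have hK1 : 1 ≤ K := (KPCA.one_le_opConst α (mul_nonneg hC.le hc₁0)).trans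
      (KPCA.opConst_le_rateConst hα hC.le hc₁0)
    refine ⟨200 * K ^ 2, by positivity, fun n => {ω | KPCA.GoodEvent (hsr n) (xbar n)
      (KPCA.blockCols (hsr n) (Vbar n)) K (Δ n) (μ n) (√((r n : ℝ) / n)) (γ n) (p n)
      fun i => z n i ω}, ?_⟩
    filter_upwards [hsizes, hconc, hp_lower, hc,
      hw0.eventually_le_const (by positivity : 0 < 1 / (100 * K))]
      with n hn hconcn hpn hcn hwn
    obtain ⟨hrn, hS0, hκΔ⟩ := hn
    have hκ1 := hS0.one_le_κ
    have hμ1 := hS0.one_le_μ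
    have hγ0 := hS0.γ_pos
    have hwK : 100 * K * (κ n * μ n * γ n) ≤ 1 := by
      rw [le_div_iff₀ (by positivity)] at hwn
      simp only [hw] at hwn
      linarith
    have hθ : √((r n : ℝ) / n) ^ 2 = r n / n := Real.sq_sqrt (by positivity)
    have hpγ : p n * (μ n * γ n) ^ 2 ≤ c₁ := by
      rw [Real.norm_eq_abs, Real.norm_eq_abs, abs_of_nonneg (by linarith : 0 ≤ p n),
        abs_of_nonneg (by positivity), ← div_eq_mul_inv, le_div_iff₀ (by positivity)] at hcn
      exact hcn.trans (le_max_left _ _)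
    have hsmall : 40 * K * γ n ≤ 1 := by
      have h1 : K * γ n ≤ K * (κ n * μ n * γ n) := by
        gcongr
        exact hS0.γ_le
      have h2 : 0 < K * γ n := by positivity
      linarith
    refine ⟨(hz n).measureReal_not_goodEvent_le (hsr n) hrn hS0 (hbar n) hα (hSg n) hC.le hc₁0 hpn
      hconcn hκΔ hθ hpγ hsmall, by positivity, ?_, ?_, fun ω hω => ?_⟩
    · rw [hUbar n]
      exact KPCA.norm2p_blockCols_pos (hsr n) hrn hpn (hbar n).tmul
    · rw [hLbarSqrt n]
      exact KPCA.specNorm_blockDiag_sqrt_pos (hsr n) hrn hS0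
    · have hSω := hS n ω
      rw [hU n ω, hUbar n] at hSω
      rw [hU n ω, hUbar n, hLbarInv n, hLbarSqrt n, hLbarInvSqrt n, hLamSqrt n ω, hW n ω]
      exact hω.bounds (hsr n) hrn hS0 hK1 hwK hpn hθ (hbar n) (hx n ω) (hG n ω) (hV n ω) hSω
  have habs : ∀ {n k : ℕ} (q : ℝ) (A : Matrix (Fin n) (Fin k) ℝ),
      |KPCA.norm2p q A| = KPCA.norm2p q A := fun q A => abs_of_nonneg (KPCA.norm2p_nonneg A)
  refine ⟨⟨w, hw0, ?_⟩, ⟨w, hw0, ?_⟩, ?_, fun _ => ⟨⟨w, hw0, ?_⟩, ⟨w, hw0, ?_⟩⟩⟩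
  all_goals
    refine KPCA.isBigOP_of_events fun C hC => ?_
    obtain ⟨A, hA, E, hE⟩ := key C hC
    refine ⟨A, hA, E, hE.mono fun n hn => ?_⟩
    obtain ⟨h1, h2, h3, h4, h5⟩ := hn
    refine ⟨h1, by positivity, fun ω hω => ?_⟩
    rw [habs]
  · exact (h5 ω hω).1
  · exact (h5 ω hω).2.1
  · exact (h5 ω hω).2.2.1
  · exact (h5 ω hω).2.2.2.1
  · exact (h5 ω hω).2.2.2.2
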